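/- Let $(M,g)$ be a smooth 4-dimensional Lorentzian manifold of signature $(-,+,+,+)$ and $L(M)$ its bundle of linear frames; a point of $L(M)$ is $u=(x,\{u_a\})$ with $\{u_a\}$ a basis of $T_xM$. On $L(M)$ let $\theta^a$ be the canonical 1-forms, $\Gamma^a{}_b$ the Levi-Civita connection forms, $g_{ab}(u)=g(u_a,u_b)$ (with inverse $g^{ab}$; these lower and raise indices, so $\Gamma_{ab}=g_{ac}\Gamma^c{}_b$), and $\eta_{abcd}(u)=\sqrt{-\det(g_{ab}(u))}\,\epsilon_{abcd}$. Put $\mathcal R_b{}^a=d\Gamma^a{}_b+\Gamma^a{}_c\wedge\Gamma^c{}_b=\frac12R_{cdb}{}^a\theta^c\wedge\theta^d$, $R_{ca}=R_{cda}{}^d$, $R=g^{ab}R_{ab}$, $S_{ab}=\frac12(R_{ab}-\frac16 g_{ab}R)$, $S_a=\theta^bS_{ba}$, and let $\mathcal W_a{}^b=\mathcal R_a{}^b+\theta^b\wedge S_a-\theta_a\wedge S^b$ be the Weyl 2-form, $\mathcal W_{ab}=\frac12W_{cdab}\theta^c\wedge\theta^d$. The Hodge dual of horizontal 3-forms is given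 by $*(\theta^a\wedge\theta^b\wedge\theta^c)=\eta^{abc}{}_d\theta^d$. Round and square brackets denote normalized (anti)symmetrization. Define $$\Omega^{de}{}_{abc}=\tfrac12g_{bc}*(\mathcal W^{de}\wedge\theta_a)+2\delta^e{}_{(b}*(\mathcal W_{c)}{}^d\wedge\theta_a),\qquad \mathcal Z_{abc}=\Omega^{de}{}_{abc}\wedge\Gamma_{de},$$ $$\mathcal T_{abc}=\Omega^{ed}{}_{abc}\wedge\mathcal W_{ed},\qquad \mathcal K_{abc}=2\,\Omega^{[ed]}{}_{abc}\wedge S_e\wedge\theta_d,\qquad \Xi^{de}{}_{abc}=d\Omega^{de}{}_{abc}+\Gamma^d{}_f\wedge\Omega^{fe}{}_{abc}$$ ($\mathcal Z$ is the superenergy potential and $\mathcal T$ the Bel–Robinson 3-form). Then: 1. On $L(M)$, $$d\mathcal Z_{abc}=\Xi^{de}{}_{abc}\wedge\Gamma_{de}+\mathcal K_{abc}+\mathcal T_{abc}.$$ 2. Call an $\mathbb R^m$-valued form $\omega$ on $L(M)$ pseudo-tensorial of type $\rho$ if $\tilde R_h^*\omega=\rho(h^{-1})\omega$ for every $h\in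 GL(4,\mathbb R)$, where $\tilde R_h$ is the right action and $\rho$ a representation of $GL(4,\mathbb R)$ on $\mathbb R^m$; call it tensorial if moreover it vanishes whenever one of its arguments is vertical. Then $\mathcal T_{abc}$ and $\mathcal K_{abc}$ are tensorial and $\Xi^{de}{}_{abc}$ is pseudo-tensorial, the type being in each case the tensor representation indicated by the indices times $\operatorname{sign}\det h$. At a point of $L(M)$ where the Weyl tensor does not vanish, $\Xi$ is not horizontal, so it is not tensorial unless the Weyl tensor vanishes identically. 3. For every smooth local section $\sigma$ of $L(M)$ over an open set $U\subseteq M$, the 1-forms on $U$ obtained by pulling back by $\sigma$ and then taking the Hodge dual (with the orientation of the frame $\sigma$) satisfy $$\operatorname{div}\big({*}\,\sigma^*d\mathcal Z_{abc}\big)=0,\qquad \operatorname{div}\big({*}\,\sigma^*(\Xi^{de}{}_{abc}\wedge\Gamma_{de})+{*}\,\sigma^*\mathcal K_{abc}+{*}\,\sigma^*\mathcal T_{abc}\big)=0,$$ where $\operatorname{div}$ is the divergence of $g$. 4. $*\mathcal K_{abc}=\theta^jK_{jabc}$ with $$K_{jabc}=S_c{}^dW_{abjd}+S_b{}^dW_{acjd}+S_a{}^dW_{bdcj}+S_a{}^dW_{bjcd}-g_{bc}S^{de}W_{adje}-2g_{aj}S^{de}W_{bdce}+g_{ac}S^{de}W_{bdje}+g_{ab}S^{de}W_{cdje},$$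 and $K_{jabc}=K_{jacb}$, $K_{j}{}^{a}{}_{ac}=0$, $K_{ja}{}^{b}{}_{b}=0$; consequently $g^{ab}\mathcal K_{abc}=0=g^{bc}\mathcal K_{abc}$. 5. If $\sigma$ is a smooth local section along which the functions $g_{ab}$ are constant (for instance an orthonormal frame field), then the identity in 1, pulled back by $\sigma$, also holds with $\Xi^{de}{}_{abc}$ replaced by $d\Omega^{de}{}_{abc}+\Gamma^e{}_f\wedge\Omega^{df}{}_{abc}$. -/

import Mathlib

open scoped Manifold ContDiff BigOperators

noncomputable section

namespace Superenergy

/-! ## Differential forms on a normed space -/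

section Forms

variable {V : Type*} [NormedAddCommGroup V] [NormedSpace ℝ V]

/-- Alternating `k`-linear forms on `V`. -/
abbrev Alt (V : Type*) [NormedAddCommGroup V] [NormedSpace ℝ V] (k : ℕ) : Type _ :=
  V [⋀^Fin k]→L[ℝ] ℝ

/-- Differential `k`-forms on (open subsets of) `V`. -/
abbrev Form (V : Type*) [NormedAddCommGroup V] [NormedSpace ℝ V] (k : ℕ) : Type _ :=
  V → V [⋀^Fin k]→L[ℝ] ℝ

/-- A linear functional regarded as an alternating `1`-form. -/
def oneForm (f : V →L[ℝ] ℝ) : Alt V 1 :=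
  ContinuousAlternatingMap.ofSubsingleton ℝ V ℝ (0 : Fin 1) f

/-- The multilinear map `(v₁, …, v_{k+l}) ↦ α(v₁, …, v_k) β(v_{k+1}, …, v_{k+l})`. -/
def tensorForms {k l : ℕ} (α : Alt V k) (β : Alt V l) :
    ContinuousMultilinearMap ℝ (fun _ : Fin (k + l) => V) ℝ where
  toMultilinearMap :=
    ((LinearMap.mul' ℝ ℝ).compMultilinearMap
      (MultilinearMap.domCoprod α.toMultilinearMap β.toMultilinearMap)).domDomCongr finSumFinEquiv
  cont := by
    change Continuous fun v : Fin (k + l) → V =>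
      α (fun i => v (finSumFinEquiv (Sum.inl i))) * β (fun j => v (finSumFinEquiv (Sum.inr j)))
    fun_prop

theorem tensorForms_apply {k l : ℕ} (α : Alt V k) (β : Alt V l) (v : Fin (k + l) → V) :
    tensorForms α β v = α (fun i => v (Fin.castAdd l i)) * β (fun j => v (Fin.natAdd k j)) :=
  rfl

/-- The wedge product
`(α ∧ β)(v) = (1 / (k! l!)) ∑_σ sign σ α(v_{σ 1}, …, v_{σ k}) β(v_{σ (k+1)}, …, v_{σ (k+l)})`. -/
def wedge {k l : ℕ} (α : Alt V k) (β : Alt V l) : Alt V (k + l) :=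
  ((k.factorial * l.factorial : ℝ))⁻¹ •
    ContinuousMultilinearMap.alternatization (tensorForms α β)

/-- The alternating symbol, normalised by `ε 0 1 2 3 = 1`. -/
def eps (a b c d : Fin 4) : ℝ :=
  Matrix.det (Matrix.of fun i j : Fin 4 => if ![a, b, c, d] i = j then (1 : ℝ) else 0)

/-- Components `η_{abcd} = √(-det g) ε_{abcd}` of the volume element in a frame in which the
metric has the components `g`. -/
def eta (g : Matrix (Fin 4) (Fin 4) ℝ) (a b c d : Fin 4) : ℝ :=
  Real.sqrt (-g.det) * eps a b c d

/-- `η^{abc}_d`. -/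
def etaUp (g : Matrix (Fin 4) (Fin 4) ℝ) (a b c d : Fin 4) : ℝ :=
  ∑ a', ∑ b', ∑ c', g⁻¹ a a' * g⁻¹ b b' * g⁻¹ c c' * eta g a' b' c' d

/-- The Hodge dual of a `3`-form `α = (1/3!) α_{abc} θ^a ∧ θ^b ∧ θ^c`, where `θ` is a coframe dual to
the vectors `e`, so that `α_{abc} = α(e_a, e_b, e_c)`; it is the linear operation that is determined
by `*(θ^a ∧ θ^b ∧ θ^c) = η^{abc}_d θ^d`. -/
def hodgeThree (g : Matrix (Fin 4) (Fin 4) ℝ) (e : Fin 4 → V) (θ : Fin 4 → Alt V 1)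
    (α : Alt V 3) : Alt V 1 :=
  ∑ d, ((1 / 6 : ℝ) * ∑ a, ∑ b, ∑ c, α ![e a, e b, e c] * etaUp g a b c d) • θ d

end Forms

/-! ## The frame bundle and its natural charts -/

/-- The coordinate space of a 4-manifold. -/
abbrev E4 : Type := EuclideanSpace ℝ (Fin 4)

/-- The coordinate space of the frame bundle: a pair `(y, A)` stands for the coordinates `y` of the
base point and the matrix `A` whose column `A · a` lists the coordinate components of the frame
vector `u_a`. -/
abbrev F20 : Type := E4 × (Fin 4 → Fin 4 → ℝ)

/-- The coordinate basis of `E4`. -/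
def stdVec (i : Fin 4) : E4 := EuclideanSpace.single i 1

section Manifold

variable {M : Type*} [TopologicalSpace M] [ChartedSpace E4 M]

/-- A smooth Lorentzian metric of signature `(-,+,+,+)`. Smoothness means that the components are
smooth functions of the coordinates in every chart of the smooth structure. -/
structure LorentzMetric (M : Type*) [TopologicalSpace M] [ChartedSpace E4 M] where
  /-- the scalar product on each tangent space -/
  val : ∀ x : M, TangentSpace (𝓡 4) x →ₗ[ℝ] TangentSpace (𝓡 4) x →ₗ[ℝ] ℝ
  symm : ∀ (x : M) (v w : TangentSpace (𝓡 4) x), val x v w = val x w v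
  signature : ∀ x : M, ∃ b : Module.Basis (Fin 4) ℝ (TangentSpace (𝓡 4) x),
    ∀ i j, val x (b i) (b j) = if i = j then (if i = 0 then -1 else 1) else 0
  smooth : ∀ φ ∈ IsManifold.maximalAtlas (𝓡 4) ∞ M, ∀ i j : Fin 4,
    ContDiffOn ℝ ∞ (fun y : E4 => val (φ.symm y)
      (mfderiv (𝓡 4) (𝓡 4) φ.symm y (stdVec i)) (mfderiv (𝓡 4) (𝓡 4) φ.symm y (stdVec j))) φ.target

/-- The components `g(∂_i, ∂_j)` of the metric in a chart, as functions of the coordinates. -/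
def LorentzMetric.coord (g : LorentzMetric M) (φ : OpenPartialHomeomorph M E4) (y : E4) :
    Matrix (Fin 4) (Fin 4) ℝ :=
  Matrix.of fun i j => g.val (φ.symm y)
    (mfderiv (𝓡 4) (𝓡 4) φ.symm y (stdVec i)) (mfderiv (𝓡 4) (𝓡 4) φ.symm y (stdVec j))

/-- The bundle of linear frames `L(M)`: a point is a point of `M` with a basis of the tangent
space there. -/
structure FrameBundle (M : Type*) [TopologicalSpace M] [ChartedSpace E4 M] where
  /-- the projection `π : L(M) → M` -/
  base : M
  /-- the frame `u_1, …, u_4` -/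
  frame : Module.Basis (Fin 4) ℝ (TangentSpace (𝓡 4) base)

/-- The natural chart of `L(M)` that is induced by a chart `φ` of `M`, with domain
`π⁻¹(φ.source)`. -/
def FrameBundle.coord (φ : OpenPartialHomeomorph M E4) (u : FrameBundle M) : F20 :=
  (φ u.base, fun μ a => (show E4 from mfderiv (𝓡 4) (𝓡 4) φ u.base (u.frame a)) μ)

/-- The open subset of the coordinate space that is the range of the natural chart. -/
def frameDomain (φ : OpenPartialHomeomorph M E4) : Set F20 :=
  {p | p.1 ∈ φ.target ∧ (Matrix.of p.2).det ≠ 0}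

/-- A smooth local section `σ` of `L(M)` over the open set `U` (that is, a smooth frame field on
`U`); the values of `σ` outside `U` are irrelevant. -/
def IsLocalSection (U : Set M) (σ : M → FrameBundle M) : Prop :=
  IsOpen U ∧ (∀ x ∈ U, (σ x).base = x) ∧
    ∀ φ ∈ IsManifold.maximalAtlas (𝓡 4) ∞ M,
      ContDiffOn ℝ ∞ (fun y : E4 => (σ (φ.symm y)).coord φ) (φ.target ∩ φ.symm ⁻¹' U)

/-- The coordinate expression `y ↦ (y, A(y))` of a section. -/
def sectionCoord (φ : OpenPartialHomeomorph M E4) (σ : M → FrameBundle M) (y : E4) : F20 :=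
  (σ (φ.symm y)).coord φ

end Manifold

/-! ## The geometry of `L(M)` in a natural chart

`G` is the matrix of components of the metric in the coordinates of `M`, and `p = (y, A)`. -/

section Geometry

variable (G : E4 → Matrix (Fin 4) (Fin 4) ℝ)

/-- The partial derivative `∂_i f`. -/
def pd (i : Fin 4) (f : E4 → ℝ) (y : E4) : ℝ := fderiv ℝ f y (stdVec i)

/-- The Christoffel symbols `Γ^m_{ij}` of the Levi-Civita connection. -/
def christoffel (m i j : Fin 4) (y : E4) : ℝ :=
  (1 / 2) * ∑ r, (G y)⁻¹ m r *
    (pd i (fun z => G z r j) y + pd j (fun z => G z r i) y - pd r (fun z => G z i j) y)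

/-- The matrix `A` of a frame. -/
def frameMat (p : F20) : Matrix (Fin 4) (Fin 4) ℝ := Matrix.of p.2

/-- The functions `g_{ab}(u) = g(u_a, u_b)` on `L(M)`; the inverse matrix is `g^{ab}(u)`. -/
def gFrame (p : F20) : Matrix (Fin 4) (Fin 4) ℝ :=
  Matrix.of fun a b => ∑ i, ∑ j, G p.1 i j * p.2 i a * p.2 j b

/-- `g^{ab}(u)`. -/
def gInv (p : F20) : Matrix (Fin 4) (Fin 4) ℝ := (gFrame G p)⁻¹

/-- The coordinate differential `dx^i` on `L(M)`. -/
def dBase (i : Fin 4) : F20 →L[ℝ] ℝ :=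
  (EuclideanSpace.proj i : E4 →L[ℝ] ℝ).comp (ContinuousLinearMap.fst ℝ E4 (Fin 4 → Fin 4 → ℝ))

/-- The coordinate differential `dA^i_a` on `L(M)`. -/
def dFrame (i a : Fin 4) : F20 →L[ℝ] ℝ :=
  ((ContinuousLinearMap.proj a : (Fin 4 → ℝ) →L[ℝ] ℝ).comp
    (ContinuousLinearMap.proj i : (Fin 4 → Fin 4 → ℝ) →L[ℝ] (Fin 4 → ℝ))).comp
    (ContinuousLinearMap.snd ℝ E4 (Fin 4 → Fin 4 → ℝ))

/-- The canonical forms `θ^a = (A⁻¹)^a_i dx^i`, so that `π_* X = θ^a(X) u_a`. -/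
def theta (a : Fin 4) : Form F20 1 := fun p =>
  oneForm (∑ i, (frameMat p)⁻¹ a i • dBase i)

/-- The Levi-Civita connection forms
`Γ^a_b = (A⁻¹)^a_m (dA^m_b + Γ^m_{ij} A^j_b dx^i)`. -/
def conn (a b : Fin 4) : Form F20 1 := fun p =>
  oneForm (∑ m, (frameMat p)⁻¹ a m •
    (dFrame m b + ∑ i, (∑ j, christoffel G m i j p.1 * p.2 j b) • dBase i))

/-- `Γ_{ab} = g_{ac} Γ^c_b`. -/
def connLow (a b : Fin 4) : Form F20 1 := fun p => ∑ c, gFrame G p a c • conn G c b p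

/-- `θ_a = g_{ab} θ^b`. -/
def thetaLow (a : Fin 4) : Form F20 1 := fun p => ∑ b, gFrame G p a b • theta b p

/-- The standard horizontal vector fields: `θ^b(H_a) = δ^b_a` and `Γ^b_c(H_a) = 0`. -/
def horiz (p : F20) (a : Fin 4) : F20 :=
  (WithLp.toLp 2 fun i => p.2 i a,
    fun m b => -∑ i, ∑ j, christoffel G m i j p.1 * p.2 i a * p.2 j b)

/-- The curvature forms `ℛ_b^a = dΓ^a_b + Γ^a_c ∧ Γ^c_b`; the lower index comes first. -/
def curv (b a : Fin 4) : Form F20 2 := fun p =>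
  extDeriv (conn G a b) p + ∑ c, wedge (conn G a c p) (conn G c b p)

/-- The Riemann tensor `R_{cda}^b`, given by `ℛ_a^b = ½ R_{cda}^b θ^c ∧ θ^d`. -/
def riem (c d a b : Fin 4) (p : F20) : ℝ := curv G a b p ![horiz G p c, horiz G p d]

/-- The Ricci tensor `R_{ca} = R_{cda}^d`. -/
def ricci (c a : Fin 4) (p : F20) : ℝ := ∑ d, riem G c d a d p

/-- The scalar curvature `R = g^{ab} R_{ab}`. -/
def scalarCurv (p : F20) : ℝ := ∑ a, ∑ b, gInv G p a b * ricci G a b p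

/-- The Schouten tensor `S_{ab} = ½ (R_{ab} - (1/6) g_{ab} R)`. -/
def schouten (a b : Fin 4) (p : F20) : ℝ :=
  (1 / 2) * (ricci G a b p - (1 / 6) * gFrame G p a b * scalarCurv G p)

/-- `S_a^b = S_{ac} g^{cb}`. -/
def schoutenMix (a b : Fin 4) (p : F20) : ℝ := ∑ c, schouten G a c p * gInv G p c b

/-- `S^{ab}`. -/
def schoutenUp (a b : Fin 4) (p : F20) : ℝ := ∑ c, gInv G p a c * schoutenMix G c b p

/-- The Schouten forms `S_a = θ^b S_{ba}`. -/
def schoutenForm (a : Fin 4) : Form F20 1 := fun p => ∑ b, schouten G b a p • theta b p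

/-- `S^a = g^{ab} S_b`. -/
def schoutenFormUp (a : Fin 4) : Form F20 1 := fun p =>
  ∑ b, gInv G p a b • schoutenForm G b p

/-- The Weyl forms `𝒲_a^b = ℛ_a^b + θ^b ∧ S_a - θ_a ∧ S^b`. -/
def weyl (a b : Fin 4) : Form F20 2 := fun p =>
  curv G a b p + wedge (theta b p) (schoutenForm G a p)
    - wedge (thetaLow G a p) (schoutenFormUp G b p)

/-- `𝒲_{ab} = 𝒲_a^c g_{cb}`. -/
def weylLow (a b : Fin 4) : Form F20 2 := fun p => ∑ c, gFrame G p c b • weyl G a c p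

/-- `𝒲^{ab} = g^{ac} 𝒲_c^b`. -/
def weylUp (a b : Fin 4) : Form F20 2 := fun p => ∑ c, gInv G p a c • weyl G c b p

/-- The Weyl tensor `W_{cdab}`, given by `𝒲_{ab} = ½ W_{cdab} θ^c ∧ θ^d`. -/
def weylTensor (c d a b : Fin 4) (p : F20) : ℝ :=
  weylLow G a b p ![horiz G p c, horiz G p d]

/-- The Hodge dual of a horizontal `3`-form on `L(M)`. -/
def hodge (α : Form F20 3) : Form F20 1 := fun p =>
  hodgeThree (gFrame G p) (horiz G p) (fun d => theta d p) (α p)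

/-- The Kronecker symbol. -/
def kron (a b : Fin 4) : ℝ := if a = b then 1 else 0

/-- `Ω^{de}_{abc} = ½ g_{bc} *(𝒲^{de} ∧ θ_a) + 2 δ^e_{(b} *(𝒲_{c)}^d ∧ θ_a)`. -/
def omega (d e a b c : Fin 4) : Form F20 1 := fun p =>
  ((1 / 2) * gFrame G p b c) • hodge G (fun q => wedge (weylUp G d e q) (thetaLow G a q)) p
  + kron e b • hodge G (fun q => wedge (weyl G c d q) (thetaLow G a q)) p
  + kron e c • hodge G (fun q => wedge (weyl G b d q) (thetaLow G a q)) p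

/-- The superenergy potential `𝒵_{abc} = Ω^{de}_{abc} ∧ Γ_{de}`. -/
def potential (a b c : Fin 4) : Form F20 2 := fun p =>
  ∑ d, ∑ e, wedge (omega G d e a b c p) (connLow G d e p)

/-- The Bel-Robinson form `𝒯_{abc} = Ω^{ed}_{abc} ∧ 𝒲_{ed}`. -/
def belRobinson (a b c : Fin 4) : Form F20 3 := fun p =>
  ∑ e, ∑ d, wedge (omega G e d a b c p) (weylLow G e d p)

/-- The form `𝒦_{abc} = 2 Ω^{[ed]}_{abc} ∧ S_e ∧ θ_d`. -/
def kForm (a b c : Fin 4) : Form F20 3 := fun p =>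
  ∑ e, ∑ d, wedge (omega G e d a b c p - omega G d e a b c p)
    (wedge (schoutenForm G e p) (thetaLow G d p))

/-- `Ξ^{de}_{abc} = dΩ^{de}_{abc} + Γ^d_f ∧ Ω^{fe}_{abc}`. -/
def xi (d e a b c : Fin 4) : Form F20 2 := fun p =>
  extDeriv (omega G d e a b c) p + ∑ f, wedge (conn G d f p) (omega G f e a b c p)

/-- The variant `dΩ^{de}_{abc} + Γ^e_f ∧ Ω^{df}_{abc}` of `Ξ^{de}_{abc}`, with the connection acting on
the second index. -/
def xiSnd (d e a b c : Fin 4) : Form F20 2 := fun p =>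
  extDeriv (omega G d e a b c) p + ∑ f, wedge (conn G e f p) (omega G d f a b c p)

/-- `Ξ^{de}_{abc} ∧ Γ_{de}`. -/
def xiConn (a b c : Fin 4) : Form F20 3 := fun p =>
  ∑ d, ∑ e, wedge (xi G d e a b c p) (connLow G d e p)

/-- The variant of `Ξ^{de}_{abc} ∧ Γ_{de}` with the connection acting on the second index. -/
def xiSndConn (a b c : Fin 4) : Form F20 3 := fun p =>
  ∑ d, ∑ e, wedge (xiSnd G d e a b c p) (connLow G d e p)

/-- The tensor
`K_{jabc} = S_c^d W_{abjd} + S_b^d W_{acjd} + S_a^d W_{bdcj} + S_a^d W_{bjcd} - g_{bc} S^{de} W_{adje}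
  - 2 g_{aj} S^{de} W_{bdce} + g_{ac} S^{de} W_{bdje} + g_{ab} S^{de} W_{cdje}`. -/
def kTensor (j a b c : Fin 4) (p : F20) : ℝ :=
  ∑ d, (schoutenMix G c d p * weylTensor G a b j d p
    + schoutenMix G b d p * weylTensor G a c j d p
    + schoutenMix G a d p * weylTensor G b d c j p
    + schoutenMix G a d p * weylTensor G b j c d p)
  + ∑ d, ∑ e, schoutenUp G d e p *
    (-(gFrame G p b c * weylTensor G a d j e p)
      - 2 * gFrame G p a j * weylTensor G b d c e p
      + gFrame G p a c * weylTensor G b d j e p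
      + gFrame G p a b * weylTensor G c d j e p)

end Geometry

/-! ## Pseudo-tensorial and tensorial forms -/

section Tensorial

/-- The right action `(y, A) ↦ (y, A h)` of a matrix on the frame bundle. -/
def rightAct (h : Matrix (Fin 4) (Fin 4) ℝ) : F20 →ₗ[ℝ] F20 where
  toFun p := (p.1, fun i a => ∑ b, p.2 i b * h b a)
  map_add' p q := by
    ext <;> simp [add_mul, Finset.sum_add_distrib]
  map_smul' r p := by
    ext <;> simp [Finset.mul_sum, mul_assoc]

/-- An `ℝ^ι`-valued form `α` on the domain `D` is pseudo-tensorial of type `ρ` if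
`R_h^* α = ρ(h⁻¹) α` for all `h` in `GL(4, ℝ)`. (The right action is linear in the coordinates, so it
is its own derivative.) -/
def IsPseudoTensorial {ι : Type*} {k : ℕ} (D : Set F20)
    (ρ : Representation ℝ (GL (Fin 4) ℝ) (ι → ℝ)) (α : ι → Form F20 k) : Prop :=
  ∀ h : GL (Fin 4) ℝ, ∀ p ∈ D, ∀ (v : Fin k → F20) (i : ι),
    α i (rightAct h.val p) (fun n => rightAct h.val (v n)) = ρ h⁻¹ (fun j => α j p v) i

/-- A tangent vector is vertical if it is annihilated by all the canonical forms. -/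
def IsVertical (p v : F20) : Prop := ∀ a, theta a p ![v] = 0

/-- The form `α` at the point `p` vanishes as soon as one of its arguments is vertical. -/
def IsHorizontalAt {k : ℕ} (p : F20) (α : Alt F20 k) : Prop :=
  ∀ v : Fin k → F20, (∃ n, IsVertical p (v n)) → α v = 0

/-- A pseudo-tensorial form is tensorial if it is horizontal. -/
def IsTensorial {ι : Type*} {k : ℕ} (D : Set F20)
    (ρ : Representation ℝ (GL (Fin 4) ℝ) (ι → ℝ)) (α : ι → Form F20 k) : Prop :=
  IsPseudoTensorial D ρ α ∧ ∀ i, ∀ p ∈ D, IsHorizontalAt p (α i p)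

/-- Multi-indices with `r` upper and `s` lower entries. -/
abbrev MultiIndex (r s : ℕ) : Type := (Fin r → Fin 4) × (Fin s → Fin 4)

/-- The matrix `h^{a₁}_{a'₁} ⋯ (h⁻¹)^{b'₁}_{b₁} ⋯` of the action of `h` on tensors. -/
def tensorMat (r s : ℕ) (h : GL (Fin 4) ℝ) : Matrix (MultiIndex r s) (MultiIndex r s) ℝ :=
  Matrix.of fun I J => (∏ k, h.val (I.1 k) (J.1 k)) * ∏ k, h⁻¹.val (J.2 k) (I.2 k)

theorem tensorMat_one (r s : ℕ) : tensorMat r s 1 = 1 := by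
  ext I J
  by_cases hIJ : I = J
  · subst hIJ; simp [tensorMat]
  · rw [Matrix.one_apply_ne hIJ]
    by_cases h1 : I.1 = J.1
    · have h2 : I.2 ≠ J.2 := fun h2 => hIJ (Prod.ext h1 h2)
      obtain ⟨k, hk⟩ := Function.ne_iff.mp h2
      simp only [tensorMat, Matrix.of_apply]
      rw [Finset.prod_eq_zero (s := Finset.univ) (i := k)
        (f := fun k => (1 : GL (Fin 4) ℝ)⁻¹.val (J.2 k) (I.2 k)) (Finset.mem_univ k), mul_zero]
      simp [Matrix.one_apply_ne (Ne.symm hk)]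
    · obtain ⟨k, hk⟩ := Function.ne_iff.mp h1
      simp only [tensorMat, Matrix.of_apply]
      rw [Finset.prod_eq_zero (s := Finset.univ) (i := k)
        (f := fun k => (1 : GL (Fin 4) ℝ).val (I.1 k) (J.1 k)) (Finset.mem_univ k), zero_mul]
      simp [Matrix.one_apply_ne hk]

theorem tensorMat_mul (r s : ℕ) (h h' : GL (Fin 4) ℝ) :
    tensorMat r s (h * h') = tensorMat r s h * tensorMat r s h' := by
  ext I J
  simp only [tensorMat, Matrix.of_apply, Matrix.mul_apply, Fintype.sum_prod_type, mul_inv_rev,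
    Units.val_mul]
  rw [Finset.prod_univ_sum, Finset.prod_univ_sum]
  simp only [Fintype.piFinset_univ, Finset.prod_mul_distrib]
  rw [Finset.sum_mul_sum]
  refine Finset.sum_congr rfl fun x _ => Finset.sum_congr rfl fun y _ => ?_
  ring

/-- The sign of the determinant. -/
def detSign (h : GL (Fin 4) ℝ) : ℝ := ((SignType.sign h.val.det : SignType) : ℝ)

theorem detSign_one : detSign 1 = 1 := by simp [detSign]

theorem detSign_mul (h h' : GL (Fin 4) ℝ) : detSign (h * h') = detSign h * detSign h' := by
  simp [detSign, sign_mul]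

/-- The representation of `GL(4, ℝ)` on tensors with `r` upper and `s` lower indices, twisted by the
sign of the determinant: the type of tensors built with one factor of the volume element
`η_{abcd} = √(-g) ε_{abcd}`. On matrices of positive determinant it is the usual tensor
representation. -/
def twistedRep (r s : ℕ) : Representation ℝ (GL (Fin 4) ℝ) (MultiIndex r s → ℝ) where
  toFun h := detSign h • Matrix.toLin' (tensorMat r s h)
  map_one' := by
    rw [detSign_one, tensorMat_one, Matrix.toLin'_one, one_smul]; rfl
  map_mul' h h' := by
    rw [detSign_mul, tensorMat_mul, Matrix.toLin'_mul, mul_smul, Module.End.mul_eq_comp,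
      LinearMap.smul_comp, LinearMap.comp_smul]

end Tensorial

/-! ## Pull-backs to `M` by sections, in a chart of `M` -/

section PullBack

variable (G : E4 → Matrix (Fin 4) (Fin 4) ℝ)

/-- The pull-back of a form on `L(M)` by a section `s`. -/
def pullback {k : ℕ} (s : E4 → F20) (α : Form F20 k) : Form E4 k := fun y =>
  (α (s y)).compContinuousLinearMap (fderiv ℝ s y)

/-- The Hodge dual of a `3`-form on `M`, taken in the frame given by the section `s` (with the
orientation of that frame). -/
def starBase (s : E4 → F20) (β : Form E4 3) : Form E4 1 := fun y =>
  hodgeThree (gFrame G (s y)) (fun a => WithLp.toLp 2 fun i => (s y).2 i a)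
    (fun d => oneForm (∑ i, (frameMat (s y))⁻¹ d i • (EuclideanSpace.proj i : E4 →L[ℝ] ℝ))) (β y)

/-- The divergence `(1/√|det g|) ∂_i (√|det g| g^{ij} J_j)` of a `1`-form on `M`. -/
def divergence (J : Form E4 1) (y : E4) : ℝ :=
  (Real.sqrt |(G y).det|)⁻¹ * ∑ i, pd i (fun z =>
    Real.sqrt |(G z).det| * ∑ j, (G z)⁻¹ i j * J z ![stdVec j]) y

end PullBack

end Superenergy

end

open Superenergy

open scoped Manifold ContDiff BigOperators

noncomputable section

namespace Superenergy

/-! ### Wedge products and exterior derivatives evaluated on vectors -/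

section Wedge

variable {V : Type*} [NormedAddCommGroup V] [NormedSpace ℝ V]

/-! In a natural chart everything depends on one function `G`, the matrix of metric components;
`LorentzMetric.isLorentzOn_coord` shows that `G` is smooth, symmetric and of negative determinant,
and all later arguments use only this. Forms are evaluated on vectors and their values collected
into 4×4 matrices, so that index computations become matrix algebra: the connection is A⁻¹(dA + ΓA),
the curvature is A⁻¹BA with B the curvature of the base, and contractions are traces.

The differential identity uses of Ω only that it is a smooth 1-form. The structure equation and
dg_{de} = Γ_{de} + Γ_{ed} give dΓ_{de} = Γ^f_d ∧ Γ_{fe} + ℛ_{ed} (`IsLorentzOn.extDeriv_connLow`).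
In d(Ω ∧ Γ) = dΩ ∧ Γ - Ω ∧ dΓ the quadratic term completes dΩ to Ξ, while the decomposition of
ℛ_{ed} into its Weyl and Schouten parts (`curvLow_eq`) yields 𝒯 and 𝒦.

For the transformation laws, the Hodge dual of a 3-form acquires exactly the sign of det h under a
change of frame (`hodgeThree_change`), all other ingredients are tensorial, and a contraction of
upper with lower indices is invariant (`pairing_congr`). The law for Ω can be differentiated,
because the right action is linear in the chart. That Ξ is not horizontal is seen on the vertical
vector (0, A) generating dilations of the frame: Ω is homogeneous of degree one along it and the
connection takes the value 1 on it, so Ξ((0, A), ·) = 2Ω (`IsLorentzOn.xiMat_scale`). If this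
vanishes, a trace and the injectivity of the dual force the Weyl tensor to vanish.

The formula for *𝒦 rests on *(*α ∧ β ∧ γ) = α(β♯, γ♯, ·) (`dualCoef_dualCoef_wedge`), followed by
the algebraic symmetries of the Weyl tensor. The conservation law holds because, in coordinates, the
divergence of the dual of a 3-form β is a metric factor times the ε-contraction of the first
derivatives of β, and this vanishes when dβ = 0; here β is the pull-back of an exact form. Along a
frame with constant g_{ab} the pulled back Γ_{ab} is skew, and a trace identity
(`pairing_skew_swap`) moves the connection from one index of Ω to the other. -/

theorem sum_perm_two {A : Type*} [AddCommMonoid A] (f : Equiv.Perm (Fin 2) → A) :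
    ∑ σ, f σ = f 1 + f (Equiv.swap 0 1) := by
  have h : (Finset.univ : Finset (Equiv.Perm (Fin 2))) = {1, Equiv.swap 0 1} := by decide
  rw [h, Finset.sum_pair (by decide)]

theorem sum_perm_three {A : Type*} [AddCommMonoid A] (f : Equiv.Perm (Fin 3) → A) :
    ∑ σ, f σ = f 1 + (f (Equiv.swap 0 1) + (f (Equiv.swap 0 2) + (f (Equiv.swap 1 2) +
      (f (Equiv.swap 0 1 * Equiv.swap 1 2) + f (Equiv.swap 1 2 * Equiv.swap 0 1))))) := by
  have h : (Finset.univ : Finset (Equiv.Perm (Fin 3))) =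
      {1, Equiv.swap 0 1, Equiv.swap 0 2, Equiv.swap 1 2,
        Equiv.swap 0 1 * Equiv.swap 1 2, Equiv.swap 1 2 * Equiv.swap 0 1} := by decide
  rw [h]
  repeat rw [Finset.sum_insert (by decide)]
  rw [Finset.sum_singleton]

theorem wedge_apply {k l : ℕ} (α : Alt V k) (β : Alt V l) (v : Fin (k + l) → V) :
    wedge α β v = ((k.factorial * l.factorial : ℝ))⁻¹ *
      ∑ σ : Equiv.Perm (Fin (k + l)), Equiv.Perm.sign σ •
        (α (fun i => v (σ (Fin.castAdd l i))) * β (fun j => v (σ (Fin.natAdd k j)))) := by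
  simp only [wedge, ContinuousAlternatingMap.smul_apply, smul_eq_mul,
    ContinuousMultilinearMap.alternatization_apply_apply]
  rfl

theorem map_swap_two (α : Alt V 2) (v w : V) : α ![v, w] = -α ![w, v] := by
  have h := α.toAlternatingMap.map_swap ![w, v] (i := 0) (j := 1) (by decide)
  have e : (![w, v] ∘ Equiv.swap (0 : Fin 2) 1) = ![v, w] := by
    ext i; fin_cases i <;> rfl
  rw [e] at h
  exact h

theorem wedge_one_one (α β : Alt V 1) (v w : V) :
    wedge α β ![v, w] = α ![v] * β ![w] - α ![w] * β ![v] := by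
  have e1 : ∀ x : Fin 1 → V, x = ![x 0] := fun x => by ext i; fin_cases i; rfl
  have k1 : ∀ σ : Equiv.Perm (Fin 2), (fun i : Fin 1 => ![v, w] (σ (Fin.castAdd 1 i)))
    = ![![v, w] (σ 0)] := fun σ => e1 _
  have k2 : ∀ σ : Equiv.Perm (Fin 2), (fun i : Fin 1 => ![v, w] (σ (Fin.natAdd 1 i)))
    = ![![v, w] (σ 1)] := fun σ => e1 _
  rw [wedge_apply, sum_perm_two]
  erw [k1, k1, k2, k2]
  simp
  ring

theorem wedge_one_two (α : Alt V 1) (β : Alt V 2) (u v w : V) :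
    wedge α β ![u, v, w] = α ![u] * β ![v, w] - α ![v] * β ![u, w] + α ![w] * β ![u, v] := by
  have e1 : ∀ x : Fin 1 → V, x = ![x 0] := fun x => by ext i; fin_cases i; rfl
  have e2 : ∀ x : Fin 2 → V, x = ![x 0, x 1] := fun x => by ext i; fin_cases i <;> rfl
  have k1 : ∀ σ : Equiv.Perm (Fin 3), (fun i : Fin 1 => ![u, v, w] (σ (Fin.castAdd 2 i)))
    = ![![u, v, w] (σ 0)] := fun σ => e1 _
  have k2 : ∀ σ : Equiv.Perm (Fin 3), (fun i : Fin 2 => ![u, v, w] (σ (Fin.natAdd 1 i)))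
    = ![![u, v, w] (σ 1), ![u, v, w] (σ 2)] := fun σ => e2 _
  have s1 : Equiv.swap (0 : Fin 3) 1 2 = 2 := by decide
  have s2 : Equiv.swap (0 : Fin 3) 2 1 = 1 := by decide
  have s3 : Equiv.swap (1 : Fin 3) 2 0 = 0 := by decide
  rw [wedge_apply, sum_perm_three]
  erw [k1, k1, k1, k1, k1, k1, k2, k2, k2, k2, k2, k2]
  simp [s1, s2, s3]
  rw [map_swap_two β w u, map_swap_two β w v, map_swap_two β v u]
  ring

theorem wedge_two_one (β : Alt V 2) (α : Alt V 1) (u v w : V) :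
    wedge β α ![u, v, w] = β ![u, v] * α ![w] - β ![u, w] * α ![v] + β ![v, w] * α ![u] := by
  have e1 : ∀ x : Fin 1 → V, x = ![x 0] := fun x => by ext i; fin_cases i; rfl
  have e2 : ∀ x : Fin 2 → V, x = ![x 0, x 1] := fun x => by ext i; fin_cases i <;> rfl
  have k1 : ∀ σ : Equiv.Perm (Fin 3), (fun i : Fin 1 => ![u, v, w] (σ (Fin.natAdd 2 i)))
    = ![![u, v, w] (σ 2)] := fun σ => e1 _
  have k2 : ∀ σ : Equiv.Perm (Fin 3), (fun i : Fin 2 => ![u, v, w] (σ (Fin.castAdd 1 i)))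
    = ![![u, v, w] (σ 0), ![u, v, w] (σ 1)] := fun σ => e2 _
  have s1 : Equiv.swap (0 : Fin 3) 1 2 = 2 := by decide
  have s2 : Equiv.swap (0 : Fin 3) 2 1 = 1 := by decide
  have s3 : Equiv.swap (1 : Fin 3) 2 0 = 0 := by decide
  rw [wedge_apply, sum_perm_three]
  erw [k1, k1, k1, k1, k1, k1, k2, k2, k2, k2, k2, k2]
  simp [s1, s2, s3]
  rw [map_swap_two β w u, map_swap_two β w v, map_swap_two β v u]
  ring

theorem alt_one_ext {α β : Alt V 1} (h : ∀ v, α ![v] = β ![v]) : α = β := by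
  ext v
  have e : v = ![v 0] := by ext i; fin_cases i; rfl
  rw [e]; exact h _

theorem alt_two_ext {α β : Alt V 2} (h : ∀ v w, α ![v, w] = β ![v, w]) : α = β := by
  ext v
  have e : v = ![v 0, v 1] := by ext i; fin_cases i <;> rfl
  rw [e]; exact h _ _

theorem alt_three_ext {α β : Alt V 3} (h : ∀ u v w, α ![u, v, w] = β ![u, v, w]) : α = β := by
  ext v
  have e : v = ![v 0, v 1, v 2] := by ext i; fin_cases i <;> rfl
  rw [e]; exact h _ _ _

/-- Each of the (k + l)! summands is at most ‖α‖ ‖β‖ ∏ ‖v i‖, because a permutation only reorders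
the product. The crude constant suffices: the bound serves to make the wedge product a continuous
bilinear map, from which smoothness and the Leibniz rule follow. -/
theorem norm_wedge_le {k l : ℕ} (α : Alt V k) (β : Alt V l) :
    ‖wedge α β‖ ≤ ((k.factorial * l.factorial : ℝ))⁻¹ * (k + l).factorial * ‖α‖ * ‖β‖ := by
  refine ContinuousAlternatingMap.opNorm_le_bound _ (by positivity) fun v => ?_
  rw [wedge_apply, norm_mul, Real.norm_of_nonneg (by positivity)]
  have h : ‖∑ σ : Equiv.Perm (Fin (k + l)), Equiv.Perm.sign σ •
        (α (fun i => v (σ (Fin.castAdd l i))) * β (fun j => v (σ (Fin.natAdd k j))))‖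
      ≤ ∑ _σ : Equiv.Perm (Fin (k + l)), ‖α‖ * ‖β‖ * ∏ i, ‖v i‖ := by
    refine norm_sum_le_of_le _ fun σ _ => ?_
    have hs : ‖Equiv.Perm.sign σ •
        (α (fun i => v (σ (Fin.castAdd l i))) * β (fun j => v (σ (Fin.natAdd k j))))‖
        = ‖α (fun i => v (σ (Fin.castAdd l i)))‖ * ‖β (fun j => v (σ (Fin.natAdd k j)))‖ := by
      rcases Int.units_eq_one_or (Equiv.Perm.sign σ) with h | h <;> simp [h]
    rw [hs]
    calc _ ≤ (‖α‖ * ∏ i, ‖v (σ (Fin.castAdd l i))‖) * (‖β‖ * ∏ j, ‖v (σ (Fin.natAdd k j))‖) := by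
          gcongr
          · exact α.le_opNorm _
          · exact β.le_opNorm _
      _ = ‖α‖ * ‖β‖ * ∏ i, ‖v (σ i)‖ := by rw [Fin.prod_univ_add]; ring
      _ = ‖α‖ * ‖β‖ * ∏ i, ‖v i‖ := by rw [Equiv.prod_comp σ (fun i => ‖v i‖)]
  rw [Finset.sum_const, Finset.card_univ, Fintype.card_perm, Fintype.card_fin, nsmul_eq_mul] at h
  calc _ ≤ ((k.factorial * l.factorial : ℝ))⁻¹ *
        ((k + l).factorial * (‖α‖ * ‖β‖ * ∏ i, ‖v i‖)) := by gcongr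
    _ = _ := by ring

/-- The wedge product as a continuous bilinear map. -/
def wedgeCLM (V : Type*) [NormedAddCommGroup V] [NormedSpace ℝ V] (k l : ℕ) :
    Alt V k →L[ℝ] Alt V l →L[ℝ] Alt V (k + l) :=
  LinearMap.mkContinuous₂
    (LinearMap.mk₂ ℝ (fun (α : Alt V k) (β : Alt V l) => wedge α β)
      (fun α α' β => by
        ext v
        simp only [wedge_apply, ContinuousAlternatingMap.add_apply, add_mul, smul_add,
          Finset.sum_add_distrib, mul_add])
      (fun c α β => by
        ext v
        simp only [wedge_apply, ContinuousAlternatingMap.smul_apply, smul_eq_mul, Finset.mul_sum,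
          mul_assoc, mul_smul_comm, mul_left_comm _ c])
      (fun α β β' => by
        ext v
        simp only [wedge_apply, ContinuousAlternatingMap.add_apply, smul_add,
          Finset.sum_add_distrib, mul_add])
      (fun c α β => by
        ext v
        simp only [wedge_apply, ContinuousAlternatingMap.smul_apply, smul_eq_mul, Finset.mul_sum,
          mul_smul_comm, mul_left_comm _ c]))
    (((k.factorial * l.factorial : ℝ))⁻¹ * (k + l).factorial) norm_wedge_le

theorem wedgeCLM_apply {k l : ℕ} (α : Alt V k) (β : Alt V l) : wedgeCLM V k l α β = wedge α β :=
  rfl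

theorem wedge_add_left {k l : ℕ} (α α' : Alt V k) (β : Alt V l) :
    wedge (α + α') β = wedge α β + wedge α' β := by simp [← wedgeCLM_apply]

theorem wedge_add_right {k l : ℕ} (α : Alt V k) (β β' : Alt V l) :
    wedge α (β + β') = wedge α β + wedge α β' := by simp [← wedgeCLM_apply]

theorem wedge_sub_left {k l : ℕ} (α α' : Alt V k) (β : Alt V l) :
    wedge (α - α') β = wedge α β - wedge α' β := by simp [← wedgeCLM_apply]

theorem wedge_sub_right {k l : ℕ} (α : Alt V k) (β β' : Alt V l) :
    wedge α (β - β') = wedge α β - wedge α β' := by simp [← wedgeCLM_apply]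

theorem wedge_neg_left {k l : ℕ} (α : Alt V k) (β : Alt V l) :
    wedge (-α) β = -wedge α β := by simp [← wedgeCLM_apply]

theorem wedge_neg_right {k l : ℕ} (α : Alt V k) (β : Alt V l) :
    wedge α (-β) = -wedge α β := by simp [← wedgeCLM_apply]

theorem wedge_smul_left {k l : ℕ} (c : ℝ) (α : Alt V k) (β : Alt V l) :
    wedge (c • α) β = c • wedge α β := by simp [← wedgeCLM_apply]

theorem wedge_smul_right {k l : ℕ} (c : ℝ) (α : Alt V k) (β : Alt V l) :
    wedge α (c • β) = c • wedge α β := by simp [← wedgeCLM_apply]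

theorem wedge_sum_left {ι : Type*} {k l : ℕ} (s : Finset ι) (α : ι → Alt V k) (β : Alt V l) :
    wedge (∑ i ∈ s, α i) β = ∑ i ∈ s, wedge (α i) β := by simp [← wedgeCLM_apply]

theorem wedge_sum_right {ι : Type*} {k l : ℕ} (s : Finset ι) (α : Alt V k) (β : ι → Alt V l) :
    wedge α (∑ i ∈ s, β i) = ∑ i ∈ s, wedge α (β i) := by simp [← wedgeCLM_apply]

theorem wedge_comm_one (α β : Alt V 1) : wedge α β = -wedge β α :=
  alt_two_ext fun v w => by
    change _ = -(wedge β α ![v, w])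
    rw [wedge_one_one, wedge_one_one]; ring

/-- The ascription to `Alt V 3` identifies the degrees 1 + 1 + 1 and 1 + (1 + 1), so that both sides
can be expanded on the same three vectors. -/
theorem wedge_assoc_one (α β γ : Alt V 1) :
    (wedge (wedge α β) γ : Alt V 3) = wedge α (wedge β γ) :=
  alt_three_ext fun u v w => by
    have h1 := wedge_two_one (wedge α β) γ u v w
    have h2 := wedge_one_two α (wedge β γ) u v w
    refine h1.trans (Eq.trans ?_ h2.symm)
    simp only [wedge_one_one]; ring

theorem oneForm_apply (f : V →L[ℝ] ℝ) (v : V) : oneForm f ![v] = f v := rfl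

theorem extDeriv_one_apply (μ : Form V 1) (p v w : V) :
    extDeriv μ p ![v, w] = fderiv ℝ μ p v ![w] - fderiv ℝ μ p w ![v] := by
  rw [extDeriv, ContinuousAlternatingMap.alternatizeUncurryFin_apply, Fin.sum_univ_two]
  have e0 : Fin.removeNth 0 ![v, w] = ![w] := by ext i; fin_cases i; rfl
  have e1 : Fin.removeNth 1 ![v, w] = ![v] := by ext i; fin_cases i; rfl
  rw [e0, e1]
  simp [sub_eq_add_neg]

theorem extDeriv_two_apply (μ : Form V 2) (p u v w : V) :
    extDeriv μ p ![u, v, w] =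
      fderiv ℝ μ p u ![v, w] - fderiv ℝ μ p v ![u, w] + fderiv ℝ μ p w ![u, v] := by
  rw [extDeriv, ContinuousAlternatingMap.alternatizeUncurryFin_apply, Fin.sum_univ_three]
  have e0 : Fin.removeNth 0 ![u, v, w] = ![v, w] := by ext i; fin_cases i <;> rfl
  have e1 : Fin.removeNth 1 ![u, v, w] = ![u, w] := by ext i; fin_cases i <;> rfl
  have e2 : Fin.removeNth 2 ![u, v, w] = ![u, v] := by ext i; fin_cases i <;> rfl
  rw [e0, e1, e2]
  simp [sub_eq_add_neg]

theorem extDeriv_three_apply (μ : Form V 3) (p t u v w : V) :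
    extDeriv μ p ![t, u, v, w] =
      fderiv ℝ μ p t ![u, v, w] - fderiv ℝ μ p u ![t, v, w] + fderiv ℝ μ p v ![t, u, w]
        - fderiv ℝ μ p w ![t, u, v] := by
  rw [extDeriv, ContinuousAlternatingMap.alternatizeUncurryFin_apply, Fin.sum_univ_four]
  have e0 : Fin.removeNth 0 ![t, u, v, w] = ![u, v, w] := by ext i; fin_cases i <;> rfl
  have e1 : Fin.removeNth 1 ![t, u, v, w] = ![t, v, w] := by ext i; fin_cases i <;> rfl
  have e2 : Fin.removeNth 2 ![t, u, v, w] = ![t, u, w] := by ext i; fin_cases i <;> rfl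
  have e3 : Fin.removeNth 3 ![t, u, v, w] = ![t, u, v] := by ext i; fin_cases i <;> rfl
  rw [e0, e1, e2, e3]
  simp [sub_eq_add_neg, pow_succ]

theorem extDeriv_sum {ι : Type*} {k : ℕ} (s : Finset ι) (α : ι → Form V k) {p : V}
    (h : ∀ i ∈ s, DifferentiableAt ℝ (α i) p) :
    extDeriv (fun q => ∑ i ∈ s, α i q) p = ∑ i ∈ s, extDeriv (α i) p := by
  simp only [extDeriv]
  rw [fderiv_fun_sum h, ← ContinuousAlternatingMap.alternatizeUncurryFinCLM_apply, map_sum]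
  rfl

theorem extDeriv_fun_smul_one {f : V → ℝ} {α : Form V 1} {p : V} (hf : DifferentiableAt ℝ f p)
    (hα : DifferentiableAt ℝ α p) :
    extDeriv (fun q => f q • α q) p =
      f p • extDeriv α p + wedge (oneForm (fderiv ℝ f p)) (α p) :=
  alt_two_ext fun v w => by
    have h := extDeriv_one_apply (fun q => f q • α q) p v w
    rw [fderiv_fun_smul hf hα] at h
    refine h.trans ?_
    change _ = f p * extDeriv α p ![v, w] + wedge (oneForm (fderiv ℝ f p)) (α p) ![v, w]
    rw [wedge_one_one, extDeriv_one_apply, oneForm_apply, oneForm_apply]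
    simp
    ring

/-- The product rule for the bilinear map `wedgeCLM` gives the Fréchet derivative. Antisymmetrizing
it produces the minus sign, from moving the direction of differentiation past the 1-form α. -/
theorem extDeriv_wedge_one_one {α β : Form V 1} {p : V} (hα : DifferentiableAt ℝ α p)
    (hβ : DifferentiableAt ℝ β p) :
    (extDeriv (fun q => wedge (α q) (β q)) p : Alt V 3) =
      wedge (extDeriv α p) (β p) - wedge (α p) (extDeriv β p) :=
  alt_three_ext fun u v w => by
    have h := extDeriv_two_apply (fun q => wedge (α q) (β q)) p u v w
    have hd : ∀ x : V, fderiv ℝ (fun q => wedge (α q) (β q)) p x =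
        wedge (α p) (fderiv ℝ β p x) + wedge (fderiv ℝ α p x) (β p) := fun x => by
      have := (wedgeCLM V 1 1).fderiv_of_bilinear hα hβ
      simp only [wedgeCLM_apply] at this
      rw [this]
      rfl
    rw [hd, hd, hd] at h
    refine h.trans ?_
    change _ = wedge (extDeriv α p) (β p) ![u, v, w] - wedge (α p) (extDeriv β p) ![u, v, w]
    rw [wedge_two_one, wedge_one_two]
    simp only [extDeriv_one_apply]
    simp only [ContinuousAlternatingMap.add_apply, wedge_one_one]
    ring

theorem contDiffAt_wedge {n : ℕ∞ω} {W : Type*} [NormedAddCommGroup W] [NormedSpace ℝ W]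
    {k l : ℕ} {α : W → Alt V k} {β : W → Alt V l} {p : W} (hα : ContDiffAt ℝ n α p)
    (hβ : ContDiffAt ℝ n β p) : ContDiffAt ℝ n (fun q => wedge (α q) (β q)) p := by
  have h : ContDiffAt ℝ n (fun q => wedgeCLM V k l (α q)) p := by fun_prop
  exact h.clm_apply hβ

end Wedge

theorem minSmoothness_two_le : minSmoothness ℝ 2 ≤ (∞ : ℕ∞ω) := by
  rw [minSmoothness_of_isRCLikeNormedField]
  exact WithTop.coe_le_coe.2 (le_top : (2 : ℕ∞) ≤ ⊤)

/-! ### Derivatives and smoothness of matrix-valued functions -/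

section MatrixCalculus

variable {V : Type*} [NormedAddCommGroup V] [NormedSpace ℝ V] {n m k : Type*}

/-- The entrywise directional derivative of a matrix-valued function. -/
def matDeriv (F : V → Matrix n m ℝ) (p v : V) : Matrix n m ℝ :=
  Matrix.of fun a b => fderiv ℝ (fun q => F q a b) p v

theorem matDeriv_mul [Fintype m] {F : V → Matrix n m ℝ} {H : V → Matrix m k ℝ} {p : V}
    (hF : ∀ a b, DifferentiableAt ℝ (fun q => F q a b) p)
    (hH : ∀ a b, DifferentiableAt ℝ (fun q => H q a b) p) (v : V) :
    matDeriv (fun q => F q * H q) p v = matDeriv F p v * H p + F p * matDeriv H p v := by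
  ext a b
  simp only [matDeriv, Matrix.of_apply, Matrix.add_apply, Matrix.mul_apply]
  rw [fderiv_fun_sum (fun i _ => (hF a i).fun_mul (hH i b)), sum_apply, ← Finset.sum_add_distrib]
  refine Finset.sum_congr rfl fun i _ => ?_
  rw [fderiv_fun_mul (hF a i) (hH i b)]
  simp
  ring

theorem matDeriv_congr {F H : V → Matrix n m ℝ} {p : V} (h : F =ᶠ[nhds p] H) (v : V) :
    matDeriv F p v = matDeriv H p v := by
  ext a b
  simp only [matDeriv, Matrix.of_apply]
  have h' : (fun q => F q a b) =ᶠ[nhds p] fun q => H q a b := by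
    filter_upwards [h] with q hq
    rw [hq]
  rw [h'.fderiv_eq]

theorem matDeriv_transpose (F : V → Matrix n m ℝ) (p v : V) :
    matDeriv (fun q => (F q).transpose) p v = (matDeriv F p v).transpose := rfl

theorem matDeriv_add {F H : V → Matrix n m ℝ} {p : V}
    (hF : ∀ a b, DifferentiableAt ℝ (fun q => F q a b) p)
    (hH : ∀ a b, DifferentiableAt ℝ (fun q => H q a b) p) (v : V) :
    matDeriv (fun q => F q + H q) p v = matDeriv F p v + matDeriv H p v := by
  ext a b
  simp only [matDeriv, Matrix.of_apply, Matrix.add_apply]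
  rw [fderiv_fun_add (hF a b) (hH a b)]
  rfl

theorem contDiffAt_matrix_mul [Fintype m] {r : ℕ∞ω} {F : V → Matrix n m ℝ} {H : V → Matrix m k ℝ}
    {p : V}
    (hF : ∀ a b, ContDiffAt ℝ r (fun q => F q a b) p)
    (hH : ∀ a b, ContDiffAt ℝ r (fun q => H q a b) p) (a : n) (b : k) :
    ContDiffAt ℝ r (fun q => (F q * H q) a b) p := by
  simp only [Matrix.mul_apply]
  exact ContDiffAt.sum fun i _ => (hF a i).mul (hH i b)

variable [Fintype n] [DecidableEq n]

theorem contDiffAt_det {r : ℕ∞ω} {F : V → Matrix n n ℝ} {p : V}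
    (hF : ∀ a b, ContDiffAt ℝ r (fun q => F q a b) p) :
    ContDiffAt ℝ r (fun q => (F q).det) p := by
  simp only [Matrix.det_apply, Units.smul_def, zsmul_eq_mul]
  refine ContDiffAt.sum fun σ _ => contDiffAt_const.mul ?_
  exact contDiffAt_prod fun i _ => hF _ _

/-- Cramer's rule: an entry of the inverse is a determinant with one replaced row, divided by the
determinant of the matrix. -/
theorem contDiffAt_inv_entry {r : ℕ∞ω} {F : V → Matrix n n ℝ} {p : V}
    (hF : ∀ a b, ContDiffAt ℝ r (fun q => F q a b) p) (h : (F p).det ≠ 0) (a b : n) :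
    ContDiffAt ℝ r (fun q => (F q)⁻¹ a b) p := by
  simp only [Matrix.inv_def, Matrix.smul_apply, smul_eq_mul, Ring.inverse_eq_inv',
    Matrix.adjugate_apply]
  refine ((contDiffAt_det hF).inv h).mul (contDiffAt_det fun i j => ?_)
  by_cases hi : i = b
  · subst hi
    simpa using contDiffAt_const
  · simpa [Matrix.updateRow_ne hi] using hF i j

end MatrixCalculus

/-- The matrix of a metric of Lorentzian type on an open set of the coordinate space: smooth,
symmetric, and of negative determinant. -/
structure IsLorentzOn (G : E4 → Matrix (Fin 4) (Fin 4) ℝ) (D : Set E4) : Prop where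
  isOpen : IsOpen D
  smooth : ∀ y ∈ D, ∀ i j, ContDiffAt ℝ ∞ (fun z => G z i j) y
  symm : ∀ y ∈ D, (G y).transpose = G y
  det_neg : ∀ y ∈ D, (G y).det < 0

/-! ### The Levi-Civita connection and its curvature in coordinates of the base -/

section LeviCivita

variable (G : E4 → Matrix (Fin 4) (Fin 4) ℝ)

/-- The matrix `Γ_v = (v^i Γ^m_{ij})`. -/
def gam (y v : E4) : Matrix (Fin 4) (Fin 4) ℝ :=
  Matrix.of fun m j => ∑ i, christoffel G m i j y * v i

/-- The derivative of `Γ_w` in the direction `v`. -/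
def dgam (y v w : E4) : Matrix (Fin 4) (Fin 4) ℝ :=
  Matrix.of fun m j => ∑ i, (∑ k, v k * pd k (christoffel G m i j) y) * w i

/-- The curvature endomorphism `B(v, w)` in the coordinates of the base. -/
def baseCurv (y v w : E4) : Matrix (Fin 4) (Fin 4) ℝ :=
  dgam G y v w - dgam G y w v + gam G y v * gam G y w - gam G y w * gam G y v

theorem fderiv_eq_sum_pd (f : E4 → ℝ) (y v : E4) : fderiv ℝ f y v = ∑ k, v k * pd k f y := by
  have hv : v = ∑ k, v k • stdVec k := by
    ext j
    simp [stdVec, Finset.sum_apply, Pi.single_apply]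
  conv_lhs => rw [hv]
  simp [pd]

theorem contDiffAt_pd {f : E4 → ℝ} {y : E4} (hf : ContDiffAt ℝ ∞ f y) (i : Fin 4) :
    ContDiffAt ℝ ∞ (pd i f) y :=
  (hf.fderiv_right (m := ∞) (by simp)).clm_apply contDiffAt_const

variable {G} {D : Set E4}

theorem IsLorentzOn.det_ne (hG : IsLorentzOn G D) {y : E4} (hy : y ∈ D) : (G y).det ≠ 0 :=
  (hG.det_neg y hy).ne

theorem IsLorentzOn.apply_symm (hG : IsLorentzOn G D) {y : E4} (hy : y ∈ D) (i j : Fin 4) :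
    G y i j = G y j i := congrFun (congrFun (hG.symm y hy) j) i

theorem IsLorentzOn.pd_symm (hG : IsLorentzOn G D) {y : E4} (hy : y ∈ D) (k i j : Fin 4) :
    pd k (fun z => G z i j) y = pd k (fun z => G z j i) y := by
  have h : (fun z => G z i j) =ᶠ[nhds y] fun z => G z j i := by
    filter_upwards [hG.isOpen.mem_nhds hy] with z hz using hG.apply_symm hz i j
  simp only [pd, h.fderiv_eq]

theorem IsLorentzOn.contDiffAt_christoffel (hG : IsLorentzOn G D) {y : E4} (hy : y ∈ D)
    (m i j : Fin 4) : ContDiffAt ℝ ∞ (christoffel G m i j) y := by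
  refine contDiffAt_const.mul (ContDiffAt.sum fun r _ => ContDiffAt.mul ?_ ?_)
  · exact contDiffAt_inv_entry (hG.smooth y hy) (hG.det_ne hy) m r
  · exact ((contDiffAt_pd (hG.smooth y hy _ _) _).add (contDiffAt_pd (hG.smooth y hy _ _) _)).sub
      (contDiffAt_pd (hG.smooth y hy _ _) _)

theorem IsLorentzOn.christoffel_symm (hG : IsLorentzOn G D) {y : E4} (hy : y ∈ D)
    (m i j : Fin 4) : christoffel G m i j y = christoffel G m j i y := by
  simp only [christoffel]
  congr 1
  refine Finset.sum_congr rfl fun r _ => ?_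
  rw [hG.pd_symm hy r i j]
  ring

theorem IsLorentzOn.fderiv_gam (hG : IsLorentzOn G D) {y : E4} (hy : y ∈ D) (v w : E4) :
    matDeriv (fun z => gam G z w) y v = dgam G y v w := by
  ext m j
  simp only [matDeriv, dgam, gam, Matrix.of_apply]
  have hd := fun i => (hG.contDiffAt_christoffel hy m i j).differentiableAt (by simp)
  rw [fderiv_fun_sum (fun i _ => (hd i).mul_const (w i)), sum_apply]
  refine Finset.sum_congr rfl fun i _ => ?_
  rw [fderiv_mul_const (hd i), ← fderiv_eq_sum_pd]
  simp [mul_comm]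

/-- The Levi-Civita connection is metric. -/
theorem IsLorentzOn.matDeriv_metric (hG : IsLorentzOn G D) {y : E4} (hy : y ∈ D) (v : E4) :
    matDeriv G y v = (gam G y v).transpose * G y + G y * gam G y v := by
  -- Lowering the index removes the inverse metric from the Christoffel symbols. Of the three
  -- derivatives that remain, the last two are antisymmetric in i, j and disappear when the
  -- transpose is added.
  have key : ∀ i j, (G y * gam G y v) i j = (1 / 2) * ∑ k, v k *
      (pd k (fun z => G z i j) y + pd j (fun z => G z i k) y - pd i (fun z => G z k j) y) := by
    intro i j
    have hinv : G y * (G y)⁻¹ = 1 := Matrix.mul_nonsing_inv _ (hG.det_ne hy).isUnit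
    have h2 : gam G y v = (G y)⁻¹ * Matrix.of fun r j => (1 / 2) * ∑ k, v k *
        (pd k (fun z => G z r j) y + pd j (fun z => G z r k) y - pd r (fun z => G z k j) y) := by
      ext m j
      simp only [gam, christoffel, Matrix.mul_apply, Matrix.of_apply, Finset.mul_sum,
        Finset.sum_mul]
      rw [Finset.sum_comm]
      refine Finset.sum_congr rfl fun r _ => Finset.sum_congr rfl fun k _ => ?_
      ring
    rw [h2, ← Matrix.mul_assoc, hinv, Matrix.one_mul]
    rfl
  have ht : (gam G y v).transpose * G y = (G y * gam G y v).transpose := by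
    rw [Matrix.transpose_mul, hG.symm y hy]
  ext i j
  rw [ht, Matrix.add_apply, Matrix.transpose_apply, key, key, matDeriv, Matrix.of_apply,
    fderiv_eq_sum_pd, ← mul_add, ← Finset.sum_add_distrib, Finset.mul_sum]
  refine Finset.sum_congr rfl fun k _ => ?_
  rw [hG.pd_symm hy k j i, hG.pd_symm hy i j k, hG.pd_symm hy j k i]
  ring

theorem IsLorentzOn.differentiableAt_gam (hG : IsLorentzOn G D) {y : E4} (hy : y ∈ D) (v : E4)
    (m j : Fin 4) : DifferentiableAt ℝ (fun z => gam G z v m j) y := by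
  simp only [gam, Matrix.of_apply]
  exact DifferentiableAt.fun_sum fun i _ =>
    ((hG.contDiffAt_christoffel hy m i j).differentiableAt (by simp)).mul_const _

/-- The curvature of a metric connection is skew with respect to the metric. -/
theorem IsLorentzOn.baseCurv_skew (hG : IsLorentzOn G D) {y : E4} (hy : y ∈ D) (v w : E4) :
    G y * baseCurv G y v w + (baseCurv G y v w).transpose * G y = 0 := by
  have hGd : ∀ i j, DifferentiableAt ℝ (fun z => G z i j) y := fun i j =>
    (hG.smooth y hy i j).differentiableAt (by simp)
  -- Metricity is differentiated in a second direction. By the symmetry of second derivatives the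
  -- part antisymmetric in v, w vanishes, and up to sign this part is the asserted combination of
  -- curvatures.
  have hsecond : ∀ v w : E4, matDeriv (fun z => matDeriv G z v) y w =
      (dgam G y w v).transpose * G y + (gam G y v).transpose * matDeriv G y w
        + (matDeriv G y w * gam G y v + G y * dgam G y w v) := by
    intro v w
    have he : (fun z => matDeriv G z v) =ᶠ[nhds y]
        fun z => (gam G z v).transpose * G z + G z * gam G z v := by
      filter_upwards [hG.isOpen.mem_nhds hy] with z hz using hG.matDeriv_metric hz v
    have hg := hG.differentiableAt_gam hy v
    have hgt : ∀ a b, DifferentiableAt ℝ (fun z => (gam G z v).transpose a b) y :=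
      fun a b => hg b a
    have hmul : ∀ {F H : E4 → Matrix (Fin 4) (Fin 4) ℝ},
        (∀ a b, DifferentiableAt ℝ (fun q => F q a b) y) →
        (∀ a b, DifferentiableAt ℝ (fun q => H q a b) y) → ∀ a b,
        DifferentiableAt ℝ (fun q => (F q * H q) a b) y := by
      intro F H hF hH a b
      simp only [Matrix.mul_apply]
      exact DifferentiableAt.fun_sum fun i _ => (hF a i).mul (hH i b)
    rw [matDeriv_congr he, matDeriv_add (hmul hgt hGd) (hmul hGd hg), matDeriv_mul hgt hGd,
      matDeriv_mul hGd hg, matDeriv_transpose, hG.fderiv_gam hy]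
  have hsymm : matDeriv (fun z => matDeriv G z v) y w = matDeriv (fun z => matDeriv G z w) y v := by
    ext i j
    have hs : ∀ v w : E4, fderiv ℝ (fun z => fderiv ℝ (fun q => G q i j) z v) y w
        = fderiv ℝ (fderiv ℝ (fun q => G q i j)) y w v := by
      intro v w
      have hd : DifferentiableAt ℝ (fderiv ℝ (fun q => G q i j)) y :=
        ((hG.smooth y hy i j).fderiv_right (m := ∞) (by simp)).differentiableAt (by simp)
      rw [fderiv_clm_apply hd (differentiableAt_const v)]
      simp
    simp only [matDeriv, Matrix.of_apply]
    rw [hs, hs]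
    exact ((hG.smooth y hy i j).isSymmSndFDerivAt minSmoothness_two_le) w v
  rw [hsecond, hsecond, hG.matDeriv_metric hy, hG.matDeriv_metric hy] at hsymm
  have hz := sub_eq_zero.mpr hsymm
  rw [← neg_eq_zero, ← hz]
  simp only [baseCurv, Matrix.transpose_sub, Matrix.transpose_add, Matrix.transpose_mul]
  noncomm_ring

/-- The connection has no torsion: Γ_v w and the derivatives of Γ are symmetric in the two vectors,
so the terms of the cyclic sum cancel in pairs. -/
theorem IsLorentzOn.baseCurv_bianchi (hG : IsLorentzOn G D) {y : E4} (hy : y ∈ D) (u v w : E4) :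
    (baseCurv G y u v).mulVec w + (baseCurv G y v w).mulVec u +
      (baseCurv G y w u).mulVec v = 0 := by
  have h1 : ∀ v w : E4, (gam G y v).mulVec w = (gam G y w).mulVec v := by
    intro v w
    ext m
    simp only [gam, Matrix.mulVec, dotProduct, Matrix.of_apply, Finset.sum_mul]
    rw [Finset.sum_comm]
    refine Finset.sum_congr rfl fun i _ => Finset.sum_congr rfl fun j _ => ?_
    rw [hG.christoffel_symm hy]; ring
  have hp : ∀ k m i j, pd k (christoffel G m i j) y = pd k (christoffel G m j i) y := by
    intro k m i j
    have h : christoffel G m i j =ᶠ[nhds y] christoffel G m j i := by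
      filter_upwards [hG.isOpen.mem_nhds hy] with z hz using hG.christoffel_symm hz m i j
    simp only [pd, h.fderiv_eq]
  have h2 : ∀ u v w : E4, (dgam G y u v).mulVec w = (dgam G y u w).mulVec v := by
    intro u v w
    ext m
    simp only [dgam, Matrix.mulVec, dotProduct, Matrix.of_apply, Finset.sum_mul]
    rw [Finset.sum_comm]
    refine Finset.sum_congr rfl fun i _ => Finset.sum_congr rfl fun j _ =>
      Finset.sum_congr rfl fun k _ => ?_
    rw [hp]; ring
  simp only [baseCurv, Matrix.sub_mulVec, Matrix.add_mulVec, ← Matrix.mulVec_mulVec]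
  rw [h1 w u, h1 v u, h1 w v, h2 u w v, h2 v w u, h2 w v u]
  abel

theorem baseCurv_swap (y v w : E4) : baseCurv G y v w = -baseCurv G y w v := by
  simp only [baseCurv]; abel

theorem baseCurv_add_left (y v v' w : E4) :
    baseCurv G y (v + v') w = baseCurv G y v w + baseCurv G y v' w := by
  have h1 : gam G y (v + v') = gam G y v + gam G y v' := by
    ext; simp [gam, mul_add, Finset.sum_add_distrib]
  have h2 : dgam G y (v + v') w = dgam G y v w + dgam G y v' w := by
    ext; simp [dgam, add_mul, Finset.sum_add_distrib]
  have h3 : dgam G y w (v + v') = dgam G y w v + dgam G y w v' := by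
    ext; simp [dgam, mul_add, Finset.sum_add_distrib]
  simp only [baseCurv, h1, h2, h3]
  noncomm_ring

theorem baseCurv_smul_left (y : E4) (c : ℝ) (v w : E4) :
    baseCurv G y (c • v) w = c • baseCurv G y v w := by
  have h1 : gam G y (c • v) = c • gam G y v := by
    ext; simp [gam, Finset.mul_sum, mul_left_comm]
  have h2 : dgam G y (c • v) w = c • dgam G y v w := by
    ext; simp [dgam, Finset.mul_sum, Finset.sum_mul, mul_assoc]
  have h3 : dgam G y w (c • v) = c • dgam G y w v := by
    ext; simp [dgam, Finset.mul_sum, mul_left_comm]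
  simp only [baseCurv, h1, h2, h3, Matrix.smul_mul, Matrix.mul_smul, smul_sub, smul_add]

end LeviCivita

/-! ### Connection and curvature forms on the frame bundle as matrices -/

section FrameForms

variable (G : E4 → Matrix (Fin 4) (Fin 4) ℝ)

/-- The frames over an open set of the coordinate space. -/
def framesOver (D : Set E4) : Set F20 := {p | p.1 ∈ D ∧ (frameMat p).det ≠ 0}

/-- The matrix of values of the connection forms at a vector. -/
def connMat (p v : F20) : Matrix (Fin 4) (Fin 4) ℝ := Matrix.of fun a b => conn G a b p ![v]

/-- The matrix of values of the curvature forms at a pair of vectors. -/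
def curvMat (p v w : F20) : Matrix (Fin 4) (Fin 4) ℝ :=
  Matrix.of fun a b => curv G b a p ![v, w]

theorem theta_apply (a : Fin 4) (p v : F20) :
    theta a p ![v] = ∑ i, (frameMat p)⁻¹ a i * v.1 i := by
  rw [theta, oneForm_apply, sum_apply]
  rfl

/-- Evaluation on a vector turns the index sums into matrix products. Equivariance and the structure
equation are then read off from this factorization. -/
theorem connMat_eq (p v : F20) :
    connMat G p v = (frameMat p)⁻¹ * (Matrix.of v.2 + gam G p.1 v.1 * frameMat p) := by
  ext a b
  rw [connMat, Matrix.of_apply, conn, oneForm_apply, sum_apply, Matrix.mul_apply]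
  refine Finset.sum_congr rfl fun m _ => ?_
  rw [smul_apply, add_apply, sum_apply, smul_eq_mul,
    Matrix.add_apply, Matrix.mul_apply]
  congr 1
  congr 1
  simp only [gam, Matrix.of_apply, Finset.sum_mul, smul_apply, smul_eq_mul]
  rw [Finset.sum_comm]
  refine Finset.sum_congr rfl fun j _ => Finset.sum_congr rfl fun i _ => ?_
  change _ * _ * v.1 _ = _ * _ * p.2 _ _
  ring

theorem gFrame_eq (p : F20) :
    gFrame G p = (frameMat p).transpose * G p.1 * frameMat p := by
  ext a b
  simp only [gFrame, Matrix.of_apply, Matrix.mul_apply, Matrix.transpose_apply, Finset.sum_mul,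
    frameMat]
  rw [Finset.sum_comm]
  refine Finset.sum_congr rfl fun j _ => Finset.sum_congr rfl fun i _ => ?_
  ring

theorem connLow_apply (a b : Fin 4) (p v : F20) :
    connLow G a b p ![v] = (gFrame G p * connMat G p v) a b := by
  rw [connLow, ContinuousAlternatingMap.sum_apply, Matrix.mul_apply]
  rfl

variable {G} {D : Set E4}

theorem contDiff_frameMat_apply {n : ℕ∞ω} (i a : Fin 4) :
    ContDiff ℝ n fun q : F20 => frameMat q i a := by
  change ContDiff ℝ n fun q : F20 => q.2 i a
  fun_prop

theorem IsLorentzOn.isOpen_framesOver (hG : IsLorentzOn G D) : IsOpen (framesOver D) := by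
  have h : Continuous fun q : F20 => (frameMat q).det :=
    continuous_iff_continuousAt.2 fun q =>
      (contDiffAt_det (r := 0) fun a b => (contDiff_frameMat_apply a b).contDiffAt).continuousAt
  exact (hG.isOpen.preimage continuous_fst).inter (isOpen_ne_fun h continuous_const)

theorem contDiffAt_oneForm {V W : Type*} [NormedAddCommGroup V] [NormedSpace ℝ V]
    [NormedAddCommGroup W] [NormedSpace ℝ W] {n : ℕ∞ω} {f : W → V →L[ℝ] ℝ} {p : W}
    (hf : ContDiffAt ℝ n f p) : ContDiffAt ℝ n (fun q => oneForm (f q)) p :=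
  (ContinuousAlternatingMap.ofSubsingletonLIE (𝕜 := ℝ) (E := V) (F := ℝ)
    (0 : Fin 1)).toContinuousLinearEquiv.contDiff.contDiffAt.comp p hf

theorem contDiffAt_frameInv {p : F20} (hp : p ∈ framesOver D) (a i : Fin 4) :
    ContDiffAt ℝ ∞ (fun q => (frameMat q)⁻¹ a i) p :=
  contDiffAt_inv_entry (fun a b => (contDiff_frameMat_apply a b).contDiffAt) hp.2 a i

theorem contDiffAt_theta {p : F20} (hp : p ∈ framesOver D) (a : Fin 4) :
    ContDiffAt ℝ ∞ (theta a) p :=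
  contDiffAt_oneForm (ContDiffAt.sum fun i _ => (contDiffAt_frameInv hp a i).smul contDiffAt_const)

theorem ContDiffAt.comp_base {n : ℕ∞ω} {f : E4 → ℝ} {p : F20} (h : ContDiffAt ℝ n f p.1) :
    ContDiffAt ℝ n (fun q : F20 => f q.1) p :=
  ContDiffAt.comp p h contDiffAt_fst

theorem IsLorentzOn.contDiffAt_conn (hG : IsLorentzOn G D) {p : F20} (hp : p ∈ framesOver D)
    (a b : Fin 4) : ContDiffAt ℝ ∞ (conn G a b) p := by
  have h : ∀ m i, ContDiffAt ℝ ∞ (fun q : F20 => ∑ j, christoffel G m i j q.1 * q.2 j b) p :=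
    fun m i => ContDiffAt.sum fun j _ =>
      (ContDiffAt.comp_base (hG.contDiffAt_christoffel hp.1 m i j)).mul
        (contDiff_frameMat_apply j b).contDiffAt
  exact contDiffAt_oneForm (ContDiffAt.sum fun m _ => (contDiffAt_frameInv hp a m).smul
    (contDiffAt_const.add (ContDiffAt.sum fun i _ => (h m i).smul contDiffAt_const)))

theorem IsLorentzOn.contDiffAt_gFrame (hG : IsLorentzOn G D) {p : F20} (hp : p ∈ framesOver D)
    (a b : Fin 4) : ContDiffAt ℝ ∞ (fun q => gFrame G q a b) p := by
  change ContDiffAt ℝ ∞ (fun q : F20 => ∑ i, ∑ j, G q.1 i j * q.2 i a * q.2 j b) p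
  refine ContDiffAt.sum fun i _ => ContDiffAt.sum fun j _ => ?_
  exact ((ContDiffAt.comp_base (hG.smooth p.1 hp.1 i j)).mul
    (contDiff_frameMat_apply i a).contDiffAt).mul (contDiff_frameMat_apply j b).contDiffAt

theorem IsLorentzOn.contDiffAt_connLow (hG : IsLorentzOn G D) {p : F20} (hp : p ∈ framesOver D)
    (a b : Fin 4) : ContDiffAt ℝ ∞ (connLow G a b) p :=
  ContDiffAt.sum fun c _ => (hG.contDiffAt_gFrame hp a c).smul (hG.contDiffAt_conn hp c b)

theorem IsLorentzOn.gFrame_transpose (hG : IsLorentzOn G D) {p : F20} (hp : p ∈ framesOver D) :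
    (gFrame G p).transpose = gFrame G p := by
  rw [gFrame_eq, Matrix.transpose_mul, Matrix.transpose_mul, hG.symm _ hp.1,
    Matrix.transpose_transpose, Matrix.mul_assoc]

theorem IsLorentzOn.det_gFrame_neg (hG : IsLorentzOn G D) {p : F20} (hp : p ∈ framesOver D) :
    (gFrame G p).det < 0 := by
  rw [gFrame_eq, Matrix.det_mul, Matrix.det_mul, Matrix.det_transpose]
  have := mul_neg_of_neg_of_pos (hG.det_neg _ hp.1) (mul_self_pos.2 hp.2)
  linarith

theorem frameMat_mul_inv {p : F20} (hp : p ∈ framesOver D) :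
    frameMat p * (frameMat p)⁻¹ = 1 :=
  Matrix.mul_nonsing_inv _ hp.2.isUnit

theorem frameMat_inv_mul {p : F20} (hp : p ∈ framesOver D) :
    (frameMat p)⁻¹ * frameMat p = 1 :=
  Matrix.nonsing_inv_mul _ hp.2.isUnit

theorem matDeriv_frameMat (p v : F20) : matDeriv frameMat p v = Matrix.of v.2 := by
  ext i a
  simp only [matDeriv, Matrix.of_apply]
  have h : (fun q : F20 => frameMat q i a) = dFrame i a := rfl
  rw [h, ContinuousLinearMap.fderiv]
  rfl

theorem matDeriv_comp_base {F : E4 → Matrix (Fin 4) (Fin 4) ℝ} {p : F20}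
    (hF : ∀ a b, DifferentiableAt ℝ (fun z => F z a b) p.1) (v : F20) :
    matDeriv (fun q : F20 => F q.1) p v = matDeriv F p.1 v.1 := by
  ext i a
  simp only [matDeriv, Matrix.of_apply]
  have h := fderiv_comp p (hF i a) (differentiableAt_fst (𝕜 := ℝ))
  rw [fderiv_fst] at h
  exact congrArg (fun L => L v) h

/-- `dg_{ab} = Γ_{ab} + Γ_{ba}`. -/
theorem IsLorentzOn.fderiv_gFrame (hG : IsLorentzOn G D) {p : F20} (hp : p ∈ framesOver D)
    (a b : Fin 4) (v : F20) : fderiv ℝ (fun q => gFrame G q a b) p v =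
      connLow G a b p ![v] + connLow G b a p ![v] := by
  have hA : ∀ a b, DifferentiableAt ℝ (fun q : F20 => frameMat q a b) p := fun a b =>
    (contDiff_frameMat_apply (n := 1) a b).contDiffAt.differentiableAt (by simp)
  have hAt : ∀ a b, DifferentiableAt ℝ (fun q : F20 => (frameMat q).transpose a b) p := fun a b =>
    hA b a
  have hGd : ∀ a b, DifferentiableAt ℝ (fun z => G z a b) p.1 := fun a b =>
    (hG.smooth p.1 hp.1 a b).differentiableAt (by simp)
  have hGd' : ∀ a b, DifferentiableAt ℝ (fun q : F20 => G q.1 a b) p := fun a b =>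
    (ContDiffAt.comp_base (hG.smooth p.1 hp.1 a b)).differentiableAt (by simp)
  have hm : ∀ a b, DifferentiableAt ℝ (fun q : F20 => ((frameMat q).transpose * G q.1) a b) p :=
    fun a b => (contDiffAt_matrix_mul (r := 1)
      (fun a b => (contDiff_frameMat_apply b a).contDiffAt)
      (fun a b => (ContDiffAt.comp_base ((hG.smooth p.1 hp.1 a b).of_le (by simp)))) a b
      ).differentiableAt (by simp)
  -- The factor A⁻¹ in the connection is absorbed by the A in the frame components of the metric.
  -- The product rule for AᵀGA, with metricity on the base, then gives one matrix plus its
  -- transpose.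
  have key : matDeriv (gFrame G) p v =
      gFrame G p * connMat G p v + (gFrame G p * connMat G p v).transpose := by
    have e : gFrame G = fun q => (frameMat q).transpose * G q.1 * frameMat q := funext (gFrame_eq G)
    have e2 : gFrame G p * connMat G p v =
        (frameMat p).transpose * G p.1 * (Matrix.of v.2 + gam G p.1 v.1 * frameMat p) := by
      rw [connMat_eq, gFrame_eq, Matrix.mul_assoc, ← Matrix.mul_assoc (frameMat p),
        frameMat_mul_inv hp, Matrix.one_mul]
    rw [e2, e, matDeriv_mul hm hA, matDeriv_mul hAt hGd', matDeriv_comp_base hGd,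
      matDeriv_transpose, matDeriv_frameMat, hG.matDeriv_metric hp.1]
    simp only [Matrix.transpose_mul, Matrix.transpose_add, Matrix.transpose_transpose,
      hG.symm _ hp.1]
    noncomm_ring
  have h := congrFun (congrFun key a) b
  rw [connLow_apply, connLow_apply]
  exact h

theorem IsLorentzOn.fderiv_conn (hG : IsLorentzOn G D) {p : F20} (hp : p ∈ framesOver D)
    (a b : Fin 4) (v w : F20) :
    fderiv ℝ (conn G a b) p v ![w] = matDeriv (fun q => connMat G q w) p v a b := by
  rw [matDeriv, Matrix.of_apply]
  have := fderiv_continuousAlternatingMap_apply_const_apply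
    ((hG.contDiffAt_conn hp a b).differentiableAt (by simp)) ![w] v
  exact this.symm

/-- Differentiating Aω = dA + ΓA instead of ω avoids derivatives of A⁻¹. In A times the curvature
all terms with vertical components cancel; this is why the curvature forms are horizontal and
equivariant. -/
theorem IsLorentzOn.curvMat_eq (hG : IsLorentzOn G D) {p : F20} (hp : p ∈ framesOver D)
    (v w : F20) :
    curvMat G p v w = (frameMat p)⁻¹ * baseCurv G p.1 v.1 w.1 * frameMat p := by
  have h0 : curvMat G p v w = matDeriv (fun q => connMat G q w) p v
      - matDeriv (fun q => connMat G q v) p w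
      + (connMat G p v * connMat G p w - connMat G p w * connMat G p v) := by
    ext a b
    rw [curvMat, Matrix.of_apply, curv]
    change extDeriv (conn G a b) p ![v, w] + (∑ c, wedge (conn G a c p) (conn G c b p)) ![v, w] = _
    rw [extDeriv_one_apply, hG.fderiv_conn hp, hG.fderiv_conn hp, Matrix.add_apply,
      Matrix.sub_apply, Matrix.sub_apply, Matrix.mul_apply, Matrix.mul_apply,
      ← Finset.sum_sub_distrib]
    congr 1
    exact (ContinuousAlternatingMap.sum_apply _ _).trans (Finset.sum_congr rfl fun c _ =>
      wedge_one_one _ _ _ _)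
  have hA : ∀ a b, DifferentiableAt ℝ (fun q : F20 => frameMat q a b) p := fun a b =>
    (contDiff_frameMat_apply (n := 1) a b).contDiffAt.differentiableAt (by simp)
  have hω : ∀ w : F20, ∀ a b, DifferentiableAt ℝ (fun q : F20 => connMat G q w a b) p := by
    intro w a b
    exact ((hG.contDiffAt_conn hp a b).differentiableAt
      (by simp)).continuousAlternatingMap_apply_const _
  have hgam : ∀ w : F20, ∀ a b, DifferentiableAt ℝ (fun q : F20 => gam G q.1 w.1 a b) p := by
    intro w a b
    exact (hG.differentiableAt_gam hp.1 w.1 a b).comp p (differentiableAt_fst (𝕜 := ℝ))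
  have hprod : ∀ w : F20, ∀ a b,
      DifferentiableAt ℝ (fun q : F20 => (gam G q.1 w.1 * frameMat q) a b) p := by
    intro w a b
    simp only [Matrix.mul_apply]
    exact DifferentiableAt.fun_sum fun i _ => (hgam w a i).mul (hA i b)
  have hconst : ∀ w : F20, ∀ a b,
      DifferentiableAt ℝ (fun _ : F20 => (Matrix.of w.2 : Matrix (Fin 4) (Fin 4) ℝ) a b) p :=
    fun w a b => differentiableAt_const _
  have hconst0 : ∀ w v : F20,
      matDeriv (fun _ : F20 => (Matrix.of w.2 : Matrix (Fin 4) (Fin 4) ℝ)) p v = 0 := by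
    intro w v; ext a b; simp [matDeriv]
  -- The derivative in the direction v of the identity Aω(w) = w.2 + Γ_w A, which holds in a
  -- neighbourhood of p with w held constant.
  have hD : ∀ v w : F20, Matrix.of v.2 * connMat G p w
      + frameMat p * matDeriv (fun q => connMat G q w) p v =
      dgam G p.1 v.1 w.1 * frameMat p + gam G p.1 w.1 * Matrix.of v.2 := by
    intro v w
    have e : (fun q => frameMat q * connMat G q w) =ᶠ[nhds p]
        fun q => Matrix.of w.2 + gam G q.1 w.1 * frameMat q := by
      filter_upwards [hG.isOpen_framesOver.mem_nhds hp] with q hq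
      rw [connMat_eq, ← Matrix.mul_assoc, frameMat_mul_inv hq, Matrix.one_mul]
    have h := matDeriv_congr e v
    rw [matDeriv_mul hA (hω w), matDeriv_add (hconst w) (hprod w), matDeriv_mul (hgam w) hA,
      matDeriv_frameMat, hconst0, zero_add,
      matDeriv_comp_base (F := fun z => gam G z w.1) (hG.differentiableAt_gam hp.1 w.1),
      hG.fderiv_gam hp.1] at h
    exact h
  have hΦ : ∀ v : F20, frameMat p * connMat G p v = Matrix.of v.2 + gam G p.1 v.1 * frameMat p := by
    intro v
    rw [connMat_eq, ← Matrix.mul_assoc, frameMat_mul_inv hp, Matrix.one_mul]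
  have h1 : frameMat p * curvMat G p v w = baseCurv G p.1 v.1 w.1 * frameMat p := by
    have e1 : ∀ v w : F20, frameMat p * matDeriv (fun q => connMat G q w) p v =
        dgam G p.1 v.1 w.1 * frameMat p + gam G p.1 w.1 * Matrix.of v.2
          - Matrix.of v.2 * connMat G p w := fun v w => by rw [← hD]; abel
    have e2 : ∀ v w : F20, frameMat p * (connMat G p v * connMat G p w) =
        Matrix.of v.2 * connMat G p w
          + gam G p.1 v.1 * (Matrix.of w.2 + gam G p.1 w.1 * frameMat p) := fun v w => by
      rw [← Matrix.mul_assoc, hΦ, Matrix.add_mul, Matrix.mul_assoc, hΦ]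
    rw [h0, Matrix.mul_add, Matrix.mul_sub, Matrix.mul_sub, e1, e1, e2, e2, baseCurv]
    noncomm_ring
  rw [Matrix.mul_assoc, ← h1, ← Matrix.mul_assoc, frameMat_inv_mul hp, Matrix.one_mul]

end FrameForms

/-! ### Values on horizontal fields, and smoothness of all the forms involved -/

section Smoothness

variable {G : E4 → Matrix (Fin 4) (Fin 4) ℝ} {D : Set E4}

theorem theta_horiz {p : F20} (hp : p ∈ framesOver D) (a b : Fin 4) :
    theta a p ![horiz G p b] = if a = b then 1 else 0 := by
  rw [theta_apply]
  have h := congrFun (congrFun (frameMat_inv_mul hp) a) b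
  rw [Matrix.mul_apply, Matrix.one_apply] at h
  exact h

theorem thetaLow_horiz {p : F20} (hp : p ∈ framesOver D) (a b : Fin 4) :
    thetaLow G a p ![horiz G p b] = gFrame G p a b := by
  rw [thetaLow, ContinuousAlternatingMap.sum_apply]
  simp [theta_horiz hp]

theorem schoutenForm_horiz {p : F20} (hp : p ∈ framesOver D) (a b : Fin 4) :
    schoutenForm G a p ![horiz G p b] = schouten G b a p := by
  rw [schoutenForm, ContinuousAlternatingMap.sum_apply]
  simp [theta_horiz hp]

theorem schoutenFormUp_horiz {p : F20} (hp : p ∈ framesOver D) (a b : Fin 4) :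
    schoutenFormUp G a p ![horiz G p b] = ∑ c, gInv G p a c * schouten G b c p := by
  rw [schoutenFormUp, ContinuousAlternatingMap.sum_apply]
  simp [schoutenForm_horiz hp]

theorem weyl_apply (a b : Fin 4) (p v w : F20) : weyl G a b p ![v, w] =
    curv G a b p ![v, w]
      + (theta b p ![v] * schoutenForm G a p ![w] - theta b p ![w] * schoutenForm G a p ![v])
      - (thetaLow G a p ![v] * schoutenFormUp G b p ![w]
        - thetaLow G a p ![w] * schoutenFormUp G b p ![v]) := by
  rw [← wedge_one_one, ← wedge_one_one]
  rfl

theorem weylUp_apply (a b : Fin 4) (p v w : F20) :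
    weylUp G a b p ![v, w] = ∑ c, gInv G p a c * weyl G c b p ![v, w] := by
  rw [weylUp, ContinuousAlternatingMap.sum_apply]
  rfl

theorem weylLow_apply (a b : Fin 4) (p v w : F20) :
    weylLow G a b p ![v, w] = ∑ c, gFrame G p c b * weyl G a c p ![v, w] := by
  rw [weylLow, ContinuousAlternatingMap.sum_apply]
  rfl

theorem IsLorentzOn.contDiffAt_gInv (hG : IsLorentzOn G D) {p : F20} (hp : p ∈ framesOver D)
    (a b : Fin 4) : ContDiffAt ℝ ∞ (fun q => gInv G q a b) p :=
  contDiffAt_inv_entry (hG.contDiffAt_gFrame hp) (hG.det_gFrame_neg hp).ne a b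

/-- Near p the exterior derivative in the definition is replaced by the conjugated base curvature,
an expression in A, A⁻¹, the Christoffel symbols and their first derivatives. -/
theorem IsLorentzOn.contDiffAt_riem (hG : IsLorentzOn G D) {p : F20} (hp : p ∈ framesOver D)
    (c d a b : Fin 4) : ContDiffAt ℝ ∞ (riem G c d a b) p := by
  have hh : ∀ i a, ContDiffAt ℝ ∞ (fun q : F20 => (horiz G q a).1 i) p := fun i a =>
    (contDiff_frameMat_apply i a).contDiffAt
  have hg : ∀ a i j, ContDiffAt ℝ ∞ (fun q : F20 => gam G q.1 (horiz G q a).1 i j) p := by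
    intro a m j
    change ContDiffAt ℝ ∞ (fun q : F20 => ∑ i, christoffel G m i j q.1 * (horiz G q a).1 i) p
    exact ContDiffAt.sum fun i _ =>
      (ContDiffAt.comp_base (hG.contDiffAt_christoffel hp.1 m i j)).mul (hh i a)
  have hdg : ∀ a b i j, ContDiffAt ℝ ∞
      (fun q : F20 => dgam G q.1 (horiz G q a).1 (horiz G q b).1 i j) p := by
    intro a b m j
    change ContDiffAt ℝ ∞ (fun q : F20 => ∑ i, (∑ k, (horiz G q a).1 k *
      pd k (christoffel G m i j) q.1) * (horiz G q b).1 i) p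
    exact ContDiffAt.sum fun i _ => (ContDiffAt.sum fun k _ => (hh k a).mul
      (ContDiffAt.comp_base (contDiffAt_pd (hG.contDiffAt_christoffel hp.1 m i j) k))).mul (hh i b)
  have hB : ∀ i j, ContDiffAt ℝ ∞
      (fun q : F20 => baseCurv G q.1 (horiz G q c).1 (horiz G q d).1 i j) p := fun i j =>
    (((hdg c d i j).sub (hdg d c i j)).add (contDiffAt_matrix_mul (hg c) (hg d) i j)).sub
      (contDiffAt_matrix_mul (hg d) (hg c) i j)
  have h : riem G c d a b =ᶠ[nhds p] fun q => ((frameMat q)⁻¹ *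
      baseCurv G q.1 (horiz G q c).1 (horiz G q d).1 * frameMat q) b a := by
    filter_upwards [hG.isOpen_framesOver.mem_nhds hp] with q hq
    rw [← hG.curvMat_eq hq]
    rfl
  refine ContDiffAt.congr_of_eventuallyEq ?_ h
  exact contDiffAt_matrix_mul (contDiffAt_matrix_mul (contDiffAt_frameInv hp) hB)
    (fun a b => (contDiff_frameMat_apply a b).contDiffAt) b a

theorem IsLorentzOn.contDiffAt_ricci (hG : IsLorentzOn G D) {p : F20} (hp : p ∈ framesOver D)
    (a b : Fin 4) : ContDiffAt ℝ ∞ (ricci G a b) p :=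
  ContDiffAt.sum fun d _ => hG.contDiffAt_riem hp a d b d

theorem IsLorentzOn.contDiffAt_schouten (hG : IsLorentzOn G D) {p : F20} (hp : p ∈ framesOver D)
    (a b : Fin 4) : ContDiffAt ℝ ∞ (schouten G a b) p :=
  contDiffAt_const.mul ((hG.contDiffAt_ricci hp a b).sub ((contDiffAt_const.mul
    (hG.contDiffAt_gFrame hp a b)).mul (ContDiffAt.sum fun c _ => ContDiffAt.sum fun d _ =>
      (hG.contDiffAt_gInv hp c d).mul (hG.contDiffAt_ricci hp c d))))

theorem IsLorentzOn.contDiffAt_weyl_horiz (hG : IsLorentzOn G D) {p : F20}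
    (hp : p ∈ framesOver D) (c d a b : Fin 4) :
    ContDiffAt ℝ ∞ (fun q => weyl G a b q ![horiz G q c, horiz G q d]) p := by
  have h : (fun q => weyl G a b q ![horiz G q c, horiz G q d]) =ᶠ[nhds p] fun q =>
      riem G c d a b q + ((if b = c then 1 else 0) * schouten G d a q
        - (if b = d then 1 else 0) * schouten G c a q)
      - (gFrame G q a c * (∑ e, gInv G q b e * schouten G d e q)
        - gFrame G q a d * (∑ e, gInv G q b e * schouten G c e q)) := by
    filter_upwards [hG.isOpen_framesOver.mem_nhds hp] with q hq
    rw [weyl_apply, theta_horiz hq, theta_horiz hq, thetaLow_horiz hq, thetaLow_horiz hq,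
      schoutenForm_horiz hq, schoutenForm_horiz hq, schoutenFormUp_horiz hq,
      schoutenFormUp_horiz hq]
    rfl
  refine ContDiffAt.congr_of_eventuallyEq ?_ h
  have hS := hG.contDiffAt_schouten hp
  have hU : ∀ d, ContDiffAt ℝ ∞ (fun q => ∑ e, gInv G q b e * schouten G d e q) p := fun d =>
    ContDiffAt.sum fun e _ => (hG.contDiffAt_gInv hp b e).mul (hS d e)
  exact ((hG.contDiffAt_riem hp c d a b).add ((contDiffAt_const.mul (hS d a)).sub
    (contDiffAt_const.mul (hS c a)))).sub (((hG.contDiffAt_gFrame hp a c).mul (hU d)).sub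
      ((hG.contDiffAt_gFrame hp a d).mul (hU c)))

theorem IsLorentzOn.contDiffAt_etaUp (hG : IsLorentzOn G D) {p : F20} (hp : p ∈ framesOver D)
    (a b c d : Fin 4) : ContDiffAt ℝ ∞ (fun q => etaUp (gFrame G q) a b c d) p := by
  have hs : ContDiffAt ℝ ∞ (fun q => Real.sqrt (-(gFrame G q).det)) p :=
    (contDiffAt_det (hG.contDiffAt_gFrame hp)).neg.sqrt (neg_ne_zero.2 (hG.det_gFrame_neg hp).ne)
  have hi := hG.contDiffAt_gInv hp
  exact ContDiffAt.sum fun x _ => ContDiffAt.sum fun y _ => ContDiffAt.sum fun z _ =>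
    (((hi a x).mul (hi b y)).mul (hi c z)).mul (hs.mul contDiffAt_const)

/-- The dual sees a form only through its components on the horizontal fields. Smoothness of these
functions is enough, and no smoothness of the curvature as a form is required. -/
theorem IsLorentzOn.contDiffAt_hodge (hG : IsLorentzOn G D) {p : F20} (hp : p ∈ framesOver D)
    {α : Form F20 3} (hα : ∀ a b c,
      ContDiffAt ℝ ∞ (fun q => α q ![horiz G q a, horiz G q b, horiz G q c]) p) :
    ContDiffAt ℝ ∞ (hodge G α) p := by
  have h : ∀ d, ContDiffAt ℝ ∞ (fun q => (1 / 6 : ℝ) * ∑ a, ∑ b, ∑ c,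
      α q ![horiz G q a, horiz G q b, horiz G q c] * etaUp (gFrame G q) a b c d) p := fun d =>
    contDiffAt_const.mul (ContDiffAt.sum fun a _ => ContDiffAt.sum fun b _ =>
      ContDiffAt.sum fun c _ => (hα a b c).mul (hG.contDiffAt_etaUp hp a b c d))
  change ContDiffAt ℝ ∞ (fun q => ∑ d, ((1 / 6 : ℝ) * ∑ a, ∑ b, ∑ c,
    α q ![horiz G q a, horiz G q b, horiz G q c] * etaUp (gFrame G q) a b c d) • theta d q) p
  refine ContDiffAt.sum fun d _ => ?_
  exact (h d).smul (contDiffAt_theta hp d)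

theorem IsLorentzOn.contDiffAt_wedge_thetaLow_horiz (hG : IsLorentzOn G D) {p : F20}
    (hp : p ∈ framesOver D) {μ : Form F20 2}
    (hμ : ∀ a b, ContDiffAt ℝ ∞ (fun q => μ q ![horiz G q a, horiz G q b]) p) (a x y z : Fin 4) :
    ContDiffAt ℝ ∞ (fun q => (wedge (μ q) (thetaLow G a q) : Alt F20 3)
      ![horiz G q x, horiz G q y, horiz G q z]) p := by
  have h : (fun q => (wedge (μ q) (thetaLow G a q) : Alt F20 3)
      ![horiz G q x, horiz G q y, horiz G q z]) =ᶠ[nhds p] fun q =>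
      μ q ![horiz G q x, horiz G q y] * gFrame G q a z
        - μ q ![horiz G q x, horiz G q z] * gFrame G q a y
        + μ q ![horiz G q y, horiz G q z] * gFrame G q a x := by
    filter_upwards [hG.isOpen_framesOver.mem_nhds hp] with q hq
    rw [← thetaLow_horiz hq, ← thetaLow_horiz hq, ← thetaLow_horiz hq]
    exact wedge_two_one _ _ _ _ _
  refine ContDiffAt.congr_of_eventuallyEq ?_ h
  have hg := hG.contDiffAt_gFrame hp
  exact (((hμ x y).mul (hg a z)).sub ((hμ x z).mul (hg a y))).add ((hμ y z).mul (hg a x))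

theorem IsLorentzOn.contDiffAt_omega (hG : IsLorentzOn G D) {p : F20} (hp : p ∈ framesOver D)
    (d e a b c : Fin 4) : ContDiffAt ℝ ∞ (omega G d e a b c) p := by
  have hW : ∀ c d, ContDiffAt ℝ ∞
      (hodge G (fun q => wedge (weyl G c d q) (thetaLow G a q))) p := fun c d =>
    hG.contDiffAt_hodge hp (hG.contDiffAt_wedge_thetaLow_horiz hp
      (fun x y => hG.contDiffAt_weyl_horiz hp x y c d) a)
  have hU : ContDiffAt ℝ ∞
      (hodge G (fun q => wedge (weylUp G d e q) (thetaLow G a q))) p := by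
    refine hG.contDiffAt_hodge hp (hG.contDiffAt_wedge_thetaLow_horiz hp (fun x y => ?_) a)
    simp only [weylUp_apply]
    exact ContDiffAt.sum fun f _ =>
      (hG.contDiffAt_gInv hp d f).mul (hG.contDiffAt_weyl_horiz hp x y f e)
  have h1 : ContDiffAt ℝ ∞ (fun q => ((1 / 2) * gFrame G q b c) •
      hodge G (fun q => wedge (weylUp G d e q) (thetaLow G a q)) q) p :=
    (contDiffAt_const.mul (hG.contDiffAt_gFrame hp b c)).smul hU
  have h2 : ∀ e b c d, ContDiffAt ℝ ∞ (fun q => kron e b •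
      hodge G (fun q => wedge (weyl G c d q) (thetaLow G a q)) q) p := fun e b c d =>
    (hW c d).const_smul (kron e b)
  exact (h1.add (h2 e b c d)).add (h2 e c b d)

theorem IsLorentzOn.contDiffAt_potential (hG : IsLorentzOn G D) {p : F20}
    (hp : p ∈ framesOver D) (a b c : Fin 4) : ContDiffAt ℝ ∞ (potential G a b c) p :=
  ContDiffAt.sum fun d _ => ContDiffAt.sum fun e _ =>
    contDiffAt_wedge (hG.contDiffAt_omega hp d e a b c) (hG.contDiffAt_connLow hp d e)

end Smoothness

/-! ### Structure equations with lowered indices and the differential of the potential -/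

section Structure

variable {G : E4 → Matrix (Fin 4) (Fin 4) ℝ} {D : Set E4}

theorem IsLorentzOn.gFrame_apply_symm (hG : IsLorentzOn G D) {p : F20} (hp : p ∈ framesOver D)
    (a b : Fin 4) : gFrame G p a b = gFrame G p b a :=
  congrFun (congrFun (hG.gFrame_transpose hp) b) a

variable (G) in
/-- The curvature forms `ℛ_{ba} = ℛ_b^c g_{ca}`. -/
def curvLow (b a : Fin 4) : Form F20 2 := fun p => ∑ c, gFrame G p a c • curv G b c p

theorem curvLow_apply (b a : Fin 4) (p v w : F20) :
    curvLow G b a p ![v, w] = (gFrame G p * curvMat G p v w) a b := by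
  rw [curvLow, ContinuousAlternatingMap.sum_apply, Matrix.mul_apply]
  rfl

/-- The matrix equals Aᵀ(GB)A with B the base curvature, and congruence preserves the skewness of
GB. -/
theorem IsLorentzOn.gFrame_mul_curvMat_skew (hG : IsLorentzOn G D) {p : F20}
    (hp : p ∈ framesOver D) (v w : F20) :
    (gFrame G p * curvMat G p v w).transpose = -(gFrame G p * curvMat G p v w) := by
  have e : gFrame G p * curvMat G p v w =
      (frameMat p).transpose * (G p.1 * baseCurv G p.1 v.1 w.1) * frameMat p := by
    rw [hG.curvMat_eq hp, gFrame_eq, Matrix.mul_assoc, ← Matrix.mul_assoc (frameMat p),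
      ← Matrix.mul_assoc (frameMat p), frameMat_mul_inv hp, Matrix.one_mul]
    simp only [Matrix.mul_assoc]
  have h := hG.baseCurv_skew hp.1 v.1 w.1
  have h' : (baseCurv G p.1 v.1 w.1).transpose * G p.1 = -(G p.1 * baseCurv G p.1 v.1 w.1) :=
    (neg_eq_of_add_eq_zero_right h).symm
  rw [e]
  simp only [Matrix.transpose_mul, Matrix.transpose_transpose, hG.symm _ hp.1, h',
    Matrix.mul_neg, Matrix.neg_mul, Matrix.mul_assoc]

theorem IsLorentzOn.curvLow_skew (hG : IsLorentzOn G D) {p : F20} (hp : p ∈ framesOver D)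
    (a b : Fin 4) : curvLow G a b p = -curvLow G b a p :=
  alt_two_ext fun v w => by
    change _ = -(curvLow G b a p ![v, w])
    rw [curvLow_apply, curvLow_apply]
    exact congrFun (congrFun (hG.gFrame_mul_curvMat_skew hp v w) a) b

/-- `dΓ_{de} = Γ^f_d ∧ Γ_{fe} + ℛ_{ed}`. -/
theorem IsLorentzOn.extDeriv_connLow (hG : IsLorentzOn G D) {p : F20} (hp : p ∈ framesOver D)
    (d e : Fin 4) : extDeriv (connLow G d e) p =
      ∑ f, wedge (conn G f d p) (connLow G f e p) + curvLow G e d p := by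
  have hg : ∀ a b, DifferentiableAt ℝ (fun q => gFrame G q a b) p := fun a b =>
    (hG.contDiffAt_gFrame hp a b).differentiableAt (by simp)
  have hc : ∀ a b, DifferentiableAt ℝ (conn G a b) p := fun a b =>
    (hG.contDiffAt_conn hp a b).differentiableAt (by simp)
  -- The differential of g_{dc} contributes Γ_{dc} + Γ_{cd}. The first part cancels against the
  -- quadratic term of the structure equation; the second survives.
  have h1 : extDeriv (connLow G d e) p = ∑ c, (gFrame G p d c • extDeriv (conn G c e) p
      + wedge (connLow G d c p + connLow G c d p) (conn G c e p)) := by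
    refine (extDeriv_sum Finset.univ (fun c q => gFrame G q d c • conn G c e q)
      fun c _ => (hg d c).smul (hc c e)).trans (Finset.sum_congr rfl fun c _ => ?_)
    rw [extDeriv_fun_smul_one (hg d c) (hc c e)]
    congr 2
    exact alt_one_ext fun v => hG.fderiv_gFrame hp d c v
  have h2 : ∀ c, extDeriv (conn G c e) p =
      curv G e c p - ∑ f, wedge (conn G c f p) (conn G f e p) := fun c => by
    rw [curv]; exact (add_sub_cancel_right _ _).symm
  have h3 : ∑ c, gFrame G p d c • (∑ f, wedge (conn G c f p) (conn G f e p) : Alt F20 2) =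
      ∑ c, wedge (connLow G d c p) (conn G c e p) := by
    simp only [connLow, wedge_sum_left, wedge_smul_left, Finset.smul_sum]
    exact Finset.sum_comm
  have h4 : (∑ c, wedge (connLow G c d p) (conn G c e p) : Alt F20 2) =
      ∑ f, wedge (conn G f d p) (connLow G f e p) := by
    simp only [connLow, wedge_sum_left, wedge_smul_left, wedge_sum_right, wedge_smul_right]
    rw [Finset.sum_comm]
    refine Finset.sum_congr rfl fun f _ => Finset.sum_congr rfl fun c _ => ?_
    rw [hG.gFrame_apply_symm hp]
  rw [h1]
  simp only [h2, wedge_add_left, smul_sub, Finset.sum_add_distrib, Finset.sum_sub_distrib]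
  rw [h3, h4, curvLow]
  exact (by intros; abel : ∀ x y z : Alt F20 2, x - y + (y + z) = z + x) _ _ _

/-- The definition of the Weyl forms is solved for the curvature and its upper index lowered; g g⁻¹
= 1 turns `schoutenFormUp` back into `schoutenForm`. -/
theorem curvLow_eq (b a : Fin 4) (p : F20) (hG : IsLorentzOn G D) (hp : p ∈ framesOver D) :
    curvLow G b a p = weylLow G b a p - wedge (thetaLow G a p) (schoutenForm G b p)
      + wedge (thetaLow G b p) (schoutenForm G a p) := by
  have hinv : gFrame G p * gInv G p = 1 :=
    Matrix.mul_nonsing_inv _ (hG.det_gFrame_neg hp).ne.isUnit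
  have h1 : ∀ c, curv G b c p = weyl G b c p - wedge (theta c p) (schoutenForm G b p)
      + wedge (thetaLow G b p) (schoutenFormUp G c p) := fun c => by
    rw [weyl]
    exact (by intros; abel : ∀ x y z : Alt F20 2, x = x + y - z - y + z) _ _ _
  have h2 : ∑ c, gFrame G p a c • wedge (theta c p) (schoutenForm G b p) =
      wedge (thetaLow G a p) (schoutenForm G b p) := by
    simp only [thetaLow, wedge_sum_left, wedge_smul_left]
  have h3 : ∑ c, gFrame G p a c • schoutenFormUp G c p = schoutenForm G a p := by
    simp only [schoutenFormUp, Finset.smul_sum, smul_smul]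
    rw [Finset.sum_comm]
    simp only [← Finset.sum_smul]
    have : ∀ e, ∑ c, gFrame G p a c * gInv G p c e = if a = e then 1 else 0 := fun e => by
      rw [← Matrix.mul_apply, hinv, Matrix.one_apply]
    simp [this]
  have h4 : ∑ c, gFrame G p a c • wedge (thetaLow G b p) (schoutenFormUp G c p) =
      wedge (thetaLow G b p) (schoutenForm G a p) := by
    rw [← h3]
    simp only [wedge_sum_right, wedge_smul_right]
  have h5 : weylLow G b a p = ∑ c, gFrame G p a c • weyl G b c p :=
    Finset.sum_congr rfl fun c _ => by rw [hG.gFrame_apply_symm hp]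
  rw [h5, ← h2, ← h4, curvLow, ← Finset.sum_sub_distrib, ← Finset.sum_add_distrib]
  refine Finset.sum_congr rfl fun c _ => ?_
  rw [h1, smul_add, smul_sub]

/-- The exterior derivative of the superenergy potential. -/
theorem IsLorentzOn.extDeriv_potential (hG : IsLorentzOn G D) {p : F20} (hp : p ∈ framesOver D)
    (a b c : Fin 4) : extDeriv (potential G a b c) p
      = (∑ d, ∑ e, wedge (xi G d e a b c p) (connLow G d e p))
        + kForm G a b c p + belRobinson G a b c p := by
  have hΩ : ∀ d e, DifferentiableAt ℝ (omega G d e a b c) p := fun d e =>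
    (hG.contDiffAt_omega hp d e a b c).differentiableAt (by simp)
  have hΓ : ∀ d e, DifferentiableAt ℝ (connLow G d e) p := fun d e =>
    (hG.contDiffAt_connLow hp d e).differentiableAt (by simp)
  have hw : ∀ d e, DifferentiableAt ℝ
      (fun q => (wedge (omega G d e a b c q) (connLow G d e q) : Alt F20 2)) p := fun d e =>
    (contDiffAt_wedge (hG.contDiffAt_omega hp d e a b c)
      (hG.contDiffAt_connLow hp d e)).differentiableAt (by simp)
  have h1 : extDeriv (potential G a b c) p = ∑ d, ∑ e,
      (wedge (extDeriv (omega G d e a b c) p) (connLow G d e p)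
        - wedge (omega G d e a b c p) (extDeriv (connLow G d e) p) : Alt F20 3) := by
    refine (extDeriv_sum Finset.univ (fun d q => ∑ e, (wedge (omega G d e a b c q)
      (connLow G d e q) : Alt F20 2)) fun d _ => DifferentiableAt.fun_sum fun e _ =>
        hw d e).trans (Finset.sum_congr rfl fun d _ => ?_)
    refine (extDeriv_sum Finset.univ (fun e q => (wedge (omega G d e a b c q)
      (connLow G d e q) : Alt F20 2)) fun e _ => hw d e).trans
        (Finset.sum_congr rfl fun e _ => ?_)
    exact extDeriv_wedge_one_one (hΩ d e) (hΓ d e)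
  -- Anticommuting Γ^f_d past Ω^{de} and renaming d and f turns the quadratic part of dΓ into minus
  -- the connection term of Ξ.
  have h2 : (∑ d, ∑ e, wedge (omega G d e a b c p)
      (∑ f, wedge (conn G f d p) (connLow G f e p)) : Alt F20 3) =
      -∑ d, ∑ e, wedge (∑ f, wedge (conn G d f p) (omega G f e a b c p)) (connLow G d e p) := by
    have e1 : ∀ d e f, (wedge (omega G d e a b c p)
        (wedge (conn G f d p) (connLow G f e p)) : Alt F20 3) =
        -wedge (wedge (conn G f d p) (omega G d e a b c p)) (connLow G f e p) := fun d e f => by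
      rw [← wedge_assoc_one, wedge_comm_one, wedge_neg_left]
    simp only [wedge_sum_left, wedge_sum_right]
    rw [← Finset.sum_neg_distrib]
    have e2 : ∀ d, (∑ e, ∑ f, wedge (omega G d e a b c p)
        (wedge (conn G f d p) (connLow G f e p)) : Alt F20 3) = ∑ f, ∑ e,
        -wedge (wedge (conn G f d p) (omega G d e a b c p)) (connLow G f e p) := fun d => by
      rw [Finset.sum_comm]
      exact Finset.sum_congr rfl fun f _ => Finset.sum_congr rfl fun e _ => e1 d e f
    rw [Finset.sum_congr rfl fun d _ => e2 d, Finset.sum_comm]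
    refine Finset.sum_congr rfl fun f _ => ?_
    rw [Finset.sum_comm, ← Finset.sum_neg_distrib]
    refine Finset.sum_congr rfl fun e _ => ?_
    rw [← Finset.sum_neg_distrib]
  -- Skewness of ℛ arranges the indices as in Ω^{ed} ∧ 𝒲_{ed}, at the cost of a sign. The two
  -- Schouten terms differ by an exchange of e and d, which is the antisymmetrization in 𝒦.
  have h3 : (∑ d, ∑ e, wedge (omega G d e a b c p) (curvLow G e d p) : Alt F20 3) =
      -(kForm G a b c p + belRobinson G a b c p) := by
    have e1 : ∀ e d, (wedge (omega G e d a b c p) (curvLow G d e p) : Alt F20 3) =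
        -(wedge (omega G e d a b c p) (weylLow G e d p)
          + (wedge (omega G e d a b c p) (wedge (schoutenForm G e p) (thetaLow G d p))
          - wedge (omega G e d a b c p) (wedge (schoutenForm G d p) (thetaLow G e p)))) := by
      intro e d
      rw [hG.curvLow_skew hp, wedge_neg_right, curvLow_eq e d p hG hp,
        wedge_comm_one (thetaLow G d p), wedge_comm_one (thetaLow G e p), wedge_add_right,
        wedge_sub_right, wedge_neg_right, wedge_neg_right]
      exact (by intros; abel : ∀ x y z : Alt F20 3, -(x - -y + -z) = -(x + (y - z))) _ _ _
    rw [Finset.sum_congr rfl fun e _ => Finset.sum_congr rfl fun d _ => e1 e d]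
    simp only [Finset.sum_neg_distrib, Finset.sum_add_distrib, Finset.sum_sub_distrib]
    rw [kForm, belRobinson]
    simp only [wedge_sub_left, Finset.sum_sub_distrib]
    have e2 := Finset.sum_comm (s := Finset.univ) (t := Finset.univ)
      (f := fun e d => (wedge (omega G e d a b c p)
        (wedge (schoutenForm G d p) (thetaLow G e p)) : Alt F20 3))
    rw [e2]
    exact (by intros; abel : ∀ x y z : Alt F20 3, -(x + (y - z)) = -(y - z + x)) _ _ _
  have h4 : (∑ d, ∑ e, wedge (omega G d e a b c p) (extDeriv (connLow G d e) p) : Alt F20 3) =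
      ∑ d, ∑ e, wedge (omega G d e a b c p) (∑ f, wedge (conn G f d p) (connLow G f e p))
        + ∑ d, ∑ e, wedge (omega G d e a b c p) (curvLow G e d p) := by
    simp only [hG.extDeriv_connLow hp, wedge_add_right, Finset.sum_add_distrib]
  have h5 : (∑ d, ∑ e, wedge (xi G d e a b c p) (connLow G d e p) : Alt F20 3) =
      ∑ d, ∑ e, wedge (extDeriv (omega G d e a b c) p) (connLow G d e p)
        + ∑ d, ∑ e, wedge (∑ f, wedge (conn G d f p) (omega G f e a b c p))
            (connLow G d e p) := by
    simp only [xi, wedge_add_left, Finset.sum_add_distrib]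
  have h6 := h1.trans ((Finset.sum_congr rfl fun d _ => Finset.sum_sub_distrib _ _).trans
    (Finset.sum_sub_distrib _ _))
  rw [h4, h2, h3] at h6
  refine h6.trans ?_
  erw [h5]
  generalize kForm G a b c p = K
  generalize belRobinson G a b c p = T
  exact (by intros; abel : ∀ x y z w : Alt F20 3, x - (-y + -(z + w)) = x + y + z + w) _ _ _ _

end Structure

/-! ### Identities for the alternating symbol -/

section Epsilon

theorem sum_vecCons {A ι : Type*} [AddCommMonoid A] [Fintype ι] {n : ℕ}
    (f : (Fin (n + 1) → ι) → A) :
    ∑ y, f y = ∑ a, ∑ z : Fin n → ι, f (Matrix.vecCons a z) := by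
  rw [← Fintype.sum_prod_type']
  exact (Fintype.sum_equiv (Fin.consEquiv fun _ => ι) (fun x => f (Matrix.vecCons x.1 x.2)) f
    fun _ => rfl).symm

theorem sum_vec_zero {A ι : Type*} [AddCommMonoid A] [Fintype ι] (f : (Fin 0 → ι) → A) :
    ∑ y, f y = f ![] := by
  rw [Fintype.sum_unique]
  congr 1

/-- Selecting rows is left multiplication by a 0-1 matrix. Repeated indices are allowed, so the
value 0 of the symbol on them needs no separate treatment. -/
theorem det_selection_mul (M : Matrix (Fin 4) (Fin 4) ℝ) (x : Fin 4 → Fin 4) :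
    (Matrix.of fun i j => M (x i) j).det =
      (Matrix.of fun i j : Fin 4 => if x i = j then (1 : ℝ) else 0).det * M.det := by
  rw [← Matrix.det_mul]
  congr 1
  ext i j
  simp [Matrix.mul_apply]

/-- The left side is the multilinear expansion of the determinant of the matrix formed by the rows
a, b, c, d of M. -/
theorem sum_mul_eps (M : Matrix (Fin 4) (Fin 4) ℝ) (a b c d : Fin 4) :
    ∑ a', ∑ b', ∑ c', ∑ d', M a a' * M b b' * M c c' * M d d' * eps a' b' c' d' =
      M.det * eps a b c d := by
  rw [mul_comm, eps, ← det_selection_mul]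
  have h : (Matrix.of fun i j => M (![a, b, c, d] i) j).det =
      Matrix.detRowAlternating fun i =>
        ∑ j, M (![a, b, c, d] i) j • (Pi.single j 1 : Fin 4 → ℝ) := by
    change Matrix.detRowAlternating _ = _
    congr 1
    ext i j
    simp [Finset.sum_apply, Pi.single_apply]
  rw [h, ← AlternatingMap.coe_multilinearMap, MultilinearMap.map_sum]
  simp only [MultilinearMap.map_smul_univ, sum_vecCons, sum_vec_zero, Fin.prod_univ_four]
  refine Finset.sum_congr rfl fun x _ => Finset.sum_congr rfl fun y _ =>
    Finset.sum_congr rfl fun z _ => Finset.sum_congr rfl fun w _ => ?_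
  rw [smul_eq_mul]
  congr 1
  change Matrix.det _ = Matrix.det _
  congr 1
  ext i j
  simp [Pi.single_apply, eq_comm]

theorem det_selection_swap (x : Fin 4 → Fin 4) {i j : Fin 4} (hij : i ≠ j) :
    (Matrix.of fun k l : Fin 4 => if (x ∘ Equiv.swap i j) k = l then (1 : ℝ) else 0).det =
      -(Matrix.of fun k l : Fin 4 => if x k = l then (1 : ℝ) else 0).det :=
  Matrix.detRowAlternating.map_swap (R := ℝ)
    (fun k : Fin 4 => fun l : Fin 4 => if x k = l then (1 : ℝ) else 0) hij

theorem eps_swap_fst (a b c d : Fin 4) : eps b a c d = -eps a b c d := by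
  have h : ![b, a, c, d] = ![a, b, c, d] ∘ Equiv.swap 0 1 := by
    ext k; fin_cases k <;> rfl
  rw [eps, h]
  exact det_selection_swap _ (by decide)

theorem eps_swap_snd (a b c d : Fin 4) : eps a c b d = -eps a b c d := by
  have h : ![a, c, b, d] = ![a, b, c, d] ∘ Equiv.swap 1 2 := by
    ext k; fin_cases k <;> rfl
  rw [eps, h]
  exact det_selection_swap _ (by decide)

theorem eps_swap_trd (a b c d : Fin 4) : eps a b d c = -eps a b c d := by
  have h : ![a, b, d, c] = ![a, b, c, d] ∘ Equiv.swap 2 3 := by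
    ext k; fin_cases k <;> rfl
  rw [eps, h]
  exact det_selection_swap _ (by decide)

theorem eps_cycle (a b c d : Fin 4) : eps a b c d = -eps d a b c := by
  rw [eps_swap_fst a d, eps_swap_snd a b d, eps_swap_trd a b c d]
  ring

/-- Inserting M⁻¹M = 1 at the free fourth index reduces this to `sum_mul_eps`. -/
theorem sum_mul_eps_three (M : Matrix (Fin 4) (Fin 4) ℝ) (hM : M.det ≠ 0) (a b c d : Fin 4) :
    ∑ a', ∑ b', ∑ c', M a a' * M b b' * M c c' * eps a' b' c' d =
      M.det * ∑ s, M⁻¹ d s * eps a b c s := by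
  have hinv : M⁻¹ * M = 1 := Matrix.nonsing_inv_mul _ hM.isUnit
  have h1 : ∀ e, ∑ s, M⁻¹ d s * M s e = if d = e then 1 else 0 := fun e => by
    rw [← Matrix.mul_apply, hinv, Matrix.one_apply]
  rw [Finset.mul_sum]
  have h2 : ∀ s, M.det * (M⁻¹ d s * eps a b c s) = ∑ a', ∑ b', ∑ c', ∑ d',
      M a a' * M b b' * M c c' * (M⁻¹ d s * M s d') * eps a' b' c' d' := fun s => by
    rw [mul_left_comm, ← sum_mul_eps]
    simp only [Finset.mul_sum]
    refine Finset.sum_congr rfl fun x _ => Finset.sum_congr rfl fun y _ =>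
      Finset.sum_congr rfl fun z _ => Finset.sum_congr rfl fun w _ => ?_
    ring
  simp only [h2]
  conv_rhs => rw [Finset.sum_comm]
  refine Finset.sum_congr rfl fun x _ => ?_
  conv_rhs => rw [Finset.sum_comm]
  refine Finset.sum_congr rfl fun y _ => ?_
  conv_rhs => rw [Finset.sum_comm]
  refine Finset.sum_congr rfl fun z _ => ?_
  conv_rhs => rw [Finset.sum_comm]
  simp only [← Finset.sum_mul, ← Finset.mul_sum, h1]
  simp

theorem kron_comm (a b : Fin 4) : kron a b = kron b a := by
  simp only [kron, eq_comm]

theorem sum_kron_mul (a : Fin 4) (f : Fin 4 → ℝ) : ∑ d, kron a d * f d = f a := by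
  simp [kron]

theorem sum_mul_kron (a : Fin 4) (f : Fin 4 → ℝ) : ∑ d, f d * kron a d = f a := by
  simp [kron]

theorem eps_mul_eps (a b c d p q r s : Fin 4) : eps a b c d * eps p q r s =
    (Matrix.of fun i j => kron (![a, b, c, d] i) (![p, q, r, s] j)).det := by
  rw [eps, eps, ← Matrix.det_transpose (Matrix.of fun i j : Fin 4 =>
    if ![p, q, r, s] i = j then (1 : ℝ) else 0), ← Matrix.det_mul]
  congr 1
  ext i j
  simp [Matrix.mul_apply, kron, eq_comm]

/-- In the expansion of the 4×4 determinant of Kronecker symbols, the entry δ_{dd} contributes the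
3×3 determinant four times after summation, and the nine remaining terms remove it three times. -/
theorem sum_eps_mul_eps (a b c p q r : Fin 4) : ∑ d, eps d a b c * eps d p q r =
    kron a p * (kron b q * kron c r - kron b r * kron c q)
      - kron a q * (kron b p * kron c r - kron b r * kron c p)
      + kron a r * (kron b p * kron c q - kron b q * kron c p) := by
  have hk : ∀ x y, ∑ d, kron x d * kron d y = kron x y := fun x y =>
    sum_kron_mul x fun d => kron d y
  have hd : ∀ d : Fin 4, kron d d = 1 := fun d => by simp [kron]
  have h : ∀ d, eps d a b c * eps d p q r =
      (kron a p * (kron b q * kron c r - kron b r * kron c q)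
      - kron a q * (kron b p * kron c r - kron b r * kron c p)
      + kron a r * (kron b p * kron c q - kron b q * kron c p))
      - (kron a d * kron d p) * (kron b q * kron c r - kron b r * kron c q)
      + (kron a d * kron d q) * (kron b p * kron c r - kron b r * kron c p)
      - (kron a d * kron d r) * (kron b p * kron c q - kron b q * kron c p)
      + (kron b d * kron d p) * (kron a q * kron c r - kron a r * kron c q)
      - (kron b d * kron d q) * (kron a p * kron c r - kron a r * kron c p)
      + (kron b d * kron d r) * (kron a p * kron c q - kron a q * kron c p)
      - (kron c d * kron d p) * (kron a q * kron b r - kron a r * kron b q)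
      + (kron c d * kron d q) * (kron a p * kron b r - kron a r * kron b p)
      - (kron c d * kron d r) * (kron a p * kron b q - kron a q * kron b p) := fun d => by
    rw [eps_mul_eps, Matrix.det_succ_row_zero]
    simp [Fin.sum_univ_succ, Matrix.det_fin_three, Fin.succAbove, hd]
    ring
  simp only [h, Finset.sum_add_distrib, Finset.sum_sub_distrib, ← Finset.sum_mul, hk,
    Finset.sum_const, Finset.card_univ, Fintype.card_fin, nsmul_eq_mul]
  push_cast
  ring

end Epsilon

theorem sum_three_comm {ι A : Type*} [Fintype ι] [AddCommMonoid A] (F : ι → ι → ι → ι → ι → ι → A) :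
    ∑ a, ∑ b, ∑ c, ∑ x, ∑ y, ∑ z, F a b c x y z = ∑ x, ∑ y, ∑ z, ∑ a, ∑ b, ∑ c, F a b c x y z := by
  have h := Finset.sum_comm (s := Finset.univ) (t := Finset.univ)
    (f := fun p q : ι × ι × ι => F p.1 p.2.1 p.2.2 q.1 q.2.1 q.2.2)
  simpa only [Fintype.sum_prod_type] using h

/-! ### The Hodge dual of 3-forms in components -/

section Dual

/-- The components of the Hodge dual of a `3`-form with components `A`. -/
def dualCoef (g : Matrix (Fin 4) (Fin 4) ℝ) (A : Fin 4 → Fin 4 → Fin 4 → ℝ) (d : Fin 4) : ℝ :=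
  (1 / 6 : ℝ) * ∑ a, ∑ b, ∑ c, A a b c * etaUp g a b c d

theorem hodgeThree_eq {V : Type*} [NormedAddCommGroup V] [NormedSpace ℝ V]
    (g : Matrix (Fin 4) (Fin 4) ℝ) (e : Fin 4 → V) (θ : Fin 4 → Alt V 1) (α : Alt V 3) :
    hodgeThree g e θ α = ∑ d, dualCoef g (fun a b c => α ![e a, e b, e c]) d • θ d := rfl

theorem sqrt_neg_det_ne {g : Matrix (Fin 4) (Fin 4) ℝ} (hg : g.det < 0) :
    Real.sqrt (-g.det) ≠ 0 := (Real.sqrt_pos.2 (neg_pos.2 hg)).ne'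

/-- Three factors g⁻¹ on ε give det g⁻¹ and leave one g on the last index. The minus sign is
Lorentzian: √(-det g) / det g = -1 / √(-det g). -/
theorem etaUp_eq {g : Matrix (Fin 4) (Fin 4) ℝ} (hg : g.det < 0) (a b c d : Fin 4) :
    etaUp g a b c d = -(Real.sqrt (-g.det))⁻¹ * ∑ s, g d s * eps a b c s := by
  have hu : IsUnit g.det := hg.ne.isUnit
  have h := sum_mul_eps_three g⁻¹ (by rw [Matrix.det_nonsing_inv]; simpa using hg.ne) a b c d
  rw [Matrix.nonsing_inv_nonsing_inv _ hu, Matrix.det_nonsing_inv, Ring.inverse_eq_inv'] at h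
  have h2 : etaUp g a b c d = Real.sqrt (-g.det) *
      ∑ a', ∑ b', ∑ c', g⁻¹ a a' * g⁻¹ b b' * g⁻¹ c c' * eps a' b' c' d := by
    simp only [etaUp, eta, Finset.mul_sum]
    refine Finset.sum_congr rfl fun x _ => Finset.sum_congr rfl fun y _ =>
      Finset.sum_congr rfl fun z _ => ?_
    ring
  rw [h2, h, ← mul_assoc]
  congr 1
  have hs := sqrt_neg_det_ne hg
  have hsq : Real.sqrt (-g.det) * Real.sqrt (-g.det) = -g.det :=
    Real.mul_self_sqrt (neg_pos.2 hg).le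
  field_simp
  rw [sq, hsq]
  field_simp [hg.ne]

theorem dualCoef_eq {g : Matrix (Fin 4) (Fin 4) ℝ} (hg : g.det < 0)
    (A : Fin 4 → Fin 4 → Fin 4 → ℝ) (d : Fin 4) :
    dualCoef g A d = -(Real.sqrt (-g.det))⁻¹ *
      ∑ s, g d s * ((1 / 6) * ∑ a, ∑ b, ∑ c, A a b c * eps a b c s) := by
  simp only [dualCoef, etaUp_eq hg, Finset.mul_sum]
  conv_rhs => rw [Finset.sum_comm]
  refine Finset.sum_congr rfl fun x _ => ?_
  conv_rhs => rw [Finset.sum_comm]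
  refine Finset.sum_congr rfl fun y _ => ?_
  conv_rhs => rw [Finset.sum_comm]
  refine Finset.sum_congr rfl fun z _ => Finset.sum_congr rfl fun w _ => ?_
  ring

/-- The sign of a real number, as a real number. -/
def rsign (x : ℝ) : ℝ := ((SignType.sign x : SignType) : ℝ)

theorem rsign_eq {x : ℝ} (hx : x ≠ 0) : rsign x = |x|⁻¹ * x := by
  have h : |x| ≠ 0 := abs_ne_zero.2 hx
  rw [rsign, eq_inv_mul_iff_mul_eq₀ h]
  exact abs_mul_sign x

/-- The behaviour of the Hodge dual under a change of the frame. -/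
theorem dualCoef_change {g h : Matrix (Fin 4) (Fin 4) ℝ} (hg : g.det < 0) (hh : h.det ≠ 0)
    (A A' : Fin 4 → Fin 4 → Fin 4 → ℝ)
    (hA : ∀ a b c, A' a b c = ∑ x, ∑ y, ∑ z, h x a * h y b * h z c * A x y z) (d : Fin 4) :
    dualCoef (h.transpose * g * h) A' d = rsign h.det * ∑ t, h t d * dualCoef g A t := by
  have hdet : (h.transpose * g * h).det = h.det ^ 2 * g.det := by
    rw [Matrix.det_mul, Matrix.det_mul, Matrix.det_transpose]; ring
  have hneg : (h.transpose * g * h).det < 0 := by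
    rw [hdet]; exact mul_neg_of_pos_of_neg (by positivity) hg
  -- The square root yields |det h|, whereas ε yields det h (in `hinner`); their quotient is the
  -- sign in the transformation law.
  have hsq : Real.sqrt (-(h.transpose * g * h).det) = |h.det| * Real.sqrt (-g.det) := by
    rw [hdet, ← mul_neg, Real.sqrt_mul (sq_nonneg _), Real.sqrt_sq_eq_abs]
  have hinner : ∀ s, ∑ a, ∑ b, ∑ c, A' a b c * eps a b c s =
      h.det * ∑ r, h⁻¹ s r * ∑ x, ∑ y, ∑ z, A x y z * eps x y z r := by
    intro s
    have h1 : ∀ x y z, ∑ a, ∑ b, ∑ c, h x a * h y b * h z c * eps a b c s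
        = h.det * ∑ r, h⁻¹ s r * eps x y z r := fun x y z => sum_mul_eps_three h hh x y z s
    calc _ = ∑ a, ∑ b, ∑ c, ∑ x, ∑ y, ∑ z,
          h x a * h y b * h z c * A x y z * eps a b c s := by
          simp only [hA, Finset.sum_mul]
      _ = ∑ x, ∑ y, ∑ z, A x y z *
          ∑ a, ∑ b, ∑ c, h x a * h y b * h z c * eps a b c s := by
          rw [sum_three_comm]
          refine Finset.sum_congr rfl fun x _ => Finset.sum_congr rfl fun y _ =>
            Finset.sum_congr rfl fun z _ => ?_
          simp only [Finset.mul_sum]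
          refine Finset.sum_congr rfl fun a _ => Finset.sum_congr rfl fun b _ =>
            Finset.sum_congr rfl fun c _ => ?_
          ring
      _ = _ := by
          simp only [h1, Finset.mul_sum]
          conv_rhs => rw [Finset.sum_comm]
          refine Finset.sum_congr rfl fun x _ => ?_
          conv_rhs => rw [Finset.sum_comm]
          refine Finset.sum_congr rfl fun y _ => ?_
          conv_rhs => rw [Finset.sum_comm]
          refine Finset.sum_congr rfl fun z _ => Finset.sum_congr rfl fun w _ => ?_
          ring
  have hinv : h * h⁻¹ = 1 := Matrix.mul_nonsing_inv _ hh.isUnit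
  have hgh : ∀ r, ∑ s, (h.transpose * g * h) d s * h⁻¹ s r = ∑ t, h t d * g t r := by
    intro r
    rw [← Matrix.mul_apply, Matrix.mul_assoc, hinv, Matrix.mul_one, Matrix.mul_apply]
    rfl
  rw [dualCoef_eq hneg, hsq, rsign_eq hh]
  simp only [dualCoef_eq hg, hinner]
  let B : Fin 4 → ℝ := fun r => ∑ x, ∑ y, ∑ z, A x y z * eps x y z r
  have h2 : ∑ s, (h.transpose * g * h) d s * (1 / 6 * (h.det * ∑ r, h⁻¹ s r * B r)) =
      h.det * ∑ r, (∑ t, h t d * g t r) * (1 / 6 * B r) := by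
    simp only [← hgh, Finset.mul_sum, Finset.sum_mul]
    conv_rhs => rw [Finset.sum_comm]
    refine Finset.sum_congr rfl fun x _ => Finset.sum_congr rfl fun y _ => ?_
    ring
  have hB' : ∀ s, ∑ x, ∑ y, ∑ z, A x y z * eps x y z s = B s := fun _ => rfl
  simp only [hB']
  rw [h2, mul_inv]
  simp only [Finset.mul_sum, Finset.sum_mul]
  rw [Finset.sum_comm]
  refine Finset.sum_congr rfl fun x _ => Finset.sum_congr rfl fun y _ => ?_
  ring

/-- After relabelling, each of the six terms of the determinant equals the diagonal one, the sign of
the permutation being absorbed by A. -/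
theorem sum_mul_det_of_antisymm {A : Fin 4 → Fin 4 → Fin 4 → ℝ}
    (h1 : ∀ a b c, A b a c = -A a b c) (h2 : ∀ a b c, A a c b = -A a b c) (u v w : Fin 4 → ℝ) :
    ∑ a, ∑ b, ∑ c, A a b c * (u a * (v b * w c - w b * v c) - v a * (u b * w c - w b * u c)
      + w a * (u b * v c - v b * u c)) = 6 * ∑ a, ∑ b, ∑ c, A a b c * (u a * v b * w c) := by
  have s1 : ∀ u v w : Fin 4 → ℝ, ∑ a, ∑ b, ∑ c, A a b c * (u a * v b * w c) =
      -∑ a, ∑ b, ∑ c, A a b c * (v a * u b * w c) := by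
    intro u v w
    rw [Finset.sum_comm]
    simp only [← Finset.sum_neg_distrib]
    refine Finset.sum_congr rfl fun x _ => Finset.sum_congr rfl fun y _ =>
      Finset.sum_congr rfl fun z _ => ?_
    rw [h1 x y]; ring
  have s2 : ∀ u v w : Fin 4 → ℝ, ∑ a, ∑ b, ∑ c, A a b c * (u a * v b * w c) =
      -∑ a, ∑ b, ∑ c, A a b c * (u a * w b * v c) := by
    intro u v w
    simp only [← Finset.sum_neg_distrib]
    refine Finset.sum_congr rfl fun x _ => ?_
    rw [Finset.sum_comm]
    refine Finset.sum_congr rfl fun y _ => Finset.sum_congr rfl fun z _ => ?_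
    rw [h2 x y]; ring
  have e : ∑ a, ∑ b, ∑ c, A a b c * (u a * (v b * w c - w b * v c) - v a * (u b * w c - w b * u c)
      + w a * (u b * v c - v b * u c)) =
      ∑ a, ∑ b, ∑ c, A a b c * (u a * v b * w c) - ∑ a, ∑ b, ∑ c, A a b c * (u a * w b * v c)
      - ∑ a, ∑ b, ∑ c, A a b c * (v a * u b * w c) + ∑ a, ∑ b, ∑ c, A a b c * (v a * w b * u c)
      + ∑ a, ∑ b, ∑ c, A a b c * (w a * u b * v c)
      - ∑ a, ∑ b, ∑ c, A a b c * (w a * v b * u c) := by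
    simp only [← Finset.sum_add_distrib, ← Finset.sum_sub_distrib]
    refine Finset.sum_congr rfl fun x _ => Finset.sum_congr rfl fun y _ =>
      Finset.sum_congr rfl fun z _ => ?_
    ring
  rw [e, s2 u w v, s1 v u w, s2 v w u, s1 v u w, s1 w u v, s2 u w v, s1 w v u, s2 v w u, s1 v u w]
  ring

/-- One factor is kept in its defining form and the other rewritten by `etaUp_eq`, so that the
square roots cancel and one contraction of two ε's remains. The sign of `eps_cycle` compensates the
Lorentzian sign. -/
theorem sum_etaUp_mul_etaUp {g : Matrix (Fin 4) (Fin 4) ℝ} (hg : g.det < 0)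
    (hs : g.transpose = g) (a b c k l j : Fin 4) : ∑ i, etaUp g a b c i * etaUp g i k l j =
      g⁻¹ a k * (g⁻¹ b l * kron j c - kron j b * g⁻¹ c l)
        - g⁻¹ a l * (g⁻¹ b k * kron j c - kron j b * g⁻¹ c k)
        + kron j a * (g⁻¹ b k * g⁻¹ c l - g⁻¹ b l * g⁻¹ c k) := by
  have hr := sqrt_neg_det_ne hg
  have hinv : ∀ x, ∑ s, g j s * g⁻¹ x s = kron j x := fun x => by
    have h := congrFun (congrFun (Matrix.mul_nonsing_inv g hg.ne.isUnit) j) x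
    rw [Matrix.mul_apply, Matrix.one_apply] at h
    rw [kron, ← h]
    refine Finset.sum_congr rfl fun s _ => ?_
    have := congrFun (congrFun (Matrix.transpose_nonsing_inv g) s) x
    rw [hs, Matrix.transpose_apply] at this
    rw [this]
  have h1 : ∀ i, etaUp g a b c i * etaUp g i k l j = ∑ a', ∑ b', ∑ c', ∑ s,
      g⁻¹ a a' * g⁻¹ b b' * g⁻¹ c c' * g j s * (eps i a' b' c' * eps i k l s) := by
    intro i
    rw [etaUp_eq hg i k l j]
    simp only [etaUp, eta, Finset.sum_mul]
    refine Finset.sum_congr rfl fun x _ => Finset.sum_congr rfl fun y _ =>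
      Finset.sum_congr rfl fun z _ => ?_
    rw [Finset.mul_sum, Finset.mul_sum]
    refine Finset.sum_congr rfl fun s _ => ?_
    rw [eps_cycle x y z i]
    field_simp
  simp only [h1]
  have h2 : ∑ i, ∑ a', ∑ b', ∑ c', ∑ s,
      g⁻¹ a a' * g⁻¹ b b' * g⁻¹ c c' * g j s * (eps i a' b' c' * eps i k l s) =
      ∑ a', ∑ b', ∑ c', ∑ s, g⁻¹ a a' * g⁻¹ b b' * g⁻¹ c c' * g j s *
        ∑ i, eps i a' b' c' * eps i k l s := by
    simp only [Finset.mul_sum]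
    rw [Finset.sum_comm]
    refine Finset.sum_congr rfl fun x _ => ?_
    rw [Finset.sum_comm]
    refine Finset.sum_congr rfl fun y _ => ?_
    rw [Finset.sum_comm]
    refine Finset.sum_congr rfl fun z _ => ?_
    rw [Finset.sum_comm]
  rw [h2]
  simp only [sum_eps_mul_eps]
  have hk : ∀ c k, ∑ z, g⁻¹ c z * kron z k = g⁻¹ c k := fun c k => by
    simp only [kron_comm _ k]; exact sum_mul_kron k _
  have hj : ∀ c, ∑ z, g⁻¹ c z * g j z = kron j c := fun c => by
    rw [← hinv]; exact Finset.sum_congr rfl fun z _ => mul_comm _ _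
  have h3 : ∀ x y z, ∑ s, g⁻¹ a x * g⁻¹ b y * g⁻¹ c z * g j s *
      (kron x k * (kron y l * kron z s - kron y s * kron z l)
        - kron x l * (kron y k * kron z s - kron y s * kron z k)
        + kron x s * (kron y k * kron z l - kron y l * kron z k)) =
      (g⁻¹ a x * kron x k) * ((g⁻¹ b y * kron y l) * (g⁻¹ c z * g j z))
      - (g⁻¹ a x * kron x k) * ((g⁻¹ b y * g j y) * (g⁻¹ c z * kron z l))
      - (g⁻¹ a x * kron x l) * ((g⁻¹ b y * kron y k) * (g⁻¹ c z * g j z))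
      + (g⁻¹ a x * kron x l) * ((g⁻¹ b y * g j y) * (g⁻¹ c z * kron z k))
      + (g⁻¹ a x * g j x) * ((g⁻¹ b y * kron y k) * (g⁻¹ c z * kron z l))
      - (g⁻¹ a x * g j x) * ((g⁻¹ b y * kron y l) * (g⁻¹ c z * kron z k)) := by
    intro x y z
    have e : ∀ z, ∑ s, g j s * kron z s = g j z := fun z => sum_mul_kron z (g j)
    rw [← e x, ← e y, ← e z]
    simp only [Finset.mul_sum, Finset.sum_mul, ← Finset.sum_add_distrib,
      ← Finset.sum_sub_distrib]
    refine Finset.sum_congr rfl fun s _ => ?_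
    ring
  simp only [h3, Finset.sum_add_distrib, Finset.sum_sub_distrib, ← Finset.mul_sum,
    ← Finset.sum_mul, hk, hj]
  ring

/-- `*(*α ∧ β ∧ γ)_j = α(β♯, γ♯, e_j)`. -/
theorem dualCoef_dualCoef_wedge {g : Matrix (Fin 4) (Fin 4) ℝ} (hg : g.det < 0)
    (hs : g.transpose = g) {A : Fin 4 → Fin 4 → Fin 4 → ℝ} (h1 : ∀ a b c, A b a c = -A a b c)
    (h2 : ∀ a b c, A a c b = -A a b c) (β γ : Fin 4 → ℝ) (j : Fin 4) :
    dualCoef g (fun i k l => dualCoef g A i * (β k * γ l - β l * γ k)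
      - dualCoef g A k * (β i * γ l - β l * γ i) + dualCoef g A l * (β i * γ k - β k * γ i)) j =
    ∑ a, ∑ b, A a b j * ((∑ k, g⁻¹ a k * β k) * (∑ l, g⁻¹ b l * γ l)) := by
  have a1 : ∀ i k l, etaUp g k i l j = -etaUp g i k l j := fun i k l => by
    simp only [etaUp_eq hg, eps_swap_fst i k l, mul_neg, Finset.sum_neg_distrib]
  have a2 : ∀ i k l, etaUp g i l k j = -etaUp g i k l j := fun i k l => by
    simp only [etaUp_eq hg, eps_swap_snd i k l, mul_neg, Finset.sum_neg_distrib]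
  -- The components of *α ∧ β ∧ γ are determinants. Against the alternating η they collapse to six
  -- times one product, which cancels the factor 1/6 of the outer dual.
  have e1 : dualCoef g (fun i k l => dualCoef g A i * (β k * γ l - β l * γ k)
      - dualCoef g A k * (β i * γ l - β l * γ i) + dualCoef g A l * (β i * γ k - β k * γ i)) j =
      ∑ i, ∑ k, ∑ l, etaUp g i k l j * (dualCoef g A i * β k * γ l) := by
    have h := sum_mul_det_of_antisymm (A := fun i k l => etaUp g i k l j) a1 a2
      (dualCoef g A) β γ
    rw [dualCoef, ← mul_right_inj' (by norm_num : (6 : ℝ) ≠ 0), ← h,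
      ← mul_assoc]
    norm_num
    refine Finset.sum_congr rfl fun x _ => Finset.sum_congr rfl fun y _ =>
      Finset.sum_congr rfl fun z _ => ?_
    ring
  have e2 : ∀ k l, ∑ i, etaUp g i k l j * dualCoef g A i = (1 / 6) * ∑ a, ∑ b, ∑ c, A a b c *
      ∑ i, etaUp g a b c i * etaUp g i k l j := by
    intro k l
    simp only [dualCoef, Finset.mul_sum]
    rw [Finset.sum_comm]
    refine Finset.sum_congr rfl fun x _ => ?_
    rw [Finset.sum_comm]
    refine Finset.sum_congr rfl fun y _ => ?_
    rw [Finset.sum_comm]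
    refine Finset.sum_congr rfl fun z _ => Finset.sum_congr rfl fun w _ => ?_
    ring
  -- The contraction of two η's is again a determinant; against the alternating A it collapses in
  -- the same way and cancels the 1/6 of the inner dual.
  have e3 : ∀ k l, ∑ i, etaUp g i k l j * dualCoef g A i =
      ∑ a, ∑ b, A a b j * (g⁻¹ a k * g⁻¹ b l) := by
    intro k l
    have h := sum_mul_det_of_antisymm h1 h2 (fun a => g⁻¹ a k) (fun b => g⁻¹ b l)
      (fun c => kron j c)
    have h' : ∀ a b, ∑ c, A a b c * (g⁻¹ a k * g⁻¹ b l * kron j c) =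
        A a b j * (g⁻¹ a k * g⁻¹ b l) := fun a b => by
      rw [← sum_mul_kron j fun c => A a b c * (g⁻¹ a k * g⁻¹ b l)]
      exact Finset.sum_congr rfl fun c _ => by ring
    simp only [h'] at h
    rw [e2]
    simp only [sum_etaUp_mul_etaUp hg hs]
    rw [h]
    ring
  rw [e1]
  have e4 : ∑ i, ∑ k, ∑ l, etaUp g i k l j * (dualCoef g A i * β k * γ l) =
      ∑ k, ∑ l, β k * γ l * ∑ i, etaUp g i k l j * dualCoef g A i := by
    rw [Finset.sum_comm]
    refine Finset.sum_congr rfl fun x _ => ?_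
    rw [Finset.sum_comm]
    refine Finset.sum_congr rfl fun y _ => ?_
    rw [Finset.mul_sum]
    refine Finset.sum_congr rfl fun z _ => ?_
    ring
  rw [e4]
  simp only [e3, Finset.mul_sum, Finset.sum_mul]
  have sw : ∀ F : Fin 4 → Fin 4 → Fin 4 → Fin 4 → ℝ,
      ∑ k, ∑ l, ∑ a, ∑ b, F k l a b = ∑ a, ∑ b, ∑ l, ∑ k, F k l a b := by
    intro F
    have h := Finset.sum_comm (s := Finset.univ) (t := Finset.univ)
      (f := fun p q : Fin 4 × Fin 4 => F p.1 p.2 q.1 q.2)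
    simp only [Fintype.sum_prod_type] at h
    rw [h]
    exact Finset.sum_congr rfl fun a _ => Finset.sum_congr rfl fun b _ => Finset.sum_comm
  rw [sw]
  refine Finset.sum_congr rfl fun x _ => Finset.sum_congr rfl fun y _ =>
    Finset.sum_congr rfl fun z _ => Finset.sum_congr rfl fun w _ => ?_
  ring

/-- The Hodge dual is injective on `3`-forms. -/
theorem eq_zero_of_dualCoef_eq_zero {g : Matrix (Fin 4) (Fin 4) ℝ} (hg : g.det < 0)
    (hs : g.transpose = g) {A : Fin 4 → Fin 4 → Fin 4 → ℝ} (h1 : ∀ a b c, A b a c = -A a b c)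
    (h2 : ∀ a b c, A a c b = -A a b c) (h : ∀ d, dualCoef g A d = 0) (a b c : Fin 4) :
    A a b c = 0 := by
  have hinv : ∀ x y, ∑ k, g⁻¹ x k * g k y = kron y x := fun x y => by
    rw [← Matrix.mul_apply, Matrix.nonsing_inv_mul g hg.ne.isUnit, Matrix.one_apply, kron]
    simp only [eq_comm]
  -- The covectors are columns of g, so raising their index gives basis vectors and the right side
  -- becomes a single component of A.
  have key := dualCoef_dualCoef_wedge hg hs h1 h2 (fun k => g k a) (fun l => g l b) c
  simp only [h, zero_mul, sub_zero, add_zero, hinv] at key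
  have h0 : dualCoef g (fun _ _ _ => 0) c = 0 := by simp [dualCoef]
  rw [h0] at key
  rw [key]
  have e : ∀ x, ∑ y, A x y c * (kron a x * kron b y) = A x b c * kron a x := fun x => by
    rw [← sum_mul_kron b fun y => A x y c * kron a x]
    exact Finset.sum_congr rfl fun c _ => by ring
  simp only [e]
  exact (sum_mul_kron a fun x => A x b c).symm

end Dual

/-! ### Symmetry of the Ricci and Schouten tensors -/

section RicciBase

variable (G : E4 → Matrix (Fin 4) (Fin 4) ℝ)

/-- The Ricci tensor in the coordinates of the base. -/
def baseRicci (y : E4) : Matrix (Fin 4) (Fin 4) ℝ :=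
  Matrix.of fun i j => ∑ k, baseCurv G y (stdVec i) (stdVec k) k j

/-- The matrix of the Ricci tensor in a frame. -/
def ricciMat (p : F20) : Matrix (Fin 4) (Fin 4) ℝ := Matrix.of fun a b => ricci G a b p

/-- The matrix of the Schouten tensor in a frame. -/
def schoutenMat (p : F20) : Matrix (Fin 4) (Fin 4) ℝ := Matrix.of fun a b => schouten G a b p

theorem vec_eq_sum_stdVec (v : E4) : v = ∑ k, v k • stdVec k := by
  ext j
  simp [stdVec, Finset.sum_apply, Pi.single_apply]

theorem baseCurv_sum_left (y : E4) {ι : Type*} (s : Finset ι) (c : ι → ℝ) (v : ι → E4) (w : E4) :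
    baseCurv G y (∑ i ∈ s, c i • v i) w = ∑ i ∈ s, c i • baseCurv G y (v i) w := by
  classical
  induction s using Finset.induction_on with
  | empty =>
    have := baseCurv_smul_left (G := G) y 0 0 w
    simpa using this
  | insert i s hi ih =>
    rw [Finset.sum_insert hi, Finset.sum_insert hi, baseCurv_add_left, baseCurv_smul_left, ih]

theorem baseCurv_sum_right (y : E4) {ι : Type*} (s : Finset ι) (c : ι → ℝ) (v : ι → E4) (w : E4) :
    baseCurv G y w (∑ i ∈ s, c i • v i) = ∑ i ∈ s, c i • baseCurv G y w (v i) := by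
  rw [baseCurv_swap, baseCurv_sum_left, ← Finset.sum_neg_distrib]
  refine Finset.sum_congr rfl fun i _ => ?_
  rw [← smul_neg, ← baseCurv_swap]

theorem baseCurv_eq_sum (y v w : E4) : baseCurv G y v w =
    ∑ i, ∑ k, (v i * w k) • baseCurv G y (stdVec i) (stdVec k) := by
  conv_lhs => rw [vec_eq_sum_stdVec v, baseCurv_sum_left]
  refine Finset.sum_congr rfl fun i _ => ?_
  conv_lhs => rw [vec_eq_sum_stdVec w, baseCurv_sum_right, Finset.smul_sum]
  simp only [smul_smul]

variable {G} {D : Set E4}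

/-- Skewness of GB means B = -G⁻¹BᵀG, so the trace of B is its own negative. -/
theorem IsLorentzOn.trace_baseCurv (hG : IsLorentzOn G D) {y : E4} (hy : y ∈ D) (v w : E4) :
    (baseCurv G y v w).trace = 0 := by
  have hu := (hG.det_ne hy).isUnit
  have h := hG.baseCurv_skew hy v w
  have h1 : baseCurv G y v w = -((G y)⁻¹ * ((baseCurv G y v w).transpose * G y)) := by
    rw [← neg_eq_of_add_eq_zero_right h, Matrix.mul_neg, neg_neg, ← Matrix.mul_assoc,
      Matrix.nonsing_inv_mul _ hu, Matrix.one_mul]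
  have h2 := congrArg Matrix.trace h1
  rw [Matrix.trace_neg, Matrix.trace_mul_comm, Matrix.mul_assoc, Matrix.mul_nonsing_inv _ hu,
    Matrix.mul_one, Matrix.trace_transpose] at h2
  linarith

/-- Trace of the first Bianchi identity: one of the three terms is the trace of a curvature
endomorphism and vanishes, the other two are Ricci components with exchanged indices and opposite
signs. -/
theorem IsLorentzOn.baseRicci_transpose (hG : IsLorentzOn G D) {y : E4} (hy : y ∈ D) :
    (baseRicci G y).transpose = baseRicci G y := by
  have hmv : ∀ (M : Matrix (Fin 4) (Fin 4) ℝ) (j k : Fin 4), M.mulVec (stdVec j) k = M k j := by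
    intro M j k
    simp [Matrix.mulVec, dotProduct, stdVec]
  ext i j
  have h : ∀ k, baseCurv G y (stdVec j) (stdVec k) k i + baseCurv G y (stdVec k) (stdVec i) k j
      + baseCurv G y (stdVec i) (stdVec j) k k = 0 := fun k => by
    have := congrFun (hG.baseCurv_bianchi hy (stdVec j) (stdVec k) (stdVec i)) k
    simpa only [Pi.add_apply, hmv, Pi.zero_apply] using this
  have hs := Finset.sum_congr rfl fun k (_ : k ∈ (Finset.univ : Finset (Fin 4))) => h k
  have ht : ∑ k, baseCurv G y (stdVec i) (stdVec j) k k = 0 :=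
    hG.trace_baseCurv hy (stdVec i) (stdVec j)
  rw [Finset.sum_add_distrib, Finset.sum_add_distrib, ht, Finset.sum_const_zero, add_zero] at hs
  have hn : ∑ k, baseCurv G y (stdVec k) (stdVec i) k j =
      -∑ k, baseCurv G y (stdVec i) (stdVec k) k j := by
    rw [← Finset.sum_neg_distrib]
    refine Finset.sum_congr rfl fun k _ => ?_
    rw [baseCurv_swap]; rfl
  rw [hn] at hs
  simp only [Matrix.transpose_apply, baseRicci, Matrix.of_apply]
  linarith

/-- Since AA⁻¹ = 1, contraction over the frame and its dual coframe agrees with contraction over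
coordinates. -/
theorem IsLorentzOn.ricciMat_eq (hG : IsLorentzOn G D) {p : F20} (hp : p ∈ framesOver D) :
    ricciMat G p = (frameMat p).transpose * baseRicci G p.1 * frameMat p := by
  ext c a
  have hinv : ∀ k m, ∑ d, frameMat p k d * (frameMat p)⁻¹ d m = kron k m := fun k m => by
    rw [← Matrix.mul_apply, frameMat_mul_inv hp, Matrix.one_apply, kron]
  have h1 : ∀ d, riem G c d a d p = ∑ i, frameMat p i c * ∑ k, ∑ m,
      (frameMat p k d * (frameMat p)⁻¹ d m) *
        ∑ j, baseCurv G p.1 (stdVec i) (stdVec k) m j * frameMat p j a := by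
    intro d
    have e : riem G c d a d p = curvMat G p (horiz G p c) (horiz G p d) d a := rfl
    rw [e, hG.curvMat_eq hp, baseCurv_eq_sum, Matrix.mul_assoc, Matrix.sum_mul, Matrix.mul_sum,
      Matrix.sum_apply]
    refine Finset.sum_congr rfl fun i _ => ?_
    rw [Matrix.sum_mul, Matrix.mul_sum, Matrix.sum_apply, Finset.mul_sum]
    refine Finset.sum_congr rfl fun k _ => ?_
    rw [Matrix.smul_mul, Matrix.mul_smul, Matrix.smul_apply, Matrix.mul_apply, smul_eq_mul,
      Finset.mul_sum, Finset.mul_sum]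
    refine Finset.sum_congr rfl fun m _ => ?_
    rw [Matrix.mul_apply]
    change (frameMat p i c * frameMat p k d) * _ = _
    ring
  rw [ricciMat, Matrix.of_apply, ricci]
  simp only [h1]
  rw [Finset.sum_comm, Matrix.mul_assoc, Matrix.mul_apply]
  refine Finset.sum_congr rfl fun i _ => ?_
  rw [← Finset.mul_sum, Finset.sum_comm, Matrix.transpose_apply]
  congr 1
  have h2 : ∀ k, ∑ d, ∑ m, (frameMat p k d * (frameMat p)⁻¹ d m) *
      ∑ j, baseCurv G p.1 (stdVec i) (stdVec k) m j * frameMat p j a =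
      ∑ j, baseCurv G p.1 (stdVec i) (stdVec k) k j * frameMat p j a := fun k => by
    rw [Finset.sum_comm]
    simp only [← Finset.sum_mul, hinv]
    exact sum_kron_mul k fun m => ∑ j, baseCurv G p.1 (stdVec i) (stdVec k) m j * frameMat p j a
  simp only [h2]
  rw [Finset.sum_comm, Matrix.mul_apply]
  refine Finset.sum_congr rfl fun j _ => ?_
  rw [← Finset.sum_mul]
  rfl

theorem scalarCurv_eq_trace (p : F20) :
    scalarCurv G p = (gInv G p * (ricciMat G p).transpose).trace := by
  rw [scalarCurv, Matrix.trace]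
  refine Finset.sum_congr rfl fun a _ => ?_
  rw [Matrix.diag_apply, Matrix.mul_apply]
  rfl

theorem schoutenMat_eq (p : F20) :
    schoutenMat G p = (1 / 2 : ℝ) • (ricciMat G p - (1 / 6 * scalarCurv G p) • gFrame G p) := by
  ext a b
  simp only [schoutenMat, schouten, Matrix.of_apply, Matrix.smul_apply, Matrix.sub_apply,
    ricciMat, smul_eq_mul]
  ring

theorem IsLorentzOn.ricciMat_transpose (hG : IsLorentzOn G D) {p : F20} (hp : p ∈ framesOver D) :
    (ricciMat G p).transpose = ricciMat G p := by
  rw [hG.ricciMat_eq hp, Matrix.transpose_mul, Matrix.transpose_mul,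
    hG.baseRicci_transpose hp.1, Matrix.transpose_transpose, Matrix.mul_assoc]

theorem IsLorentzOn.schoutenMat_transpose (hG : IsLorentzOn G D) {p : F20}
    (hp : p ∈ framesOver D) : (schoutenMat G p).transpose = schoutenMat G p := by
  rw [schoutenMat_eq, Matrix.transpose_smul, Matrix.transpose_sub, Matrix.transpose_smul,
    hG.ricciMat_transpose hp, hG.gFrame_transpose hp]

end RicciBase

/-! ### Behaviour of the tensors under the right action -/

section RightAction

variable {G : E4 → Matrix (Fin 4) (Fin 4) ℝ} {D : Set E4} {h : Matrix (Fin 4) (Fin 4) ℝ}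

theorem rightAct_fst (p : F20) : (rightAct h p).1 = p.1 := rfl

theorem frameMat_rightAct (p : F20) : frameMat (rightAct h p) = frameMat p * h := by
  ext i a
  rw [Matrix.mul_apply]
  rfl

theorem of_rightAct_snd (p : F20) :
    (Matrix.of (rightAct h p).2 : Matrix (Fin 4) (Fin 4) ℝ) = Matrix.of p.2 * h :=
  frameMat_rightAct p

theorem rightAct_mem {p : F20} (hp : p ∈ framesOver D) (hh : h.det ≠ 0) :
    rightAct h p ∈ framesOver D := by
  refine ⟨hp.1, ?_⟩
  rw [frameMat_rightAct, Matrix.det_mul]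
  exact mul_ne_zero hp.2 hh

theorem gFrame_rightAct (p : F20) :
    gFrame G (rightAct h p) = h.transpose * gFrame G p * h := by
  rw [gFrame_eq, gFrame_eq, frameMat_rightAct, Matrix.transpose_mul, rightAct_fst]
  simp only [Matrix.mul_assoc]

theorem gInv_rightAct (p : F20) :
    gInv G (rightAct h p) = h⁻¹ * gInv G p * h⁻¹.transpose := by
  rw [gInv, gInv, gFrame_rightAct, Matrix.mul_inv_rev, Matrix.mul_inv_rev, Matrix.mul_assoc,
    ← Matrix.transpose_nonsing_inv]

theorem theta_rightAct (p v : F20) (a : Fin 4) :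
    theta a (rightAct h p) ![rightAct h v] = ∑ b, h⁻¹ a b * theta b p ![v] := by
  simp only [theta_apply, frameMat_rightAct, Matrix.mul_inv_rev, Matrix.mul_apply, rightAct_fst,
    Finset.mul_sum, Finset.sum_mul]
  rw [Finset.sum_comm]
  refine Finset.sum_congr rfl fun b _ => Finset.sum_congr rfl fun i _ => ?_
  ring

theorem connMat_rightAct (p v : F20) :
    connMat G (rightAct h p) (rightAct h v) = h⁻¹ * connMat G p v * h := by
  rw [connMat_eq, connMat_eq, frameMat_rightAct, Matrix.mul_inv_rev, of_rightAct_snd,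
    rightAct_fst, rightAct_fst, ← Matrix.mul_assoc (gam G p.1 v.1), ← Matrix.add_mul]
  simp only [Matrix.mul_assoc]

theorem IsLorentzOn.curvMat_rightAct (hG : IsLorentzOn G D) {p : F20} (hp : p ∈ framesOver D)
    (hh : h.det ≠ 0) (v w : F20) :
    curvMat G (rightAct h p) (rightAct h v) (rightAct h w) = h⁻¹ * curvMat G p v w * h := by
  rw [hG.curvMat_eq hp, hG.curvMat_eq (rightAct_mem hp hh), frameMat_rightAct,
    Matrix.mul_inv_rev]
  simp only [rightAct_fst, Matrix.mul_assoc]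

theorem IsLorentzOn.ricciMat_rightAct (hG : IsLorentzOn G D) {p : F20} (hp : p ∈ framesOver D)
    (hh : h.det ≠ 0) : ricciMat G (rightAct h p) = h.transpose * ricciMat G p * h := by
  rw [hG.ricciMat_eq hp, hG.ricciMat_eq (rightAct_mem hp hh), frameMat_rightAct,
    Matrix.transpose_mul]
  simp only [rightAct_fst, Matrix.mul_assoc]

theorem IsLorentzOn.scalarCurv_rightAct (hG : IsLorentzOn G D) {p : F20} (hp : p ∈ framesOver D)
    (hh : h.det ≠ 0) : scalarCurv G (rightAct h p) = scalarCurv G p := by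
  have h1 : h * h⁻¹ = 1 := Matrix.mul_nonsing_inv _ hh.isUnit
  have h2 : h⁻¹.transpose * h.transpose = 1 := by
    rw [← Matrix.transpose_mul, h1, Matrix.transpose_one]
  rw [scalarCurv_eq_trace, scalarCurv_eq_trace, hG.ricciMat_rightAct hp hh, gInv_rightAct]
  have e : h⁻¹ * gInv G p * h⁻¹.transpose * (h.transpose * ricciMat G p * h).transpose =
      h⁻¹ * (gInv G p * (ricciMat G p).transpose * h) := by
    simp only [Matrix.transpose_mul, Matrix.transpose_transpose]
    rw [Matrix.mul_assoc (h⁻¹ * gInv G p), ← Matrix.mul_assoc h⁻¹.transpose, h2, Matrix.one_mul]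
    simp only [Matrix.mul_assoc]
  rw [e, Matrix.trace_mul_comm, Matrix.mul_assoc, h1, Matrix.mul_one]

theorem IsLorentzOn.schoutenMat_rightAct (hG : IsLorentzOn G D) {p : F20}
    (hp : p ∈ framesOver D) (hh : h.det ≠ 0) :
    schoutenMat G (rightAct h p) = h.transpose * schoutenMat G p * h := by
  rw [schoutenMat_eq, schoutenMat_eq, hG.ricciMat_rightAct hp hh, hG.scalarCurv_rightAct hp hh,
    gFrame_rightAct]
  simp only [Matrix.mul_smul, Matrix.smul_mul, Matrix.mul_sub, Matrix.sub_mul]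

/-- The vector of values of the canonical forms. -/
def thetaVec (p v : F20) : Fin 4 → ℝ := fun a => theta a p ![v]

theorem thetaVec_rightAct (p v : F20) :
    thetaVec (rightAct h p) (rightAct h v) = h⁻¹.mulVec (thetaVec p v) :=
  funext fun a => theta_rightAct p v a

theorem thetaLow_apply (a : Fin 4) (p v : F20) :
    thetaLow G a p ![v] = (gFrame G p).mulVec (thetaVec p v) a := by
  rw [thetaLow, ContinuousAlternatingMap.sum_apply]
  rfl

theorem schoutenForm_apply (a : Fin 4) (p v : F20) :
    schoutenForm G a p ![v] = (schoutenMat G p).transpose.mulVec (thetaVec p v) a := by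
  rw [schoutenForm, ContinuousAlternatingMap.sum_apply]
  rfl

theorem schoutenFormUp_apply (a : Fin 4) (p v : F20) : schoutenFormUp G a p ![v] =
    (gInv G p).mulVec ((schoutenMat G p).transpose.mulVec (thetaVec p v)) a := by
  rw [schoutenFormUp, ContinuousAlternatingMap.sum_apply, Matrix.mulVec, dotProduct]
  simp only [← schoutenForm_apply]
  rfl

/-- Lowering an index is compatible with the change of frame. Applied with M the metric or the
Schouten matrix, it gives the laws for θ_a, S_a and S^a. -/
theorem mulVec_congr_rightAct (hh : h.det ≠ 0) (M : Matrix (Fin 4) (Fin 4) ℝ) (x : Fin 4 → ℝ) :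
    (h.transpose * M * h).mulVec (h⁻¹.mulVec x) = h.transpose.mulVec (M.mulVec x) := by
  have h1 : h * h⁻¹ = 1 := Matrix.mul_nonsing_inv _ hh.isUnit
  rw [Matrix.mulVec_mulVec, Matrix.mul_assoc, h1, Matrix.mul_one, Matrix.mulVec_mulVec]

theorem thetaLow_rightAct (hh : h.det ≠ 0) (p v : F20) (a : Fin 4) :
    thetaLow G a (rightAct h p) ![rightAct h v] = ∑ b, h b a * thetaLow G b p ![v] := by
  simp only [thetaLow_apply]
  rw [gFrame_rightAct, thetaVec_rightAct, mulVec_congr_rightAct hh]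
  rfl

theorem IsLorentzOn.schoutenForm_rightAct (hG : IsLorentzOn G D) {p : F20}
    (hp : p ∈ framesOver D) (hh : h.det ≠ 0) (v : F20) (a : Fin 4) :
    schoutenForm G a (rightAct h p) ![rightAct h v] = ∑ b, h b a * schoutenForm G b p ![v] := by
  simp only [schoutenForm_apply]
  rw [hG.schoutenMat_transpose (rightAct_mem hp hh), hG.schoutenMat_transpose hp,
    hG.schoutenMat_rightAct hp hh, thetaVec_rightAct, mulVec_congr_rightAct hh]
  rfl

theorem IsLorentzOn.schoutenFormUp_rightAct (hG : IsLorentzOn G D) {p : F20}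
    (hp : p ∈ framesOver D) (hh : h.det ≠ 0) (v : F20) (a : Fin 4) :
    schoutenFormUp G a (rightAct h p) ![rightAct h v] =
      ∑ b, h⁻¹ a b * schoutenFormUp G b p ![v] := by
  have h1 : h * h⁻¹ = 1 := Matrix.mul_nonsing_inv _ hh.isUnit
  have h2 : h⁻¹.transpose * h.transpose = 1 := by
    rw [← Matrix.transpose_mul, h1, Matrix.transpose_one]
  simp only [schoutenFormUp_apply]
  rw [hG.schoutenMat_transpose (rightAct_mem hp hh), hG.schoutenMat_transpose hp,
    hG.schoutenMat_rightAct hp hh, thetaVec_rightAct, mulVec_congr_rightAct hh, gInv_rightAct,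
    Matrix.mulVec_mulVec, Matrix.mul_assoc, h2, Matrix.mul_one, ← Matrix.mulVec_mulVec]
  rfl

variable (G) in
/-- The matrix of values of the Weyl forms `𝒲_a^b` at a pair of vectors. -/
def weylMat (p v w : F20) : Matrix (Fin 4) (Fin 4) ℝ := Matrix.of fun a b => weyl G a b p ![v, w]

/-- The Weyl matrix is a transposed curvature matrix plus outer products of a quantity with a lower
and one with an upper index; each summand obeys the same law. -/
theorem IsLorentzOn.weylMat_rightAct (hG : IsLorentzOn G D) {p : F20}
    (hp : p ∈ framesOver D) (hh : h.det ≠ 0) (v w : F20) :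
    weylMat G (rightAct h p) (rightAct h v) (rightAct h w) =
      h.transpose * weylMat G p v w * h⁻¹.transpose := by
  have e : ∀ p v w, weylMat G p v w = (curvMat G p v w).transpose
      + (Matrix.vecMulVec (fun a => schoutenForm G a p ![w]) (fun b => theta b p ![v])
        - Matrix.vecMulVec (fun a => schoutenForm G a p ![v]) (fun b => theta b p ![w]))
      - (Matrix.vecMulVec (fun a => thetaLow G a p ![v]) (fun b => schoutenFormUp G b p ![w])
        - Matrix.vecMulVec (fun a => thetaLow G a p ![w])
          (fun b => schoutenFormUp G b p ![v])) := by
    intro p v w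
    ext a b
    rw [weylMat, Matrix.of_apply, weyl_apply]
    simp only [Matrix.sub_apply, Matrix.add_apply, Matrix.vecMulVec_apply,
      Matrix.transpose_apply, curvMat, Matrix.of_apply]
    ring
  have hv : ∀ x y : Fin 4 → ℝ, Matrix.vecMulVec (fun a => ∑ b, h b a * x b)
      (fun a => ∑ b, h⁻¹ a b * y b) = h.transpose * Matrix.vecMulVec x y * h⁻¹.transpose := by
    intro x y
    ext a b
    simp only [Matrix.vecMulVec_apply, Matrix.mul_apply, Matrix.transpose_apply, Finset.sum_mul,
      Finset.mul_sum]
    refine Finset.sum_congr rfl fun i _ => Finset.sum_congr rfl fun j _ => ?_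
    ring
  rw [e, e]
  simp only [theta_rightAct, thetaLow_rightAct hh, hG.schoutenForm_rightAct hp hh,
    hG.schoutenFormUp_rightAct hp hh, hv, hG.curvMat_rightAct hp hh, Matrix.transpose_mul,
    Matrix.mul_add, Matrix.add_mul, Matrix.mul_sub, Matrix.sub_mul, Matrix.mul_assoc]

end RightAction

/-! ### The Hodge dual under a change of frame -/

section HodgeAt

variable {V : Type*} [NormedAddCommGroup V] [NormedSpace ℝ V]

/-- The Hodge dual as a linear map. -/
def hodgeThreeLin (g : Matrix (Fin 4) (Fin 4) ℝ) (e : Fin 4 → V) (θ : Fin 4 → Alt V 1) :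
    Alt V 3 →ₗ[ℝ] Alt V 1 where
  toFun := hodgeThree g e θ
  map_add' α β := by
    simp only [hodgeThree, ContinuousAlternatingMap.add_apply, add_mul, Finset.sum_add_distrib,
      mul_add, add_smul]
  map_smul' c α := by
    simp only [hodgeThree, ContinuousAlternatingMap.smul_apply, smul_eq_mul, Finset.smul_sum,
      smul_smul, RingHom.id_apply]
    refine Finset.sum_congr rfl fun d _ => ?_
    congr 1
    simp only [Finset.mul_sum]
    refine Finset.sum_congr rfl fun x _ => Finset.sum_congr rfl fun y _ =>
      Finset.sum_congr rfl fun z _ => ?_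
    ring

theorem hodgeThree_apply (g : Matrix (Fin 4) (Fin 4) ℝ) (e : Fin 4 → V) (θ : Fin 4 → Alt V 1)
    (α : Alt V 3) (v : V) : hodgeThree g e θ α ![v] =
      ∑ d, dualCoef g (fun a b c => α ![e a, e b, e c]) d * θ d ![v] := by
  rw [hodgeThree_eq, ContinuousAlternatingMap.sum_apply]
  rfl

theorem alt_three_sum (α : Alt V 3) (h : Matrix (Fin 4) (Fin 4) ℝ) (e : Fin 4 → V)
    (a b c : Fin 4) : α ![∑ x, h x a • e x, ∑ x, h x b • e x, ∑ x, h x c • e x] =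
      ∑ x, ∑ y, ∑ z, h x a * h y b * h z c * α ![e x, e y, e z] := by
  have e0 : (![∑ x, h x a • e x, ∑ x, h x b • e x, ∑ x, h x c • e x] : Fin 3 → V) =
      fun i => ∑ x, h x (![a, b, c] i) • e x := by
    ext i; fin_cases i <;> rfl
  rw [e0]
  have hs := α.toMultilinearMap.map_sum (fun i x => h x (![a, b, c] i) • e x)
  refine hs.trans ?_
  simp only [MultilinearMap.map_smul_univ, sum_vecCons, sum_vec_zero, Fin.prod_univ_three]
  refine Finset.sum_congr rfl fun x _ => Finset.sum_congr rfl fun y _ =>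
    Finset.sum_congr rfl fun z _ => ?_
  rw [smul_eq_mul]
  congr 1
  have e1 : (fun i => e ((![x, y, z] : Fin 3 → Fin 4) i)) = ![e x, e y, e z] := by
    ext i; fin_cases i <;> rfl
  rw [e1]
  rfl

/-- The Hodge dual of a `3`-form changes by the sign of the determinant of a change of frame. -/
theorem hodgeThree_change {W : Type*} [NormedAddCommGroup W] [NormedSpace ℝ W]
    {g h : Matrix (Fin 4) (Fin 4) ℝ} (hg : g.det < 0) (hh : h.det ≠ 0) {e : Fin 4 → V}
    {θ : Fin 4 → Alt V 1} {e' : Fin 4 → W} {θ' : Fin 4 → Alt W 1} {α : Alt V 3} {α' : Alt W 3}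
    {v : V} {v' : W} (hθ : ∀ a, θ' a ![v'] = ∑ b, h⁻¹ a b * θ b ![v])
    (hα : ∀ a b c, α' ![e' a, e' b, e' c] =
      α ![∑ x, h x a • e x, ∑ x, h x b • e x, ∑ x, h x c • e x]) :
    hodgeThree (h.transpose * g * h) e' θ' α' ![v'] =
      rsign h.det * hodgeThree g e θ α ![v] := by
  have hinv : ∀ t b, ∑ d, h t d * h⁻¹ d b = kron t b := fun t b => by
    rw [← Matrix.mul_apply, Matrix.mul_nonsing_inv _ hh.isUnit, Matrix.one_apply, kron]
  simp only [hodgeThree_apply, hθ]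
  simp only [dualCoef_change hg hh (fun a b c => α ![e a, e b, e c])
    (fun a b c => α' ![e' a, e' b, e' c])
    (fun a b c => (hα a b c).trans (alt_three_sum α h e a b c))]
  -- The factor h on the components cancels against h⁻¹ on the coframe, so only the sign survives.
  have e1 : ∀ F X : Fin 4 → ℝ, ∑ d, (rsign h.det * ∑ t, h t d * F t) * ∑ b, h⁻¹ d b * X b =
      rsign h.det * ∑ t, F t * X t := by
    intro F X
    have e2 : ∀ d, (rsign h.det * ∑ t, h t d * F t) * ∑ b, h⁻¹ d b * X b =
        rsign h.det * ∑ t, ∑ b, (h t d * h⁻¹ d b) * (F t * X b) := fun d => by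
      rw [mul_assoc, Finset.sum_mul_sum]
      congr 1
      refine Finset.sum_congr rfl fun t _ => Finset.sum_congr rfl fun b _ => ?_
      ring
    simp only [e2]
    rw [← Finset.mul_sum, Finset.sum_comm]
    congr 1
    refine Finset.sum_congr rfl fun t _ => ?_
    rw [Finset.sum_comm]
    simp only [← Finset.sum_mul, hinv]
    exact sum_kron_mul t fun b => F t * X b
  exact e1 _ _

end HodgeAt

/-! ### Horizontal fields under the right action -/

section HorizAction

variable {G : E4 → Matrix (Fin 4) (Fin 4) ℝ} {D : Set E4} {h : Matrix (Fin 4) (Fin 4) ℝ}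

theorem gam_sum (y : E4) {ι : Type*} (s : Finset ι) (c : ι → ℝ) (v : ι → E4) :
    gam G y (∑ i ∈ s, c i • v i) = ∑ i ∈ s, c i • gam G y (v i) := by
  ext m j
  simp only [gam, Matrix.of_apply, Matrix.sum_apply, Matrix.smul_apply, smul_eq_mul,
    WithLp.ofLp_sum, Finset.sum_apply, Finset.mul_sum]
  rw [Finset.sum_comm]
  refine Finset.sum_congr rfl fun i _ => Finset.sum_congr rfl fun k _ => ?_
  change _ * (c i * v i k) = _
  ring

theorem of_horiz_snd (p : F20) (a : Fin 4) :
    (Matrix.of (horiz G p a).2 : Matrix (Fin 4) (Fin 4) ℝ) =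
      -(gam G p.1 (horiz G p a).1 * frameMat p) := by
  ext m b
  simp only [horiz, gam, Matrix.of_apply, Matrix.neg_apply, Matrix.mul_apply, Finset.sum_mul]
  rw [Finset.sum_comm]
  rfl

/-- The vertical component of a horizontal vector is a linear function of its base component, and
the base components are the frame vectors themselves, which h recombines. -/
theorem horiz_rightAct (p : F20) (a : Fin 4) :
    horiz G (rightAct h p) a = rightAct h (∑ x, h x a • horiz G p x) := by
  have h1 : (horiz G (rightAct h p) a).1 = ∑ x, h x a • (horiz G p x).1 := by
    ext i
    simp only [horiz, rightAct, LinearMap.coe_mk, AddHom.coe_mk]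
    simp [Finset.sum_apply, mul_comm]
  refine Prod.ext ?_ ?_
  · rw [h1, rightAct_fst, Prod.fst_sum]
    rfl
  · have h2 : (Matrix.of (horiz G (rightAct h p) a).2 : Matrix (Fin 4) (Fin 4) ℝ) =
        Matrix.of (rightAct h (∑ x, h x a • horiz G p x)).2 := by
      rw [of_rightAct_snd, of_horiz_snd, h1, gam_sum, frameMat_rightAct, rightAct_fst,
        ← Matrix.mul_assoc, ← Matrix.neg_mul]
      congr 1
      have h3 : (Matrix.of (∑ x, h x a • horiz G p x).2 : Matrix (Fin 4) (Fin 4) ℝ) =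
          ∑ x, h x a • Matrix.of (horiz G p x).2 := by
        rw [Prod.snd_sum]
        ext i j
        simp [Matrix.sum_apply, Finset.sum_apply]
      rw [h3]
      simp only [of_horiz_snd, Matrix.sum_mul, smul_neg, Finset.sum_neg_distrib, Matrix.smul_mul]
    exact h2

end HorizAction

/-! ### Equivariance of Ω -/

section OmegaAction

variable {G : E4 → Matrix (Fin 4) (Fin 4) ℝ} {D : Set E4} {h : Matrix (Fin 4) (Fin 4) ℝ}

theorem IsLorentzOn.hodge_rightAct (hG : IsLorentzOn G D) {p : F20} (hp : p ∈ framesOver D)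
    (hh : h.det ≠ 0) {α' : Form F20 3} {α : Alt F20 3}
    (hα : ∀ u v w, α' (rightAct h p) ![rightAct h u, rightAct h v, rightAct h w] =
      α ![u, v, w]) (v : F20) :
    hodge G α' (rightAct h p) ![rightAct h v] =
      rsign h.det * hodgeThreeLin (gFrame G p) (horiz G p) (fun d => theta d p) α ![v] := by
  rw [hodge, gFrame_rightAct]
  refine hodgeThree_change (hG.det_gFrame_neg hp) hh (theta_rightAct p v) fun a b c => ?_
  rw [horiz_rightAct, horiz_rightAct, horiz_rightAct]
  exact hα _ _ _

theorem sum_mul_sum_nested {ι κ : Type*} [Fintype ι] [Fintype κ] (c x : ι → ℝ) (r y : κ → ℝ) :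
    (∑ i, c i * x i) * (∑ j, r j * y j) = ∑ j, r j * ∑ i, c i * (x i * y j) := by
  rw [Finset.sum_mul_sum, Finset.sum_comm]
  refine Finset.sum_congr rfl fun j _ => ?_
  rw [Finset.mul_sum]
  refine Finset.sum_congr rfl fun i _ => ?_
  ring

/-- Linearity of the dual carries the transformation coefficients of the two factors outside. The
index types are arbitrary so that pairs of tensor indices can be summed as one. -/
theorem IsLorentzOn.hodge_wedge_rightAct (hG : IsLorentzOn G D) {p : F20}
    (hp : p ∈ framesOver D) (hh : h.det ≠ 0) {ι κ : Type*} [Fintype ι] [Fintype κ]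
    {μ' : Form F20 2} {ν' : Form F20 1} {μ : ι → Form F20 2} {ν : κ → Form F20 1}
    {c : ι → ℝ} {r : κ → ℝ}
    (hμ : ∀ u v, μ' (rightAct h p) ![rightAct h u, rightAct h v] = ∑ i, c i * μ i p ![u, v])
    (hν : ∀ v, ν' (rightAct h p) ![rightAct h v] = ∑ j, r j * ν j p ![v]) (v : F20) :
    hodge G (fun q => wedge (μ' q) (ν' q)) (rightAct h p) ![rightAct h v] =
      rsign h.det * ∑ j, r j * ∑ i, c i * hodge G (fun q => wedge (μ i q) (ν j q)) p ![v] := by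
  have h1 := hG.hodge_rightAct hp hh (α' := fun q => wedge (μ' q) (ν' q))
    (α := ∑ j, r j • ∑ i, c i • wedge (μ i p) (ν j p)) (fun u v w => by
      have e : ∀ u v w, (∑ j, r j • ∑ i, c i • wedge (μ i p) (ν j p) : Alt F20 3) ![u, v, w] =
          ∑ j, r j * ∑ i, c i * (wedge (μ i p) (ν j p) : Alt F20 3) ![u, v, w] := by
        intro u v w
        rw [ContinuousAlternatingMap.sum_apply]
        refine Finset.sum_congr rfl fun j _ => ?_
        rw [ContinuousAlternatingMap.smul_apply, ContinuousAlternatingMap.sum_apply]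
        rfl
      rw [e]
      refine (wedge_two_one _ _ _ _ _).trans ?_
      rw [hμ, hμ, hμ, hν, hν, hν]
      have e2 : ∀ i j, (wedge (μ i p) (ν j p) : Alt F20 3) ![u, v, w] =
        μ i p ![u, v] * ν j p ![w] - μ i p ![u, w] * ν j p ![v] + μ i p ![v, w] * ν j p ![u] :=
          fun i j => wedge_two_one _ _ _ _ _
      simp only [e2, sum_mul_sum_nested, ← Finset.sum_sub_distrib, ← Finset.sum_add_distrib,
        ← mul_sub, ← mul_add]) v
  rw [h1]
  congr 1
  rw [map_sum, ContinuousAlternatingMap.sum_apply]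
  refine Finset.sum_congr rfl fun j _ => ?_
  rw [map_smul, map_sum, ContinuousAlternatingMap.smul_apply, ContinuousAlternatingMap.sum_apply]
  simp only [map_smul]
  rfl

variable (G) in
/-- The values of `*(𝒲^{de} ∧ θ_a)` as a matrix in `d`, `e`. -/
def dualWeylUp (p : F20) (a : Fin 4) (v : F20) : Matrix (Fin 4) (Fin 4) ℝ :=
  Matrix.of fun d e => hodge G (fun q => wedge (weylUp G d e q) (thetaLow G a q)) p ![v]

variable (G) in
/-- The values of `*(𝒲_c^d ∧ θ_a)` as a vector in `d`. -/
def dualWeyl (p : F20) (c a : Fin 4) (v : F20) : Fin 4 → ℝ :=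
  fun d => hodge G (fun q => wedge (weyl G c d q) (thetaLow G a q)) p ![v]

variable (G) in
/-- The values of `Ω^{de}_{abc}` as a matrix in `d`, `e`. -/
def omegaMat (p : F20) (I : Fin 3 → Fin 4) (v : F20) : Matrix (Fin 4) (Fin 4) ℝ :=
  Matrix.of fun d e => omega G d e (I 0) (I 1) (I 2) p ![v]

theorem omegaMat_apply (p : F20) (a b c : Fin 4) (v : F20) (d e : Fin 4) :
    omegaMat G p ![a, b, c] v d e = (1 / 2) * gFrame G p b c * dualWeylUp G p a v d e
      + kron e b * dualWeyl G p c a v d + kron e c * dualWeyl G p b a v d := by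
  have h0 : (![a, b, c] : Fin 3 → Fin 4) 0 = a := rfl
  have h1 : (![a, b, c] : Fin 3 → Fin 4) 1 = b := rfl
  have h2 : (![a, b, c] : Fin 3 → Fin 4) 2 = c := rfl
  rw [omegaMat, Matrix.of_apply, h0, h1, h2, omega,
    ContinuousAlternatingMap.add_apply, ContinuousAlternatingMap.add_apply,
    ContinuousAlternatingMap.smul_apply, ContinuousAlternatingMap.smul_apply,
    ContinuousAlternatingMap.smul_apply]
  simp only [smul_eq_mul, dualWeyl, dualWeylUp, Matrix.of_apply]

theorem weylUpMat_eq (p v w : F20) :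
    (Matrix.of fun d e => weylUp G d e p ![v, w] : Matrix (Fin 4) (Fin 4) ℝ) =
      gInv G p * weylMat G p v w := by
  ext d e
  rw [Matrix.of_apply, weylUp_apply, Matrix.mul_apply]
  rfl

theorem sum_mul_mul_apply (A B M : Matrix (Fin 4) (Fin 4) ℝ) (a b : Fin 4) :
    (A * M * B) a b = ∑ x : Fin 4 × Fin 4, A a x.1 * B x.2 b * M x.1 x.2 := by
  rw [Fintype.sum_prod_type, Finset.sum_comm, Matrix.mul_apply]
  refine Finset.sum_congr rfl fun j _ => ?_
  rw [Matrix.mul_apply, Finset.sum_mul]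
  refine Finset.sum_congr rfl fun i _ => ?_
  ring

theorem IsLorentzOn.dualWeyl_rightAct (hG : IsLorentzOn G D) {p : F20} (hp : p ∈ framesOver D)
    (hh : h.det ≠ 0) (c a : Fin 4) (v : F20) (d : Fin 4) :
    dualWeyl G (rightAct h p) c a (rightAct h v) d = rsign h.det * ∑ a', h a' a * ∑ c', h c' c *
      (h⁻¹.mulVec (dualWeyl G p c' a' v)) d := by
  have h1 := hG.hodge_wedge_rightAct hp hh (μ' := weyl G c d) (ν' := thetaLow G a)
    (μ := fun i : Fin 4 × Fin 4 => weyl G i.1 i.2) (ν := thetaLow G)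
    (c := fun i => h.transpose c i.1 * h⁻¹.transpose i.2 d) (r := fun a' => h a' a)
    (fun u w => by
      have := congrFun (congrFun (hG.weylMat_rightAct hp hh u w) c) d
      rw [sum_mul_mul_apply] at this
      exact this) (fun w => thetaLow_rightAct hh p w a) v
  refine h1.trans ?_
  congr 1
  refine Finset.sum_congr rfl fun a' _ => ?_
  rw [Fintype.sum_prod_type]
  congr 1
  refine Finset.sum_congr rfl fun c' _ => ?_
  rw [Matrix.mulVec, dotProduct, Finset.mul_sum]
  refine Finset.sum_congr rfl fun d' _ => ?_
  rw [dualWeyl, Matrix.transpose_apply, Matrix.transpose_apply]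
  ring

theorem IsLorentzOn.dualWeylUp_rightAct (hG : IsLorentzOn G D) {p : F20}
    (hp : p ∈ framesOver D) (hh : h.det ≠ 0) (a : Fin 4) (v : F20) (d e : Fin 4) :
    dualWeylUp G (rightAct h p) a (rightAct h v) d e = rsign h.det * ∑ a', h a' a *
      (h⁻¹ * dualWeylUp G p a' v * h⁻¹.transpose) d e := by
  have hinv : h⁻¹.transpose * h.transpose = 1 := by
    rw [← Matrix.transpose_mul, Matrix.mul_nonsing_inv _ hh.isUnit, Matrix.transpose_one]
  have h1 := hG.hodge_wedge_rightAct hp hh (μ' := weylUp G d e) (ν' := thetaLow G a)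
    (μ := fun i : Fin 4 × Fin 4 => weylUp G i.1 i.2) (ν := thetaLow G)
    (c := fun i => h⁻¹ d i.1 * h⁻¹.transpose i.2 e) (r := fun a' => h a' a)
    (fun u w => by
      have e1 : (Matrix.of fun d e => weylUp G d e (rightAct h p) ![rightAct h u, rightAct h w] :
          Matrix (Fin 4) (Fin 4) ℝ) =
          h⁻¹ * (Matrix.of fun d e => weylUp G d e p ![u, w]) * h⁻¹.transpose := by
        rw [weylUpMat_eq, weylUpMat_eq, hG.weylMat_rightAct hp hh, gInv_rightAct]
        simp only [Matrix.mul_assoc]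
        rw [← Matrix.mul_assoc h⁻¹.transpose, hinv, Matrix.one_mul]
      have := congrFun (congrFun e1 d) e
      rw [sum_mul_mul_apply] at this
      exact this) (fun w => thetaLow_rightAct hh p w a) v
  refine h1.trans ?_
  congr 1
  refine Finset.sum_congr rfl fun a' _ => ?_
  rw [sum_mul_mul_apply]
  rfl

/-- The Kronecker symbol is an invariant tensor and the metric is covariant, so the three summands
of Ω share one type. The sign comes from the dual, which occurs once in each. -/
theorem IsLorentzOn.omegaMat_rightAct (hG : IsLorentzOn G D) {p : F20} (hp : p ∈ framesOver D)
    (hh : h.det ≠ 0) (I : Fin 3 → Fin 4) (v : F20) :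
    omegaMat G (rightAct h p) I (rightAct h v) = rsign h.det • ∑ J : Fin 3 → Fin 4,
      (∏ k, h (J k) (I k)) • (h⁻¹ * omegaMat G p J v * h⁻¹.transpose) := by
  obtain ⟨a, b, c, rfl⟩ : ∃ a b c, I = ![a, b, c] :=
    ⟨I 0, I 1, I 2, by ext i; fin_cases i <;> rfl⟩
  ext d e
  have hJ : ∀ a' b' c', (h⁻¹ * omegaMat G p ![a', b', c'] v * h⁻¹.transpose) d e =
      (1 / 2) * gFrame G p b' c' * (h⁻¹ * dualWeylUp G p a' v * h⁻¹.transpose) d e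
      + h⁻¹ e b' * (h⁻¹.mulVec (dualWeyl G p c' a' v)) d
      + h⁻¹ e c' * (h⁻¹.mulVec (dualWeyl G p b' a' v)) d := by
    intro a' b' c'
    have hk : ∀ b', ∀ y : Fin 4 → ℝ, ∑ x : Fin 4 × Fin 4, h⁻¹ d x.1 * h⁻¹.transpose x.2 e *
        (kron x.2 b' * y x.1) = h⁻¹ e b' * (h⁻¹.mulVec y) d := by
      intro b' y
      rw [Fintype.sum_prod_type, Matrix.mulVec, dotProduct, Finset.mul_sum]
      refine Finset.sum_congr rfl fun x _ => ?_
      have := sum_mul_kron b' fun z => h⁻¹ d x * h⁻¹ e z * y x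
      simp only [kron_comm b'] at this
      calc _ = ∑ z, h⁻¹ d x * h⁻¹ e z * y x * kron z b' := by
            refine Finset.sum_congr rfl fun z _ => ?_
            rw [Matrix.transpose_apply]; ring
        _ = _ := by rw [this]; ring
    rw [sum_mul_mul_apply, sum_mul_mul_apply]
    simp only [omegaMat_apply, mul_add, Finset.sum_add_distrib, hk]
    congr 2
    rw [Finset.mul_sum]
    refine Finset.sum_congr rfl fun x _ => ?_
    ring
  -- Invariance of δ^e_b: the h on its lower index cancels the h⁻¹ on its upper index.
  have hkh : ∀ b, ∑ b', h b' b * h⁻¹ e b' = kron e b := fun b => by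
    have := congrFun (congrFun (Matrix.nonsing_inv_mul _ hh.isUnit) e) b
    rw [Matrix.mul_apply, Matrix.one_apply] at this
    rw [kron, ← this]
    exact Finset.sum_congr rfl fun _ _ => mul_comm _ _
  have hg : gFrame G (rightAct h p) b c = ∑ b', ∑ c', h b' b * h c' c * gFrame G p b' c' := by
    rw [gFrame_rightAct, sum_mul_mul_apply, Fintype.sum_prod_type]
    rfl
  rw [omegaMat_apply, hg, hG.dualWeylUp_rightAct hp hh, hG.dualWeyl_rightAct hp hh,
    hG.dualWeyl_rightAct hp hh, Matrix.smul_apply, Matrix.sum_apply]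
  simp only [Matrix.smul_apply, smul_eq_mul, sum_vecCons, sum_vec_zero, Fin.prod_univ_three]
  set u : Fin 4 → ℝ := fun a' => (h⁻¹ * dualWeylUp G p a' v * h⁻¹.transpose) d e with hu
  set y : Fin 4 → Fin 4 → ℝ := fun c' a' => (h⁻¹.mulVec (dualWeyl G p c' a' v)) d with hy
  have hR : ∀ a' b' c', h (![a', b', c'] 0) (![a, b, c] 0) * h (![a', b', c'] 1) (![a, b, c] 1) *
      h (![a', b', c'] 2) (![a, b, c] 2) *
      (h⁻¹ * omegaMat G p ![a', b', c'] v * h⁻¹.transpose) d e =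
      (h a' a * u a') * (1 / 2 * (h b' b * h c' c * gFrame G p b' c'))
      + (h b' b * h⁻¹ e b') * (h a' a * (h c' c * y c' a'))
      + (h c' c * h⁻¹ e c') * (h a' a * (h b' b * y b' a')) := by
    intro a' b' c'
    rw [hJ]
    change h a' a * h b' b * h c' c * _ = _
    ring
  have e1 : ∀ a', ∑ b', ∑ c', h (![a', b', c'] 0) (![a, b, c] 0) *
      h (![a', b', c'] 1) (![a, b, c] 1) * h (![a', b', c'] 2) (![a, b, c] 2) *
      (h⁻¹ * omegaMat G p ![a', b', c'] v * h⁻¹.transpose) d e =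
      (h a' a * u a') * (1 / 2 * ∑ b', ∑ c', h b' b * h c' c * gFrame G p b' c')
      + kron e b * (h a' a * ∑ c', h c' c * y c' a')
      + kron e c * (h a' a * ∑ b', h b' b * y b' a') := by
    intro a'
    simp only [hR, Finset.sum_add_distrib, ← Finset.mul_sum, ← Finset.sum_mul, hkh]
  have e2 := Finset.sum_congr rfl fun a' (_ : a' ∈ (Finset.univ : Finset (Fin 4))) => e1 a'
  refine Eq.trans ?_ (congrArg (fun z => rsign h.det * z) e2.symm)
  simp only [Finset.sum_add_distrib, ← Finset.mul_sum, ← Finset.sum_mul]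
  ring

end OmegaAction

/-! ### The twisted tensor representation at an inverse -/

section Representation

theorem detSign_inv (h : GL (Fin 4) ℝ) : detSign h⁻¹ = rsign h.val.det := by
  have hd : h.val.det ≠ 0 := (Matrix.isUnit_iff_isUnit_det h.val).1 h.isUnit |>.ne_zero
  have h1 : detSign h⁻¹ * detSign h = 1 := by
    rw [← detSign_mul, inv_mul_cancel, detSign_one]
  have h2 : detSign h = rsign h.val.det := rfl
  have h3 : rsign h.val.det * rsign h.val.det = 1 := by
    rw [rsign_eq hd, mul_mul_mul_comm, ← mul_inv, abs_mul_abs_self, inv_mul_cancel₀]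
    exact mul_ne_zero hd hd
  rw [h2] at h1
  calc detSign h⁻¹ = detSign h⁻¹ * (rsign h.val.det * rsign h.val.det) := by rw [h3, mul_one]
    _ = _ := by rw [← mul_assoc, h1, one_mul]

/-- The order of summation, lower indices outside and upper ones inside, is that of
`IsLorentzOn.omegaMat_rightAct`, so the two can be compared termwise. -/
theorem twistedRep_inv_apply (r s : ℕ) (h : GL (Fin 4) ℝ) (f : MultiIndex r s → ℝ)
    (I : MultiIndex r s) : twistedRep r s h⁻¹ f I = rsign h.val.det *
      ∑ J₂ : Fin s → Fin 4, (∏ k, h.val (J₂ k) (I.2 k)) *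
        ∑ J₁ : Fin r → Fin 4, (∏ k, h.val⁻¹ (I.1 k) (J₁ k)) * f (J₁, J₂) := by
  change (detSign h⁻¹ • Matrix.toLin' (tensorMat r s h⁻¹)) f I = _
  rw [LinearMap.smul_apply, Pi.smul_apply, smul_eq_mul, detSign_inv, Matrix.toLin'_apply,
    Matrix.mulVec, dotProduct, Fintype.sum_prod_type, Finset.sum_comm]
  congr 1
  refine Finset.sum_congr rfl fun J₂ _ => ?_
  rw [Finset.mul_sum]
  refine Finset.sum_congr rfl fun J₁ _ => ?_
  rw [tensorMat, Matrix.of_apply, inv_inv, Matrix.coe_units_inv]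
  ring

end Representation

/-! ### Contraction of two upper with two lower indices -/

section Pairing

variable {h : Matrix (Fin 4) (Fin 4) ℝ}

/-- The complete contraction `O^{ed} M_{ed}` of two matrices. -/
def pairing (O N : Matrix (Fin 4) (Fin 4) ℝ) : ℝ := ∑ e, ∑ d, O e d * N e d

theorem pairing_eq_trace (O N : Matrix (Fin 4) (Fin 4) ℝ) :
    pairing O N = (O * N.transpose).trace := by
  rw [pairing, Matrix.trace]
  refine Finset.sum_congr rfl fun e _ => ?_
  rw [Matrix.diag_apply, Matrix.mul_apply]
  rfl

/-- The contraction is the trace of ONᵀ; the inner factors cancel and the outer ones form a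
conjugation. -/
theorem pairing_congr (hh : h.det ≠ 0) (O N : Matrix (Fin 4) (Fin 4) ℝ) :
    pairing (h⁻¹ * O * h⁻¹.transpose) (h.transpose * N * h) = pairing O N := by
  have h1 : h⁻¹.transpose * h.transpose = 1 := by
    rw [← Matrix.transpose_mul, Matrix.mul_nonsing_inv _ hh.isUnit, Matrix.transpose_one]
  rw [pairing_eq_trace, pairing_eq_trace, Matrix.transpose_mul, Matrix.transpose_mul,
    Matrix.transpose_transpose]
  have e : h⁻¹ * O * h⁻¹.transpose * (h.transpose * (N.transpose * h)) =
      h⁻¹ * (O * N.transpose * h) := by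
    simp only [Matrix.mul_assoc]
    rw [← Matrix.mul_assoc h⁻¹.transpose, h1, Matrix.one_mul]
  rw [e, Matrix.trace_mul_comm, Matrix.mul_assoc, Matrix.mul_nonsing_inv _ hh.isUnit,
    Matrix.mul_one]

theorem pairing_smul_sum (s : ℝ) {ι : Type*} [Fintype ι] (c : ι → ℝ)
    (O : ι → Matrix (Fin 4) (Fin 4) ℝ) (N : Matrix (Fin 4) (Fin 4) ℝ) :
    pairing (s • ∑ i, c i • O i) N = s * ∑ i, c i * pairing (O i) N := by
  simp only [pairing_eq_trace, Matrix.smul_mul, Matrix.trace_smul, Matrix.sum_mul,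
    Matrix.trace_sum, smul_eq_mul]

end Pairing

/-! ### Equivariance of the Bel-Robinson form and of 𝒦 -/

section Equivariance

variable {G : E4 → Matrix (Fin 4) (Fin 4) ℝ} {D : Set E4} {h : Matrix (Fin 4) (Fin 4) ℝ}

variable (G) in
/-- The matrix of values of the forms `𝒲_{ab}`. -/
def weylLowMat (p v w : F20) : Matrix (Fin 4) (Fin 4) ℝ :=
  Matrix.of fun a b => weylLow G a b p ![v, w]

variable (G) in
/-- The matrix of values of the forms `S_e ∧ θ_d - S_d ∧ θ_e`. -/
def schoutenThetaMat (p v w : F20) : Matrix (Fin 4) (Fin 4) ℝ :=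
  Matrix.of fun e d =>
    (wedge (schoutenForm G e p) (thetaLow G d p) : Alt F20 2) ![v, w]
      - (wedge (schoutenForm G d p) (thetaLow G e p) : Alt F20 2) ![v, w]

theorem weylLowMat_eq (p v w : F20) : weylLowMat G p v w = weylMat G p v w * gFrame G p := by
  ext a b
  rw [weylLowMat, Matrix.of_apply, weylLow_apply, Matrix.mul_apply]
  exact Finset.sum_congr rfl fun _ _ => mul_comm _ _

theorem IsLorentzOn.weylLowMat_rightAct (hG : IsLorentzOn G D) {p : F20}
    (hp : p ∈ framesOver D) (hh : h.det ≠ 0) (v w : F20) :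
    weylLowMat G (rightAct h p) (rightAct h v) (rightAct h w) =
      h.transpose * weylLowMat G p v w * h := by
  have h1 : h⁻¹.transpose * h.transpose = 1 := by
    rw [← Matrix.transpose_mul, Matrix.mul_nonsing_inv _ hh.isUnit, Matrix.transpose_one]
  rw [weylLowMat_eq, weylLowMat_eq, hG.weylMat_rightAct hp hh, gFrame_rightAct]
  simp only [Matrix.mul_assoc]
  rw [← Matrix.mul_assoc h⁻¹.transpose, h1, Matrix.one_mul]

theorem IsLorentzOn.schoutenThetaMat_rightAct (hG : IsLorentzOn G D) {p : F20}
    (hp : p ∈ framesOver D) (hh : h.det ≠ 0) (v w : F20) :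
    schoutenThetaMat G (rightAct h p) (rightAct h v) (rightAct h w) =
      h.transpose * schoutenThetaMat G p v w * h := by
  have e : ∀ p v w, schoutenThetaMat G p v w =
      Matrix.vecMulVec (fun e => schoutenForm G e p ![v]) (fun d => thetaLow G d p ![w])
      - Matrix.vecMulVec (fun e => schoutenForm G e p ![w]) (fun d => thetaLow G d p ![v])
      - (Matrix.vecMulVec (fun d => thetaLow G d p ![w]) (fun e => schoutenForm G e p ![v])
      - Matrix.vecMulVec (fun d => thetaLow G d p ![v]) (fun e => schoutenForm G e p ![w])) := by
    intro p v w
    ext e d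
    simp only [schoutenThetaMat, Matrix.of_apply, Matrix.sub_apply, Matrix.vecMulVec_apply]
    have h1 : ∀ e d, (wedge (schoutenForm G e p) (thetaLow G d p) : Alt F20 2) ![v, w] = _ :=
      fun e d => wedge_one_one _ _ _ _
    rw [h1, h1]
    ring
  have hS : ∀ v, (fun e => schoutenForm G e (rightAct h p) ![rightAct h v]) =
      h.transpose.mulVec (fun e => schoutenForm G e p ![v]) := fun v =>
    funext fun a => hG.schoutenForm_rightAct hp hh v a
  have hθ : ∀ v, (fun e => thetaLow G e (rightAct h p) ![rightAct h v]) =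
      h.transpose.mulVec (fun e => thetaLow G e p ![v]) := fun v =>
    funext fun a => thetaLow_rightAct hh p v a
  have hv : ∀ x y : Fin 4 → ℝ, Matrix.vecMulVec (h.transpose.mulVec x) (h.transpose.mulVec y) =
      h.transpose * Matrix.vecMulVec x y * h := fun x y => by
    rw [Matrix.mul_vecMulVec, Matrix.vecMulVec_mul, Matrix.mulVec_transpose h y]
  rw [e, e, hS, hS, hθ, hθ]
  simp only [hv, Matrix.mul_sub, Matrix.sub_mul]

/-- Forms of the type of `𝒯` and `𝒦` are pseudo-tensorial. -/
theorem IsLorentzOn.isPseudoTensorial_of_pairing (hG : IsLorentzOn G D)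
    {N : F20 → F20 → F20 → Matrix (Fin 4) (Fin 4) ℝ}
    (hN : ∀ h : Matrix (Fin 4) (Fin 4) ℝ, h.det ≠ 0 → ∀ p ∈ framesOver D, ∀ v w,
      N (rightAct h p) (rightAct h v) (rightAct h w) = h.transpose * N p v w * h)
    {T : Fin 4 → Fin 4 → Fin 4 → Form F20 3}
    (hT : ∀ p u v w, ∀ I : Fin 3 → Fin 4, T (I 0) (I 1) (I 2) p ![u, v, w] =
      pairing (omegaMat G p I u) (N p v w) - pairing (omegaMat G p I v) (N p u w)
        + pairing (omegaMat G p I w) (N p u v)) :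
    IsPseudoTensorial (framesOver D) (twistedRep 0 3) (fun I => T (I.2 0) (I.2 1) (I.2 2)) := by
  intro h p hp v I
  have hd : h.val.det ≠ 0 := (Matrix.isUnit_iff_isUnit_det h.val).1 h.isUnit |>.ne_zero
  obtain ⟨u, v, w, rfl⟩ : ∃ x y z, v = ![x, y, z] :=
    ⟨v 0, v 1, v 2, by ext i : 1; fin_cases i <;> rfl⟩
  have e1 : (fun n => rightAct h.val (![u, v, w] n)) =
      ![rightAct h.val u, rightAct h.val v, rightAct h.val w] := by
    ext i : 1; fin_cases i <;> rfl
  -- Contracting e and d removes both upper indices of Ω, so that the sign and the three lower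
  -- indices alone determine the type.
  have e2 : ∀ x y z, pairing (omegaMat G (rightAct h.val p) I.2 (rightAct h.val x))
      (N (rightAct h.val p) (rightAct h.val y) (rightAct h.val z)) = rsign h.val.det *
        ∑ J : Fin 3 → Fin 4, (∏ k, h.val (J k) (I.2 k)) * pairing (omegaMat G p J x) (N p y z) := by
    intro x y z
    rw [hN _ hd p hp, hG.omegaMat_rightAct hp hd, pairing_smul_sum]
    simp only [pairing_congr hd]
  rw [e1, twistedRep_inv_apply]
  change T (I.2 0) (I.2 1) (I.2 2) _ _ = _
  rw [hT, e2, e2, e2, ← mul_sub, ← mul_add, ← Finset.sum_sub_distrib, ← Finset.sum_add_distrib]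
  congr 1
  refine Finset.sum_congr rfl fun J _ => ?_
  rw [Fintype.sum_unique, Fin.prod_univ_zero, one_mul, hT]
  ring

theorem omegaMat_eq (p : F20) (I : Fin 3 → Fin 4) (v : F20) (d e : Fin 4) :
    omegaMat G p I v d e = omega G d e (I 0) (I 1) (I 2) p ![v] := by
  rw [omegaMat, Matrix.of_apply]

theorem belRobinson_apply (p u v w : F20) (I : Fin 3 → Fin 4) :
    belRobinson G (I 0) (I 1) (I 2) p ![u, v, w] =
      pairing (omegaMat G p I u) (weylLowMat G p v w)
        - pairing (omegaMat G p I v) (weylLowMat G p u w)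
        + pairing (omegaMat G p I w) (weylLowMat G p u v) := by
  have e : ∀ e d, (wedge (omega G e d (I 0) (I 1) (I 2) p) (weylLow G e d p) : Alt F20 3)
      ![u, v, w] = _ := fun e d => wedge_one_two _ _ _ _ _
  rw [belRobinson, ContinuousAlternatingMap.sum_apply]
  simp only [ContinuousAlternatingMap.sum_apply, e, pairing, Finset.sum_add_distrib,
    Finset.sum_sub_distrib, omegaMat_eq, weylLowMat, Matrix.of_apply]

/-- The antisymmetrization is moved from Ω to S_e ∧ θ_d. This puts 𝒦 in the same shape as 𝒯, so that
both are handled by one argument. -/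
theorem kForm_apply (p u v w : F20) (I : Fin 3 → Fin 4) :
    kForm G (I 0) (I 1) (I 2) p ![u, v, w] =
      pairing (omegaMat G p I u) (schoutenThetaMat G p v w)
        - pairing (omegaMat G p I v) (schoutenThetaMat G p u w)
        + pairing (omegaMat G p I w) (schoutenThetaMat G p u v) := by
  have e : ∀ e d, (wedge (omega G e d (I 0) (I 1) (I 2) p - omega G d e (I 0) (I 1) (I 2) p)
      (wedge (schoutenForm G e p) (thetaLow G d p) : Alt F20 2) : Alt F20 3)
      ![u, v, w] = _ := fun e d => wedge_one_two _ _ _ _ _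
  have e1 : ∀ (O N : Matrix (Fin 4) (Fin 4) ℝ), ∑ e, ∑ d, (O e d - O d e) * N e d =
      pairing O (N - N.transpose) := fun O N => by
    have h1 : ∑ e, ∑ d, O d e * N e d = ∑ e, ∑ d, O e d * N.transpose e d := Finset.sum_comm
    simp only [pairing, Matrix.sub_apply, sub_mul, mul_sub, Finset.sum_sub_distrib, h1]
  rw [kForm, ContinuousAlternatingMap.sum_apply]
  have e2 : ∀ v w, schoutenThetaMat G p v w = (Matrix.of fun e d =>
      (wedge (schoutenForm G e p) (thetaLow G d p) : Alt F20 2) ![v, w]) -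
      (Matrix.of fun e d =>
        (wedge (schoutenForm G e p) (thetaLow G d p) : Alt F20 2) ![v, w]).transpose := by
    intro v w
    ext e d
    simp only [schoutenThetaMat, Matrix.of_apply, Matrix.sub_apply, Matrix.transpose_apply]
  simp only [e2, ← e1]
  simp only [ContinuousAlternatingMap.sum_apply, e, Finset.sum_add_distrib,
    Finset.sum_sub_distrib, ContinuousAlternatingMap.sub_apply, omegaMat_eq, Matrix.of_apply]

end Equivariance

/-! ### Vertical vectors and tensoriality -/

section Horizontal

variable {V : Type*} [NormedAddCommGroup V] [NormedSpace ℝ V]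

theorem map_swap_three_fst (α : Alt V 3) (u v w : V) : α ![v, u, w] = -α ![u, v, w] := by
  have h := α.toAlternatingMap.map_swap ![u, v, w] (i := 0) (j := 1) (by decide)
  have e : (![u, v, w] ∘ Equiv.swap (0 : Fin 3) 1) = ![v, u, w] := by
    ext i; fin_cases i <;> rfl
  rw [e] at h
  exact h

theorem map_swap_three_snd (α : Alt V 3) (u v w : V) : α ![u, w, v] = -α ![u, v, w] := by
  have h := α.toAlternatingMap.map_swap ![u, v, w] (i := 1) (j := 2) (by decide)
  have e : (![u, v, w] ∘ Equiv.swap (1 : Fin 3) 2) = ![u, w, v] := by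
    ext i; fin_cases i <;> rfl
  rw [e] at h
  exact h

variable {G : E4 → Matrix (Fin 4) (Fin 4) ℝ} {D : Set E4}

theorem isVertical_iff {p : F20} (hp : p ∈ framesOver D) (v : F20) :
    IsVertical p v ↔ v.1 = 0 := by
  constructor
  · intro h
    have h1 : (frameMat p)⁻¹.mulVec (fun i => v.1 i) = 0 := funext fun a => by
      have := h a
      rw [theta_apply] at this
      exact this
    have h2 := congrArg (frameMat p).mulVec h1
    rw [Matrix.mulVec_mulVec, frameMat_mul_inv hp, Matrix.one_mulVec, Matrix.mulVec_zero] at h2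
    ext i
    exact congrFun h2 i
  · intro h a
    rw [theta_apply, h]
    simp

theorem thetaVec_of_isVertical {p v : F20} (hv : IsVertical p v) : thetaVec p v = 0 := funext hv

theorem hodge_of_isVertical {p v : F20} (hv : IsVertical p v) (α : Form F20 3) :
    hodge G α p ![v] = 0 := by
  rw [hodge, hodgeThree_apply]
  exact Finset.sum_eq_zero fun d _ => by rw [hv d, mul_zero]

theorem omegaMat_of_isVertical {p v : F20} (hv : IsVertical p v) (I : Fin 3 → Fin 4) :
    omegaMat G p I v = 0 := by
  ext d e
  rw [omegaMat_eq, omega, ContinuousAlternatingMap.add_apply, ContinuousAlternatingMap.add_apply,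
    ContinuousAlternatingMap.smul_apply, ContinuousAlternatingMap.smul_apply,
    ContinuousAlternatingMap.smul_apply, hodge_of_isVertical hv, hodge_of_isVertical hv,
    hodge_of_isVertical hv]
  simp

theorem baseCurv_zero_left (y w : E4) : baseCurv G y 0 w = 0 := by
  have := baseCurv_smul_left (G := G) y 0 0 w
  rwa [zero_smul, zero_smul] at this

/-- The curvature depends only on base components by `IsLorentzOn.curvMat_eq`, and the Schouten
terms are built from canonical forms. -/
theorem IsLorentzOn.weylMat_of_isVertical (hG : IsLorentzOn G D) {p : F20}
    (hp : p ∈ framesOver D) {v : F20} (hv : IsVertical p v) (w : F20) :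
    weylMat G p v w = 0 := by
  ext a b
  have h1 := congrFun (congrFun (hG.curvMat_eq hp v w) b) a
  rw [(isVertical_iff hp v).1 hv, baseCurv_zero_left, Matrix.mul_zero, Matrix.zero_mul] at h1
  have h2 : curv G a b p ![v, w] = 0 := h1
  rw [weylMat, Matrix.of_apply, weyl_apply, h2, schoutenForm_apply, schoutenFormUp_apply,
    thetaLow_apply, hv b, schoutenForm_apply a p v, schoutenFormUp_apply b p v,
    thetaVec_of_isVertical hv]
  simp

theorem weylMat_swap (p v w : F20) : weylMat G p v w = -weylMat G p w v := by
  ext a b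
  exact map_swap_two (weyl G a b p) v w

theorem IsLorentzOn.weylLowMat_of_isVertical (hG : IsLorentzOn G D) {p : F20}
    (hp : p ∈ framesOver D) {v : F20} (hv : IsVertical p v) (w : F20) :
    weylLowMat G p v w = 0 := by
  rw [weylLowMat_eq, hG.weylMat_of_isVertical hp hv, Matrix.zero_mul]

theorem weylLowMat_swap (p v w : F20) : weylLowMat G p v w = -weylLowMat G p w v := by
  rw [weylLowMat_eq, weylLowMat_eq, weylMat_swap, Matrix.neg_mul]

theorem schoutenThetaMat_of_isVertical {p v : F20} (hv : IsVertical p v) (w : F20) :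
    schoutenThetaMat G p v w = 0 := by
  ext e d
  have h1 : ∀ e d, (wedge (schoutenForm G e p) (thetaLow G d p) : Alt F20 2) ![v, w] = _ :=
    fun e d => wedge_one_one _ _ _ _
  have h2 : ∀ e, schoutenForm G e p ![v] = 0 := fun e => by
    rw [schoutenForm_apply, thetaVec_of_isVertical hv, Matrix.mulVec_zero]; rfl
  have h3 : ∀ e, thetaLow G e p ![v] = 0 := fun e => by
    rw [thetaLow_apply, thetaVec_of_isVertical hv, Matrix.mulVec_zero]; rfl
  rw [schoutenThetaMat, Matrix.of_apply, h1, h1, h2, h2, h3, h3]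
  simp

theorem schoutenThetaMat_swap (p v w : F20) :
    schoutenThetaMat G p v w = -schoutenThetaMat G p w v := by
  ext e d
  rw [schoutenThetaMat, schoutenThetaMat, Matrix.neg_apply, Matrix.of_apply, Matrix.of_apply,
    map_swap_two _ v w, map_swap_two _ v w]
  ring

theorem pairing_zero_left (N : Matrix (Fin 4) (Fin 4) ℝ) : pairing 0 N = 0 := by
  simp [pairing]

theorem pairing_zero_right (O : Matrix (Fin 4) (Fin 4) ℝ) : pairing O 0 = 0 := by
  simp [pairing]

/-- In every term of the expansion the vertical argument enters either Ω or N, and both vanish on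
it. -/
theorem isHorizontalAt_of_pairing {p : F20} {N : F20 → F20 → Matrix (Fin 4) (Fin 4) ℝ}
    (hN : ∀ v, IsVertical p v → ∀ w, N v w = 0) (hN' : ∀ v w, N v w = -N w v)
    {α : Alt F20 3} {I : Fin 3 → Fin 4}
    (hα : ∀ u v w, α ![u, v, w] = pairing (omegaMat G p I u) (N v w)
      - pairing (omegaMat G p I v) (N u w) + pairing (omegaMat G p I w) (N u v)) :
    IsHorizontalAt p α := by
  have hN2 : ∀ v, IsVertical p v → ∀ w, N w v = 0 := fun v hv w => by
    rw [hN', hN v hv, neg_zero]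
  rintro x ⟨n, hn⟩
  obtain ⟨u, v, w, rfl⟩ : ∃ u v w, x = ![u, v, w] :=
    ⟨x 0, x 1, x 2, by ext i : 1; fin_cases i <;> rfl⟩
  rw [hα]
  fin_cases n
  · have hn : IsVertical p u := hn
    rw [omegaMat_of_isVertical hn, hN u hn, hN u hn]
    simp only [pairing_zero_left, pairing_zero_right]; ring
  · have hn : IsVertical p v := hn
    rw [omegaMat_of_isVertical hn, hN v hn, hN2 v hn]
    simp only [pairing_zero_left, pairing_zero_right]; ring
  · have hn : IsVertical p w := hn
    rw [omegaMat_of_isVertical hn, hN2 w hn, hN2 w hn]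
    simp only [pairing_zero_left, pairing_zero_right]; ring

theorem IsLorentzOn.isHorizontalAt_belRobinson (hG : IsLorentzOn G D) {p : F20}
    (hp : p ∈ framesOver D) (I : Fin 3 → Fin 4) :
    IsHorizontalAt p (belRobinson G (I 0) (I 1) (I 2) p) :=
  isHorizontalAt_of_pairing (fun _ hv w => hG.weylLowMat_of_isVertical hp hv w)
    (weylLowMat_swap p) (fun u v w => belRobinson_apply p u v w I)

theorem isHorizontalAt_kForm (p : F20) (I : Fin 3 → Fin 4) :
    IsHorizontalAt p (kForm G (I 0) (I 1) (I 2) p) :=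
  isHorizontalAt_of_pairing (fun _ hv w => schoutenThetaMat_of_isVertical hv w)
    (schoutenThetaMat_swap p) (fun u v w => kForm_apply p u v w I)

theorem IsLorentzOn.isTensorial_belRobinson (hG : IsLorentzOn G D) :
    IsTensorial (framesOver D) (twistedRep 0 3)
      (fun I => belRobinson G (I.2 0) (I.2 1) (I.2 2)) :=
  ⟨hG.isPseudoTensorial_of_pairing (N := weylLowMat G)
    (fun _ hh _ hp v w => hG.weylLowMat_rightAct hp hh v w) belRobinson_apply,
    fun I _ hp => hG.isHorizontalAt_belRobinson hp I.2⟩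

theorem IsLorentzOn.isTensorial_kForm (hG : IsLorentzOn G D) :
    IsTensorial (framesOver D) (twistedRep 0 3) (fun I => kForm G (I.2 0) (I.2 1) (I.2 2)) :=
  ⟨hG.isPseudoTensorial_of_pairing (N := schoutenThetaMat G)
    (fun _ hh _ hp v w => hG.schoutenThetaMat_rightAct hp hh v w) kForm_apply,
    fun I p _ => isHorizontalAt_kForm p I.2⟩

end Horizontal

/-! ### Equivariance of Ξ -/

section XiForm

variable {G : E4 → Matrix (Fin 4) (Fin 4) ℝ} {D : Set E4} {h : Matrix (Fin 4) (Fin 4) ℝ}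

variable (G) in
/-- The values of `Ξ^{de}_{abc}` as a matrix in `d`, `e`. -/
def xiMat (p : F20) (I : Fin 3 → Fin 4) (v w : F20) : Matrix (Fin 4) (Fin 4) ℝ :=
  Matrix.of fun d e => xi G d e (I 0) (I 1) (I 2) p ![v, w]

theorem IsLorentzOn.differentiableAt_omegaMat (hG : IsLorentzOn G D) {p : F20}
    (hp : p ∈ framesOver D) (I : Fin 3 → Fin 4) (w : F20) (d e : Fin 4) :
    DifferentiableAt ℝ (fun q => omegaMat G q I w d e) p := by
  simp only [omegaMat_eq]
  exact ((hG.contDiffAt_omega hp d e _ _ _).differentiableAt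
    (by simp)).continuousAlternatingMap_apply_const _

theorem IsLorentzOn.fderiv_omega (hG : IsLorentzOn G D) {p : F20} (hp : p ∈ framesOver D)
    (d e : Fin 4) (I : Fin 3 → Fin 4) (v w : F20) :
    fderiv ℝ (omega G d e (I 0) (I 1) (I 2)) p v ![w] =
      matDeriv (fun q => omegaMat G q I w) p v d e := by
  rw [matDeriv, Matrix.of_apply]
  simp only [omegaMat_eq]
  exact (fderiv_continuousAlternatingMap_apply_const_apply
    ((hG.contDiffAt_omega hp d e _ _ _).differentiableAt (by simp)) ![w] v).symm

theorem IsLorentzOn.xiMat_eq (hG : IsLorentzOn G D) {p : F20} (hp : p ∈ framesOver D)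
    (I : Fin 3 → Fin 4) (v w : F20) : xiMat G p I v w =
      matDeriv (fun q => omegaMat G q I w) p v - matDeriv (fun q => omegaMat G q I v) p w
        + (connMat G p v * omegaMat G p I w - connMat G p w * omegaMat G p I v) := by
  ext d e
  have e1 : ∀ f, (wedge (conn G d f p) (omega G f e (I 0) (I 1) (I 2) p) : Alt F20 2) ![v, w] = _ :=
    fun f => wedge_one_one _ _ _ _
  rw [xiMat, Matrix.of_apply, xi, ContinuousAlternatingMap.add_apply, extDeriv_one_apply,
    hG.fderiv_omega hp, hG.fderiv_omega hp, ContinuousAlternatingMap.sum_apply, Matrix.add_apply,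
    Matrix.sub_apply, Matrix.sub_apply, Matrix.mul_apply, Matrix.mul_apply,
    ← Finset.sum_sub_distrib]
  simp only [e1, omegaMat_eq, connMat, Matrix.of_apply]

theorem matDeriv_sum_conj {V ι : Type*} [NormedAddCommGroup V] [NormedSpace ℝ V] [Fintype ι]
    (c : ι → ℝ) (A B : Matrix (Fin 4) (Fin 4) ℝ) {F : ι → V → Matrix (Fin 4) (Fin 4) ℝ} {p : V}
    (hF : ∀ i a b, DifferentiableAt ℝ (fun q => F i q a b) p) (v : V) :
    matDeriv (fun q => ∑ i, c i • (A * F i q * B)) p v =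
      ∑ i, c i • (A * matDeriv (F i) p v * B) := by
  ext d e
  simp only [matDeriv, Matrix.of_apply, Matrix.sum_apply, Matrix.smul_apply, sum_mul_mul_apply,
    smul_eq_mul]
  rw [fderiv_fun_sum fun i _ => (DifferentiableAt.fun_sum fun x _ =>
    (hF i x.1 x.2).const_mul _).const_mul _, sum_apply]
  refine Finset.sum_congr rfl fun i _ => ?_
  rw [fderiv_const_mul (DifferentiableAt.fun_sum fun x _ => (hF i x.1 x.2).const_mul _),
    smul_apply, fderiv_fun_sum fun x _ => (hF i x.1 x.2).const_mul _, sum_apply, smul_eq_mul]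
  congr 1
  refine Finset.sum_congr rfl fun x _ => ?_
  rw [fderiv_const_mul (hF i x.1 x.2), smul_apply, smul_eq_mul]

theorem matDeriv_comp_rightAct {F : F20 → Matrix (Fin 4) (Fin 4) ℝ} {p : F20}
    (hF : ∀ a b, DifferentiableAt ℝ (fun q => F q a b) (rightAct h p)) (v : F20) :
    matDeriv (fun q => F (rightAct h q)) p v = matDeriv F (rightAct h p) (rightAct h v) := by
  ext a b
  simp only [matDeriv, Matrix.of_apply]
  have h1 : HasFDerivAt (fun q => rightAct h q) (rightAct h).toContinuousLinearMap p :=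
    (rightAct h).toContinuousLinearMap.hasFDerivAt
  have h2 := ((hF a b).hasFDerivAt.comp p h1).fderiv
  exact congrArg (fun L => L v) h2

/-- The law for Ω holds in a neighbourhood and the right action is linear with a constant matrix, so
the law may be differentiated. -/
theorem IsLorentzOn.matDeriv_omegaMat_rightAct (hG : IsLorentzOn G D) {p : F20}
    (hp : p ∈ framesOver D) (hh : h.det ≠ 0) (I : Fin 3 → Fin 4) (v w : F20) :
    matDeriv (fun q => omegaMat G q I (rightAct h w)) (rightAct h p) (rightAct h v) =
      rsign h.det • ∑ J : Fin 3 → Fin 4, (∏ k, h (J k) (I k)) •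
        (h⁻¹ * matDeriv (fun q => omegaMat G q J w) p v * h⁻¹.transpose) := by
  rw [← matDeriv_comp_rightAct fun a b =>
    hG.differentiableAt_omegaMat (rightAct_mem hp hh) I _ a b, Finset.smul_sum]
  simp only [smul_smul]
  rw [← matDeriv_sum_conj _ _ _ fun J a b => hG.differentiableAt_omegaMat hp J w a b]
  refine matDeriv_congr ?_ v
  filter_upwards [hG.isOpen_framesOver.mem_nhds hp] with q hq
  rw [hG.omegaMat_rightAct hq hh, Finset.smul_sum]
  simp only [smul_smul]
  rfl

/-- The connection is conjugated by h, so its product with Ω transforms like Ω itself, as does the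
derivative of Ω. -/
theorem IsLorentzOn.xiMat_rightAct (hG : IsLorentzOn G D) {p : F20} (hp : p ∈ framesOver D)
    (hh : h.det ≠ 0) (I : Fin 3 → Fin 4) (v w : F20) :
    xiMat G (rightAct h p) I (rightAct h v) (rightAct h w) = rsign h.det • ∑ J : Fin 3 → Fin 4,
      (∏ k, h (J k) (I k)) • (h⁻¹ * xiMat G p J v w * h⁻¹.transpose) := by
  have hc : ∀ v w, connMat G (rightAct h p) (rightAct h v) *
      omegaMat G (rightAct h p) I (rightAct h w) = rsign h.det • ∑ J : Fin 3 → Fin 4,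
        (∏ k, h (J k) (I k)) • (h⁻¹ * (connMat G p v * omegaMat G p J w) * h⁻¹.transpose) := by
    intro v w
    rw [connMat_rightAct, hG.omegaMat_rightAct hp hh, Matrix.mul_smul, Matrix.mul_sum]
    congr 1
    refine Finset.sum_congr rfl fun J _ => ?_
    rw [Matrix.mul_smul]
    congr 1
    simp only [Matrix.mul_assoc]
    rw [← Matrix.mul_assoc h h⁻¹, Matrix.mul_nonsing_inv _ hh.isUnit, Matrix.one_mul]
  rw [hG.xiMat_eq (rightAct_mem hp hh), hG.matDeriv_omegaMat_rightAct hp hh,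
    hG.matDeriv_omegaMat_rightAct hp hh, hc, hc, ← smul_sub, ← smul_sub, ← smul_add,
    ← Finset.sum_sub_distrib, ← Finset.sum_sub_distrib, ← Finset.sum_add_distrib]
  congr 1
  refine Finset.sum_congr rfl fun J _ => ?_
  rw [hG.xiMat_eq hp, ← smul_sub, ← smul_sub, ← smul_add]
  simp only [Matrix.mul_add, Matrix.mul_sub, Matrix.add_mul, Matrix.sub_mul]

theorem IsLorentzOn.isPseudoTensorial_xi (hG : IsLorentzOn G D) :
    IsPseudoTensorial (framesOver D) (twistedRep 2 3)
      (fun I => xi G (I.1 0) (I.1 1) (I.2 0) (I.2 1) (I.2 2)) := by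
  intro h p hp v I
  have hd : h.val.det ≠ 0 := (Matrix.isUnit_iff_isUnit_det h.val).1 h.isUnit |>.ne_zero
  obtain ⟨u, w, rfl⟩ : ∃ x y, v = ![x, y] := ⟨v 0, v 1, by ext i : 1; fin_cases i <;> rfl⟩
  have e1 : (fun n => rightAct h.val (![u, w] n)) = ![rightAct h.val u, rightAct h.val w] := by
    ext i : 1; fin_cases i <;> rfl
  have h1 := congrFun (congrFun (hG.xiMat_rightAct hp hd I.2 u w) (I.1 0)) (I.1 1)
  rw [Matrix.smul_apply, Matrix.sum_apply, smul_eq_mul, xiMat, Matrix.of_apply] at h1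
  rw [e1, twistedRep_inv_apply]
  beta_reduce
  rw [h1]
  congr 1
  refine Finset.sum_congr rfl fun J _ => ?_
  rw [Matrix.smul_apply, smul_eq_mul, sum_mul_mul_apply, Fintype.sum_prod_type]
  simp only [sum_vecCons, sum_vec_zero, Fin.prod_univ_two, xiMat, Matrix.of_apply,
    Matrix.cons_val_zero, Matrix.cons_val_one, Matrix.transpose_apply]

end XiForm

/-! ### Skewness of the Weyl forms -/

section WeylSymmetry

variable {G : E4 → Matrix (Fin 4) (Fin 4) ℝ} {D : Set E4}

/-- The lowered curvature is skew, and the Schouten correction in `curvLow_eq` changes sign when its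
two indices are exchanged. -/
theorem IsLorentzOn.weylLow_skew (hG : IsLorentzOn G D) {p : F20} (hp : p ∈ framesOver D)
    (a b : Fin 4) : weylLow G a b p = -weylLow G b a p := by
  have h1 := curvLow_eq b a p hG hp
  have h2 := curvLow_eq a b p hG hp
  have h3 := hG.curvLow_skew hp b a
  rw [h1, h2] at h3
  have h4 : weylLow G b a p = -weylLow G a b p := by
    have : weylLow G b a p = (weylLow G b a p - wedge (thetaLow G a p) (schoutenForm G b p)
      + wedge (thetaLow G b p) (schoutenForm G a p)) + wedge (thetaLow G a p) (schoutenForm G b p)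
      - wedge (thetaLow G b p) (schoutenForm G a p) := by abel
    rw [this, h3]
    abel
  rw [h4, neg_neg]

theorem IsLorentzOn.weylLowMat_skew (hG : IsLorentzOn G D) {p : F20} (hp : p ∈ framesOver D)
    (v w : F20) : (weylLowMat G p v w).transpose = -weylLowMat G p v w := by
  ext a b
  rw [Matrix.transpose_apply, Matrix.neg_apply, weylLowMat, Matrix.of_apply, Matrix.of_apply,
    hG.weylLow_skew hp b a]
  rfl

/-- `𝒲^{db} g_{bc} = -𝒲_c^d`. -/
theorem IsLorentzOn.sum_gFrame_smul_weylUp (hG : IsLorentzOn G D) {p : F20}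
    (hp : p ∈ framesOver D) (d c : Fin 4) :
    ∑ b, gFrame G p b c • weylUp G d b p = -weyl G c d p := by
  refine alt_two_ext fun v w => ?_
  have hs := hG.gFrame_transpose hp
  have hu : IsUnit (gFrame G p).det := (hG.det_gFrame_neg hp).ne.isUnit
  have hW : gInv G p * weylMat G p v w * gFrame G p = -(weylMat G p v w).transpose := by
    have h1 := congrArg (fun X => gInv G p * X) (hG.weylLowMat_skew hp v w)
    simp only [weylLowMat_eq, Matrix.transpose_mul, hs, Matrix.mul_neg] at h1
    rw [← Matrix.mul_assoc, gInv, Matrix.nonsing_inv_mul _ hu, Matrix.one_mul,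
      ← Matrix.mul_assoc] at h1
    rw [h1, neg_neg, gInv]
  have h2 := congrFun (congrFun hW d) c
  rw [← weylUpMat_eq, Matrix.mul_apply] at h2
  rw [ContinuousAlternatingMap.sum_apply]
  refine Eq.trans (Finset.sum_congr rfl fun b _ => ?_) h2
  rw [ContinuousAlternatingMap.smul_apply, smul_eq_mul, Matrix.of_apply, mul_comm]

theorem IsLorentzOn.sum_gFrame_mul_dualWeylUp (hG : IsLorentzOn G D) {p : F20}
    (hp : p ∈ framesOver D) (a d c : Fin 4) (v : F20) :
    ∑ b, gFrame G p b c * dualWeylUp G p a v d b = -dualWeyl G p c a v d := by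
  have h1 : hodgeThreeLin (gFrame G p) (horiz G p) (fun d => theta d p)
      (wedge (∑ b, gFrame G p b c • weylUp G d b p) (thetaLow G a p)) ![v] =
      ∑ b, gFrame G p b c * dualWeylUp G p a v d b := by
    rw [wedge_sum_left]
    simp only [wedge_smul_left]
    refine (congrArg (fun α : Alt F20 1 => α ![v]) (map_sum _ _ _)).trans ?_
    rw [ContinuousAlternatingMap.sum_apply]
    simp only [map_smul]
    rfl
  rw [← h1, hG.sum_gFrame_smul_weylUp hp, wedge_neg_left]
  exact congrArg (fun α : Alt F20 1 => α ![v]) (map_neg _ _)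

end WeylSymmetry

/-! ### Ξ on the dilation generator, and the vanishing of the Weyl tensor -/

section NotHorizontal

variable {G : E4 → Matrix (Fin 4) (Fin 4) ℝ} {D : Set E4}

theorem omegaMat_congr {p : F20} {v w : F20} (h : v.1 = w.1) (hp : p ∈ framesOver D)
    (I : Fin 3 → Fin 4) : omegaMat G p I v = omegaMat G p I w := by
  have hv : IsVertical p (v - w) := (isVertical_iff hp _).2 (by
    rw [Prod.fst_sub, h, sub_self])
  have h0 := omegaMat_of_isVertical (G := G) hv I
  ext d e
  have h1 := congrFun (congrFun h0 d) e
  rw [omegaMat_eq] at h1 ⊢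
  rw [omegaMat_eq]
  have h2 : ∀ α : Alt F20 1, α ![v - w] = α ![v] - α ![w] := fun α => by
    have := α.toAlternatingMap.map_update_sub ![v] 0 v w
    have e1 : ∀ x : F20, Function.update ![v] 0 x = ![x] := fun x => by
      ext i : 1; fin_cases i; rfl
    rw [e1, e1, e1] at this
    exact this
  rw [h2] at h1
  exact sub_eq_zero.1 h1

/-- Equivariance under t·1: the three lower indices contribute t³, the two upper ones t⁻², and the
sign of the determinant t⁴ is positive. -/
theorem IsLorentzOn.omegaMat_scale (hG : IsLorentzOn G D) {p : F20} (hp : p ∈ framesOver D)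
    {t : ℝ} (ht : 0 < t) (I : Fin 3 → Fin 4) (w : F20) :
    omegaMat G (p.1, t • p.2) I w = t • omegaMat G p I w := by
  set h : Matrix (Fin 4) (Fin 4) ℝ := t • 1 with hdef
  have hdet : h.det = t ^ 4 := by
    rw [hdef, Matrix.det_smul, Matrix.det_one, mul_one, Fintype.card_fin]
  have hh : h.det ≠ 0 := by rw [hdet]; positivity
  have hs : rsign h.det = 1 := by
    rw [rsign_eq hh, hdet, abs_of_pos (by positivity)]
    exact inv_mul_cancel₀ (by positivity)
  have hR : ∀ q : F20, rightAct h q = (q.1, t • q.2) := by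
    intro q
    refine Prod.ext rfl ?_
    funext i a
    change ∑ b, q.2 i b * h b a = t * q.2 i a
    rw [Finset.sum_eq_single a]
    · rw [hdef, Matrix.smul_apply, Matrix.one_apply_eq, smul_eq_mul]; ring
    · intro b _ hb
      rw [hdef, Matrix.smul_apply, Matrix.one_apply_ne hb, smul_zero, mul_zero]
    · simp
  have hinv : h⁻¹ = t⁻¹ • 1 := by
    refine Matrix.inv_eq_left_inv ?_
    rw [hdef, Matrix.smul_mul, Matrix.mul_smul, Matrix.one_mul, smul_smul,
      inv_mul_cancel₀ ht.ne', one_smul]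
  have h1 := hG.omegaMat_rightAct hp hh I (w.1, t⁻¹ • w.2)
  rw [omegaMat_congr (v := rightAct h (w.1, t⁻¹ • w.2)) (w := w) rfl (rightAct_mem hp hh), hR,
    hs, one_smul] at h1
  rw [h1, Finset.sum_eq_single I]
  · rw [omegaMat_congr (v := (w.1, t⁻¹ • w.2)) (w := w) rfl hp, hinv]
    simp only [Fin.prod_univ_three, hdef, Matrix.smul_apply, Matrix.one_apply_eq, smul_eq_mul,
      mul_one, Matrix.transpose_smul, Matrix.transpose_one, Matrix.smul_mul, Matrix.mul_smul,
      Matrix.one_mul, smul_smul]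
    congr 1
    field_simp
  · intro J _ hJ
    obtain ⟨k, hk⟩ := Function.ne_iff.1 hJ
    rw [Finset.prod_eq_zero (Finset.mem_univ k), zero_smul]
    rw [hdef, Matrix.smul_apply, Matrix.one_apply_ne hk, smul_zero]
  · simp

/-- Euler's relation for a function homogeneous of degree one: the homogeneity is differentiated at
t = 1 along t ↦ (y, tA). -/
theorem IsLorentzOn.matDeriv_omegaMat_scale (hG : IsLorentzOn G D) {p : F20}
    (hp : p ∈ framesOver D) (I : Fin 3 → Fin 4) (w : F20) :
    matDeriv (fun q => omegaMat G q I w) p (0, p.2) = omegaMat G p I w := by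
  ext d e
  rw [matDeriv, Matrix.of_apply]
  have hγ : HasDerivAt (fun t : ℝ => ((p.1, t • p.2) : F20)) ((0, p.2) : F20) 1 := by
    refine (hasDerivAt_const (1 : ℝ) p.1).prodMk ?_
    have := (hasDerivAt_id (1 : ℝ)).smul_const p.2
    rwa [one_smul] at this
  have hp1 : ((p.1, (1 : ℝ) • p.2) : F20) = p := by rw [one_smul]
  have hf : HasFDerivAt (fun q => omegaMat G q I w d e)
      (fderiv ℝ (fun q => omegaMat G q I w d e) p) ((p.1, (1 : ℝ) • p.2) : F20) := by
    rw [hp1]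
    exact (hG.differentiableAt_omegaMat hp I w d e).hasFDerivAt
  have h1 := hf.comp_hasDerivAt (1 : ℝ) hγ
  have h2 : HasDerivAt (fun t : ℝ => t * omegaMat G p I w d e) (omegaMat G p I w d e) 1 := by
    have := (hasDerivAt_id (1 : ℝ)).mul_const (omegaMat G p I w d e)
    rwa [one_mul] at this
  have h3 : (fun t : ℝ => t * omegaMat G p I w d e) =ᶠ[nhds 1]
      ((fun q => omegaMat G q I w d e) ∘ fun t : ℝ => ((p.1, t • p.2) : F20)) := by
    filter_upwards [lt_mem_nhds (zero_lt_one' ℝ)] with t ht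
    rw [Function.comp_apply, hG.omegaMat_scale hp ht I w, Matrix.smul_apply, smul_eq_mul]
  exact h1.unique (h2.congr_of_eventuallyEq h3.symm)

theorem connMat_scale {p : F20} (hp : p ∈ framesOver D) : connMat G p (0, p.2) = 1 := by
  have h : gam G p.1 0 = 0 := by
    ext m j
    simp [gam]
  rw [connMat_eq]
  change _ * (frameMat p + gam G p.1 0 * frameMat p) = 1
  rw [h, Matrix.zero_mul, add_zero, frameMat_inv_mul hp]

/-- One Ω comes from Euler's relation and one from the connection form, which takes the value 1 on
the generator. The other two terms contain Ω evaluated on a vertical vector. -/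
theorem IsLorentzOn.xiMat_scale (hG : IsLorentzOn G D) {p : F20} (hp : p ∈ framesOver D)
    (I : Fin 3 → Fin 4) (w : F20) :
    xiMat G p I (0, p.2) w = (2 : ℝ) • omegaMat G p I w := by
  have h0 : ∀ q ∈ framesOver D, omegaMat G q I (0, p.2) = 0 := fun q hq =>
    omegaMat_of_isVertical ((isVertical_iff hq _).2 rfl) I
  have h1 : matDeriv (fun q => omegaMat G q I (0, p.2)) p w = 0 := by
    have : (fun q => omegaMat G q I (0, p.2)) =ᶠ[nhds p] fun _ => 0 := by
      filter_upwards [hG.isOpen_framesOver.mem_nhds hp] with q hq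
      exact h0 q hq
    rw [matDeriv_congr this]
    ext a b
    simp [matDeriv]
  rw [hG.xiMat_eq hp, hG.matDeriv_omegaMat_scale hp, h1, connMat_scale hp, h0 p hp,
    Matrix.one_mul, Matrix.mul_zero, sub_zero, two_smul]

/-- A trace of Ω isolates *(𝒲_c^d ∧ θ_a); injectivity of the dual gives 𝒲_c^d ∧ θ_a = 0 on
horizontal vectors for every a, and one more trace removes θ_a. -/
theorem IsLorentzOn.weyl_horiz_eq_zero (hG : IsLorentzOn G D) {p : F20} (hp : p ∈ framesOver D)
    (hΩ : ∀ I w, omegaMat G p I w = 0) (c d x y : Fin 4) :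
    weyl G c d p ![horiz G p x, horiz G p y] = 0 := by
  have hu : IsUnit (gFrame G p).det := (hG.det_gFrame_neg hp).ne.isUnit
  have hY : ∀ a v, dualWeyl G p c a v d = 0 := by
    intro a v
    have h1 : ∀ b, (1 / 2) * (gFrame G p b c * dualWeylUp G p a v d b)
        + dualWeyl G p c a v d + dualWeyl G p b a v d * kron c b = 0 := fun b => by
      have := congrFun (congrFun (hΩ ![a, b, c] v) d) b
      rw [omegaMat_apply] at this
      have e : kron b b = 1 := if_pos rfl
      rw [e, kron_comm, Matrix.zero_apply] at this
      linear_combination this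
    -- The trace over e = b yields -1/2 + 4 + 1 = 9/2 times the dual; the first coefficient uses the
    -- skewness of 𝒲^{db}.
    have h2 := Finset.sum_eq_zero fun b (_ : b ∈ (Finset.univ : Finset (Fin 4))) => h1 b
    rw [Finset.sum_add_distrib, Finset.sum_add_distrib, ← Finset.mul_sum,
      hG.sum_gFrame_mul_dualWeylUp hp, sum_mul_kron c fun b => dualWeyl G p b a v d,
      Finset.sum_const, Finset.card_univ, Fintype.card_fin, nsmul_eq_mul] at h2
    push_cast at h2
    linarith
  have hZ : ∀ a x y z, (wedge (weyl G c d p) (thetaLow G a p) : Alt F20 3)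
      ![horiz G p x, horiz G p y, horiz G p z] = 0 := by
    intro a
    refine eq_zero_of_dualCoef_eq_zero (hG.det_gFrame_neg hp) (hG.gFrame_transpose hp)
      (fun x y z => map_swap_three_fst _ _ _ _) (fun x y z => map_swap_three_snd _ _ _ _)
      fun k => ?_
    have := hY a (horiz G p k)
    rw [dualWeyl, hodge, hodgeThree_apply] at this
    simp only [theta_horiz hp, mul_ite, mul_one, mul_zero, Finset.sum_ite_eq',
      Finset.mem_univ, if_true] at this
    exact this
  have hc : ∀ z y, ∑ a, gInv G p z a * gFrame G p a y = kron z y := by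
    intro z y
    have := congrFun (congrFun (Matrix.nonsing_inv_mul _ hu) z) y
    rw [Matrix.mul_apply, Matrix.one_apply] at this
    rw [kron, ← this]
    rfl
  set w : Fin 4 → Fin 4 → ℝ := fun x y => weyl G c d p ![horiz G p x, horiz G p y] with hw
  have h3 : ∀ z, w x y * kron z z - w x z * kron y z + w y z * kron x z = 0 := by
    intro z
    have h4 : ∀ a, w x y * gFrame G p a z - w x z * gFrame G p a y +
        w y z * gFrame G p a x = 0 := by
      intro a
      have := hZ a x y z
      have e := wedge_two_one (weyl G c d p) (thetaLow G a p) (horiz G p x) (horiz G p y)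
        (horiz G p z)
      rw [thetaLow_horiz hp, thetaLow_horiz hp, thetaLow_horiz hp] at e
      exact e.symm.trans this
    rw [kron_comm y z, kron_comm x z, ← hc, ← hc, ← hc, Finset.mul_sum, Finset.mul_sum,
      Finset.mul_sum, ← Finset.sum_sub_distrib, ← Finset.sum_add_distrib]
    refine Finset.sum_eq_zero fun a _ => ?_
    linear_combination gInv G p z a * h4 a
  -- The trace gives 4 - 1 - 1 = 2 times the component.
  have h5 := Finset.sum_eq_zero fun z (_ : z ∈ (Finset.univ : Finset (Fin 4))) => h3 z
  have hsw : w y x = -w x y := map_swap_two (weyl G c d p) _ _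
  have hk : ∀ z, kron z z = 1 := fun z => if_pos rfl
  simp only [hk] at h5
  rw [Finset.sum_add_distrib, Finset.sum_sub_distrib, sum_mul_kron, sum_mul_kron, Finset.sum_const,
    Finset.card_univ, Fintype.card_fin, nsmul_eq_mul, hsw] at h5
  push_cast at h5
  change w x y = 0
  linarith

theorem IsLorentzOn.weylTensor_eq_zero_of_isHorizontalAt_xi (hG : IsLorentzOn G D) {p : F20}
    (hp : p ∈ framesOver D) (hΞ : ∀ d e a b c, IsHorizontalAt p (xi G d e a b c p))
    (a b c d : Fin 4) : weylTensor G a b c d p = 0 := by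
  have hΩ : ∀ I w, omegaMat G p I w = 0 := by
    intro I w
    have h1 : xiMat G p I (0, p.2) w = 0 := by
      ext d e
      rw [xiMat, Matrix.of_apply, Matrix.zero_apply]
      have h2 : IsVertical p ((0, p.2) : F20) := (isVertical_iff hp _).2 rfl
      have h3 : IsVertical p ((![((0, p.2) : F20), w] : Fin 2 → F20) 0) := by
        rwa [Matrix.cons_val_zero]
      generalize I 0 = a, I 1 = b, I 2 = c
      exact hΞ d e a b c ![(0, p.2), w] ⟨0, h3⟩
    rw [hG.xiMat_scale hp] at h1
    exact (smul_eq_zero.1 h1).resolve_left two_ne_zero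
  rw [weylTensor, weylLow_apply]
  exact Finset.sum_eq_zero fun x _ => by rw [hG.weyl_horiz_eq_zero hp hΩ, mul_zero]

end NotHorizontal

/-! ### Algebraic symmetries of the Weyl tensor -/

section WeylTensor

variable {G : E4 → Matrix (Fin 4) (Fin 4) ℝ} {D : Set E4}

theorem weylTensor_swap_fst (x y a b : Fin 4) (p : F20) :
    weylTensor G y x a b p = -weylTensor G x y a b p :=
  map_swap_two _ _ _

theorem IsLorentzOn.weylTensor_swap_snd (hG : IsLorentzOn G D) {p : F20} (hp : p ∈ framesOver D)
    (x y a b : Fin 4) : weylTensor G x y b a p = -weylTensor G x y a b p := by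
  rw [weylTensor, weylTensor, hG.weylLow_skew hp b a]
  rfl

variable (G) in
/-- The Riemann tensor `R_{cdab}`. -/
def riemLow (c d a b : Fin 4) (p : F20) : ℝ := curvLow G a b p ![horiz G p c, horiz G p d]

theorem IsLorentzOn.weylTensor_eq (hG : IsLorentzOn G D) {p : F20} (hp : p ∈ framesOver D)
    (c d a b : Fin 4) : weylTensor G c d a b p = riemLow G c d a b p
      + gFrame G p b c * schouten G d a p - gFrame G p b d * schouten G c a p
      - gFrame G p a c * schouten G d b p + gFrame G p a d * schouten G c b p := by
  have h1 := congrArg (fun α : Alt F20 2 => α ![horiz G p c, horiz G p d])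
    (curvLow_eq a b p hG hp)
  have e : ∀ a b, (wedge (thetaLow G b p) (schoutenForm G a p) : Alt F20 2)
      ![horiz G p c, horiz G p d] =
      gFrame G p b c * schouten G d a p - gFrame G p b d * schouten G c a p := by
    intro a b
    rw [← thetaLow_horiz hp, ← thetaLow_horiz hp, ← schoutenForm_horiz hp, ← schoutenForm_horiz hp]
    exact wedge_one_one _ _ _ _
  simp only [ContinuousAlternatingMap.add_apply, ContinuousAlternatingMap.sub_apply] at h1
  rw [e, e] at h1
  rw [weylTensor, riemLow]
  linear_combination -h1

theorem IsLorentzOn.curvMat_bianchi (hG : IsLorentzOn G D) {p : F20} (hp : p ∈ framesOver D)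
    (c d a b : Fin 4) : curvMat G p (horiz G p c) (horiz G p d) b a
      + curvMat G p (horiz G p d) (horiz G p a) b c
      + curvMat G p (horiz G p a) (horiz G p c) b d = 0 := by
  have e : ∀ c d a, curvMat G p (horiz G p c) (horiz G p d) b a = ((frameMat p)⁻¹.mulVec
      ((baseCurv G p.1 (horiz G p c).1 (horiz G p d).1).mulVec (horiz G p a).1)) b := by
    intro c d a
    rw [hG.curvMat_eq hp, Matrix.mulVec_mulVec, Matrix.mul_apply]
    rfl
  rw [e, e, e, ← Pi.add_apply, ← Pi.add_apply, ← Matrix.mulVec_add, ← Matrix.mulVec_add,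
    hG.baseCurv_bianchi hp.1, Matrix.mulVec_zero]
  rfl

theorem IsLorentzOn.riemLow_cyclic (hG : IsLorentzOn G D) {p : F20} (hp : p ∈ framesOver D)
    (c d a b : Fin 4) :
    riemLow G c d a b p + riemLow G d a c b p + riemLow G a c d b p = 0 := by
  simp only [riemLow, curvLow_apply, Matrix.mul_apply, ← Finset.sum_add_distrib, ← mul_add]
  exact Finset.sum_eq_zero fun x _ => by rw [hG.curvMat_bianchi hp, mul_zero]

theorem IsLorentzOn.schouten_symm (hG : IsLorentzOn G D) {p : F20} (hp : p ∈ framesOver D)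
    (a b : Fin 4) : schouten G a b p = schouten G b a p :=
  congrFun (congrFun (hG.schoutenMat_transpose hp) b) a

theorem IsLorentzOn.gInv_symm (hG : IsLorentzOn G D) {p : F20} (hp : p ∈ framesOver D)
    (a b : Fin 4) : gInv G p a b = gInv G p b a := by
  have : (gInv G p).transpose = gInv G p := by
    rw [gInv, Matrix.transpose_nonsing_inv, hG.gFrame_transpose hp]
  exact congrFun (congrFun this b) a

theorem IsLorentzOn.sum_gInv_mul_gFrame (hG : IsLorentzOn G D) {p : F20} (hp : p ∈ framesOver D)
    (a b : Fin 4) : ∑ c, gInv G p a c * gFrame G p c b = kron a b := by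
  have := congrFun (congrFun (Matrix.nonsing_inv_mul _ (hG.det_gFrame_neg hp).ne.isUnit) a) b
  rw [Matrix.mul_apply, Matrix.one_apply] at this
  exact this

/-- The Riemann tensor satisfies the identity, and the Schouten terms cancel in the cyclic sum
because g and S are symmetric. -/
theorem IsLorentzOn.weylTensor_cyclic (hG : IsLorentzOn G D) {p : F20} (hp : p ∈ framesOver D)
    (c d a b : Fin 4) :
    weylTensor G c d a b p + weylTensor G d a c b p + weylTensor G a c d b p = 0 := by
  rw [hG.weylTensor_eq hp, hG.weylTensor_eq hp, hG.weylTensor_eq hp,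
    hG.schouten_symm hp d a, hG.schouten_symm hp c a, hG.schouten_symm hp d c,
    hG.gFrame_apply_symm hp c a, hG.gFrame_apply_symm hp d a, hG.gFrame_apply_symm hp d c]
  linear_combination hG.riemLow_cyclic hp c d a b

/-- The classical consequence of skewness in each pair: four instances of the cyclic identity are
combined linearly. -/
theorem IsLorentzOn.weylTensor_pair (hG : IsLorentzOn G D) {p : F20} (hp : p ∈ framesOver D)
    (c d a b : Fin 4) : weylTensor G a b c d p = weylTensor G c d a b p := by
  have s1 := fun x y a b => weylTensor_swap_fst (G := G) x y a b p
  have s2 := fun x y a b => hG.weylTensor_swap_snd hp x y a b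
  have cy := fun c d a b => hG.weylTensor_cyclic hp c d a b
  linarith [cy c d a b, cy d a b c, cy a b c d, cy b c d a, s1 c d a b, s1 d a c b, s1 a c d b,
    s2 c d a b, s2 d a b c, s2 a b c d, s2 b c d a, s2 a b d c, s1 a b d c, s1 b d a c, s1 d a b c,
    s2 b d a c, s1 b c a d, s2 b c a d, s1 c a b d, s2 c a b d, s1 c d b a, s2 d b a c, s1 d b c a,
    s2 d b c a, s1 b c d a, s2 a c d b, s1 d b a c, s2 b d c a, s1 b d c a, s2 c a d b, s1 c a d b,
    s2 d a c b, s1 a b c d, s2 d b c a, s1 a c b d, s2 a c b d, s1 a d b c, s2 a d b c]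

/-- Here the dimension enters: (1/2)(R - 4R/6) = R/6. -/
theorem IsLorentzOn.sum_gInv_mul_schouten (hG : IsLorentzOn G D) {p : F20}
    (hp : p ∈ framesOver D) :
    ∑ a, ∑ b, gInv G p a b * schouten G a b p = 1 / 6 * scalarCurv G p := by
  have h1 : ∑ a, ∑ b, gInv G p a b * gFrame G p a b = 4 := by
    have : ∀ a, ∑ b, gInv G p a b * gFrame G p a b = 1 := fun a => by
      have := hG.sum_gInv_mul_gFrame hp a a
      rw [kron, if_pos rfl] at this
      rw [← this]
      exact Finset.sum_congr rfl fun b _ => by rw [hG.gFrame_apply_symm hp a b]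
    simp [this]
  have h2 : ∀ a b, gInv G p a b * schouten G a b p = 1 / 2 * (gInv G p a b * ricci G a b p)
      - 1 / 12 * scalarCurv G p * (gInv G p a b * gFrame G p a b) := fun a b => by
    rw [schouten]; ring
  simp only [h2, Finset.sum_sub_distrib, ← Finset.mul_sum]
  rw [h1, ← scalarCurv]
  ring

/-- The trace equals Ric + (1 - 4 + 1) S - g tr S with tr S = R/6, which vanishes by the
normalization of the Schouten tensor. -/
theorem IsLorentzOn.weylTensor_trace (hG : IsLorentzOn G D) {p : F20} (hp : p ∈ framesOver D)
    (c a : Fin 4) : ∑ d, ∑ b, gInv G p d b * weylTensor G c d a b p = 0 := by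
  have hR : ∑ d, ∑ b, gInv G p d b * riemLow G c d a b p = ricci G c a p := by
    rw [ricci]
    refine Finset.sum_congr rfl fun d _ => ?_
    simp only [riemLow, curvLow_apply, Matrix.mul_apply, Finset.mul_sum]
    rw [Finset.sum_comm]
    simp only [← mul_assoc, ← Finset.sum_mul, hG.sum_gInv_mul_gFrame hp, sum_kron_mul]
    rfl
  have e : ∀ d b, gInv G p d b * weylTensor G c d a b p = gInv G p d b * riemLow G c d a b p
      + (gInv G p d b * gFrame G p b c) * schouten G d a p
      - (gInv G p d b * gFrame G p b d) * schouten G c a p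
      - gFrame G p a c * (gInv G p d b * schouten G d b p)
      + (gInv G p b d * gFrame G p d a) * schouten G c b p := fun d b => by
    rw [hG.weylTensor_eq hp, hG.gInv_symm hp b d, hG.gFrame_apply_symm hp d a]
    ring
  have h4 : ∑ d, ∑ b, (gInv G p b d * gFrame G p d a) * schouten G c b p = schouten G c a p := by
    rw [Finset.sum_comm]
    simp only [← Finset.sum_mul, hG.sum_gInv_mul_gFrame hp, kron_comm _ a, sum_kron_mul]
  have h5 : ∑ d, kron d d * schouten G c a p = 4 * schouten G c a p := by
    simp [kron]
  simp only [e, Finset.sum_add_distrib, Finset.sum_sub_distrib, hR, h4]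
  simp only [← Finset.sum_mul, ← Finset.mul_sum, hG.sum_gInv_mul_gFrame hp,
    hG.sum_gInv_mul_schouten hp]
  simp only [kron_comm _ c, sum_kron_mul]
  rw [Finset.sum_mul, h5, schouten, hG.gFrame_apply_symm hp a c]
  ring

end WeylTensor

/-! ### Symmetry and traces of the tensor K -/

section Contractions

variable {G : E4 → Matrix (Fin 4) (Fin 4) ℝ} {D : Set E4}

variable (G) in
/-- The contraction `S^{de} W_{xdye}`. -/
def schoutenWeyl (x y : Fin 4) (p : F20) : ℝ :=
  ∑ d, ∑ e, schoutenUp G d e p * weylTensor G x d y e p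

theorem kTensor_eq (j a b c : Fin 4) (p : F20) : kTensor G j a b c p =
    ∑ d, schoutenMix G c d p * weylTensor G a b j d p
    + ∑ d, schoutenMix G b d p * weylTensor G a c j d p
    + ∑ d, schoutenMix G a d p * weylTensor G b d c j p
    + ∑ d, schoutenMix G a d p * weylTensor G b j c d p
    - gFrame G p b c * schoutenWeyl G a j p - 2 * gFrame G p a j * schoutenWeyl G b c p
    + gFrame G p a c * schoutenWeyl G b j p + gFrame G p a b * schoutenWeyl G c j p := by
  have e : ∀ d e, schoutenUp G d e p *
    (-(gFrame G p b c * weylTensor G a d j e p)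
      - 2 * gFrame G p a j * weylTensor G b d c e p
      + gFrame G p a c * weylTensor G b d j e p
      + gFrame G p a b * weylTensor G c d j e p) =
    -(gFrame G p b c * (schoutenUp G d e p * weylTensor G a d j e p))
      - 2 * gFrame G p a j * (schoutenUp G d e p * weylTensor G b d c e p)
      + gFrame G p a c * (schoutenUp G d e p * weylTensor G b d j e p)
      + gFrame G p a b * (schoutenUp G d e p * weylTensor G c d j e p) := fun d e => by ring
  rw [kTensor]
  simp only [e, Finset.sum_add_distrib, Finset.sum_sub_distrib, Finset.sum_neg_distrib,
    ← Finset.mul_sum, schoutenWeyl]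
  ring

theorem IsLorentzOn.schoutenUp_symm (hG : IsLorentzOn G D) {p : F20} (hp : p ∈ framesOver D)
    (a b : Fin 4) : schoutenUp G a b p = schoutenUp G b a p := by
  have e : ∀ a b, schoutenUp G a b p =
      ∑ c, ∑ f, gInv G p a c * (schouten G c f p * gInv G p f b) := fun a b => by
    simp only [schoutenUp, schoutenMix, Finset.mul_sum]
  rw [e, e, Finset.sum_comm]
  refine Finset.sum_congr rfl fun c _ => Finset.sum_congr rfl fun f _ => ?_
  rw [hG.schouten_symm hp f c, hG.gInv_symm hp a f, hG.gInv_symm hp c b]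
  ring

theorem IsLorentzOn.schoutenWeyl_symm (hG : IsLorentzOn G D) {p : F20} (hp : p ∈ framesOver D)
    (x y : Fin 4) : schoutenWeyl G x y p = schoutenWeyl G y x p := by
  rw [schoutenWeyl, Finset.sum_comm]
  refine Finset.sum_congr rfl fun c _ => Finset.sum_congr rfl fun f _ => ?_
  rw [hG.schoutenUp_symm hp f c, hG.weylTensor_pair hp y c x f]

/-- Exchanging b and c permutes the first two terms, the next two by pair symmetry, and the last
two. The remaining terms are symmetric since `schoutenWeyl` is. -/
theorem IsLorentzOn.kTensor_symm (hG : IsLorentzOn G D) {p : F20} (hp : p ∈ framesOver D)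
    (j a b c : Fin 4) : kTensor G j a b c p = kTensor G j a c b p := by
  have h1 : ∀ d, weylTensor G b d c j p = weylTensor G c j b d p := fun d =>
    hG.weylTensor_pair hp _ _ _ _
  have h2 : ∀ d, weylTensor G b j c d p = weylTensor G c d b j p := fun d =>
    hG.weylTensor_pair hp _ _ _ _
  rw [kTensor_eq, kTensor_eq, hG.schoutenWeyl_symm hp c b, hG.gFrame_apply_symm hp c b]
  simp only [h1, h2]
  ring

theorem sum_gInv_mul_sum_schoutenMix (p : F20) (F : Fin 4 → Fin 4 → ℝ) :
    ∑ a, ∑ b, gInv G p a b * ∑ d, schoutenMix G b d p * F a d =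
      ∑ a, ∑ d, schoutenUp G a d p * F a d := by
  refine Finset.sum_congr rfl fun a _ => ?_
  simp only [Finset.mul_sum, schoutenUp, Finset.sum_mul]
  rw [Finset.sum_comm]
  simp only [mul_assoc]

theorem sum_mul_eq_zero_of_symm_of_skew {A B : Fin 4 → Fin 4 → ℝ} (hA : ∀ a b, A a b = A b a)
    (hB : ∀ a b, B b a = -B a b) : ∑ a, ∑ b, A a b * B a b = 0 := by
  have h : ∑ a, ∑ b, A a b * B a b = -∑ a, ∑ b, A a b * B a b := by
    conv_lhs => rw [Finset.sum_comm]
    rw [← Finset.sum_neg_distrib]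
    refine Finset.sum_congr rfl fun a _ => ?_
    rw [← Finset.sum_neg_distrib]
    refine Finset.sum_congr rfl fun b _ => ?_
    rw [hA b a, hB a b]
    ring
  linarith

theorem IsLorentzOn.sum_gInv_mul_gFrame_mul (hG : IsLorentzOn G D) {p : F20}
    (hp : p ∈ framesOver D) (c : Fin 4) (F : Fin 4 → ℝ) :
    ∑ a, ∑ b, gInv G p a b * (gFrame G p b c * F a) = F c := by
  simp only [← mul_assoc, ← Finset.sum_mul, hG.sum_gInv_mul_gFrame hp, kron_comm _ c,
    sum_kron_mul]

theorem IsLorentzOn.sum_gInv_mul_gFrame_mul' (hG : IsLorentzOn G D) {p : F20}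
    (hp : p ∈ framesOver D) (c : Fin 4) (F : Fin 4 → ℝ) :
    ∑ a, ∑ b, gInv G p a b * (gFrame G p a c * F b) = F c := by
  rw [Finset.sum_comm, ← hG.sum_gInv_mul_gFrame_mul hp c F]
  simp only [hG.gInv_symm hp]

theorem IsLorentzOn.sum_gInv_mul_gFrame_self (hG : IsLorentzOn G D) {p : F20}
    (hp : p ∈ framesOver D) : ∑ a, ∑ b, gInv G p a b * gFrame G p a b = 4 := by
  have : ∀ a, ∑ b, gInv G p a b * gFrame G p a b = 1 := fun a => by
    have := hG.sum_gInv_mul_gFrame hp a a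
    rw [kron, if_pos rfl] at this
    rw [← this]
    exact Finset.sum_congr rfl fun b _ => by rw [hG.gFrame_apply_symm hp a b]
  simp [this]

/-- Every term contracts to a multiple of X = S^{de}W_{cdje}; in order the multiples are 0, -1, 0,
-1, -1, -2, 1, 4, with sum zero. -/
theorem IsLorentzOn.kTensor_trace_fst (hG : IsLorentzOn G D) {p : F20} (hp : p ∈ framesOver D)
    (j c : Fin 4) : ∑ a, ∑ b, gInv G p a b * kTensor G j a b c p = 0 := by
  have hs := hG.gInv_symm hp
  have s1 := fun x y a b => weylTensor_swap_fst (G := G) x y a b p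
  have t1 : ∑ a, ∑ b, gInv G p a b * (∑ d, schoutenMix G c d p * weylTensor G a b j d p) = 0 :=
    sum_mul_eq_zero_of_symm_of_skew hs fun a b => by
      simp only [s1 a b, mul_neg, Finset.sum_neg_distrib]
  have t2 : ∑ a, ∑ b, gInv G p a b * (∑ d, schoutenMix G b d p * weylTensor G a c j d p) =
      -schoutenWeyl G c j p := by
    rw [sum_gInv_mul_sum_schoutenMix, schoutenWeyl]
    simp only [s1 c, mul_neg, Finset.sum_neg_distrib]
  have hsw : ∀ F : Fin 4 → Fin 4 → ℝ, ∑ a, ∑ b, gInv G p a b * (∑ d, schoutenMix G a d p * F b d) =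
      ∑ a, ∑ d, schoutenUp G a d p * F a d := by
    intro F
    rw [Finset.sum_comm, ← sum_gInv_mul_sum_schoutenMix]
    simp only [hs]
  have t3 : ∑ a, ∑ b, gInv G p a b * (∑ d, schoutenMix G a d p * weylTensor G b d c j p) = 0 := by
    rw [hsw]
    exact sum_mul_eq_zero_of_symm_of_skew (hG.schoutenUp_symm hp) fun a b => s1 _ _ _ _
  have t4 : ∑ a, ∑ b, gInv G p a b * (∑ d, schoutenMix G a d p * weylTensor G b j c d p) =
      -schoutenWeyl G c j p := by
    rw [hsw, hG.schoutenWeyl_symm hp, schoutenWeyl]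
    simp only [s1 j, mul_neg, Finset.sum_neg_distrib]
  have t5 := hG.sum_gInv_mul_gFrame_mul hp c fun a => schoutenWeyl G a j p
  have t6 := hG.sum_gInv_mul_gFrame_mul' hp j fun b => schoutenWeyl G b c p
  have t7 := hG.sum_gInv_mul_gFrame_mul' hp c fun b => schoutenWeyl G b j p
  have t8 : ∑ a, ∑ b, gInv G p a b * gFrame G p a b * schoutenWeyl G c j p =
      4 * schoutenWeyl G c j p := by
    simp only [← Finset.sum_mul, hG.sum_gInv_mul_gFrame_self hp]
  have e : ∀ a b, gInv G p a b * kTensor G j a b c p =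
      gInv G p a b * (∑ d, schoutenMix G c d p * weylTensor G a b j d p)
      + gInv G p a b * (∑ d, schoutenMix G b d p * weylTensor G a c j d p)
      + gInv G p a b * (∑ d, schoutenMix G a d p * weylTensor G b d c j p)
      + gInv G p a b * (∑ d, schoutenMix G a d p * weylTensor G b j c d p)
      - gInv G p a b * (gFrame G p b c * schoutenWeyl G a j p)
      - 2 * (gInv G p a b * (gFrame G p a j * schoutenWeyl G b c p))
      + gInv G p a b * (gFrame G p a c * schoutenWeyl G b j p)
      + gInv G p a b * gFrame G p a b * schoutenWeyl G c j p := fun a b => by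
    rw [kTensor_eq]; ring
  simp only [e, Finset.sum_add_distrib, Finset.sum_sub_distrib, ← Finset.mul_sum (a := (2 : ℝ))]
  rw [t1, t2, t3, t4, t5, t6, t7, t8, hG.schoutenWeyl_symm hp j c]
  ring

theorem IsLorentzOn.weylTensor_trace_odd (hG : IsLorentzOn G D) {p : F20} (hp : p ∈ framesOver D)
    (d j : Fin 4) : ∑ b, ∑ c, gInv G p b c * weylTensor G b d c j p = 0 := by
  rw [← hG.weylTensor_trace hp d j]
  refine Finset.sum_congr rfl fun b _ => Finset.sum_congr rfl fun c _ => ?_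
  rw [weylTensor_swap_fst d b c j p, hG.weylTensor_swap_snd hp d b j c, neg_neg]

/-- The multiples of S^{de}W_{adje} are 1, 1, 0, 0, -4, 0, 1, 1; the three zeros are traces of the
Weyl tensor. -/
theorem IsLorentzOn.kTensor_trace_snd (hG : IsLorentzOn G D) {p : F20} (hp : p ∈ framesOver D)
    (j a : Fin 4) : ∑ b, ∑ c, gInv G p b c * kTensor G j a b c p = 0 := by
  have hs := hG.gInv_symm hp
  have hcomm : ∀ F : Fin 4 → Fin 4 → Fin 4 → ℝ,
      ∑ b, ∑ c, gInv G p b c * (∑ d, schoutenMix G a d p * F b c d) =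
        ∑ d, schoutenMix G a d p * ∑ b, ∑ c, gInv G p b c * F b c d := by
    intro F
    simp only [Finset.mul_sum]
    rw [Finset.sum_comm' (t' := Finset.univ) (s' := fun _ => Finset.univ) (by simp)]
    rw [Finset.sum_comm]
    conv_rhs => rw [Finset.sum_comm]
    refine Finset.sum_congr rfl fun b _ => ?_
    rw [Finset.sum_comm]
    refine Finset.sum_congr rfl fun c _ => Finset.sum_congr rfl fun d _ => ?_
    ring
  have t2 : ∑ b, ∑ c, gInv G p b c * (∑ d, schoutenMix G c d p * weylTensor G a b j d p) =
      schoutenWeyl G a j p := sum_gInv_mul_sum_schoutenMix p _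
  have t1 : ∑ b, ∑ c, gInv G p b c * (∑ d, schoutenMix G b d p * weylTensor G a c j d p) =
      schoutenWeyl G a j p := by
    rw [Finset.sum_comm, ← t2]
    simp only [hs]
  have t3 : ∑ b, ∑ c, gInv G p b c * (∑ d, schoutenMix G a d p * weylTensor G b d c j p) = 0 := by
    rw [hcomm]
    exact Finset.sum_eq_zero fun d _ => by rw [hG.weylTensor_trace_odd hp, mul_zero]
  have t4 : ∑ b, ∑ c, gInv G p b c * (∑ d, schoutenMix G a d p * weylTensor G b j c d p) = 0 := by
    rw [hcomm]
    exact Finset.sum_eq_zero fun d _ => by rw [hG.weylTensor_trace_odd hp, mul_zero]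
  have t5 : ∑ b, ∑ c, gInv G p b c * gFrame G p b c * schoutenWeyl G a j p =
      4 * schoutenWeyl G a j p := by
    simp only [← Finset.sum_mul, hG.sum_gInv_mul_gFrame_self hp]
  have t6 : ∑ b, ∑ c, gInv G p b c * schoutenWeyl G b c p = 0 := by
    have h : ∑ b, ∑ c, gInv G p b c * schoutenWeyl G b c p = ∑ d, ∑ e, schoutenUp G d e p *
        ∑ b, ∑ c, gInv G p b c * weylTensor G b d c e p := by
      simp only [schoutenWeyl, Finset.mul_sum]
      refine (Finset.sum_congr rfl fun b _ => Finset.sum_comm).trans ?_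
      rw [Finset.sum_comm]
      refine Finset.sum_congr rfl fun d _ => ?_
      refine (Finset.sum_congr rfl fun b _ => Finset.sum_comm).trans ?_
      rw [Finset.sum_comm]
      refine Finset.sum_congr rfl fun e _ => Finset.sum_congr rfl fun b _ =>
        Finset.sum_congr rfl fun c _ => ?_
      ring
    rw [h]
    exact Finset.sum_eq_zero fun d _ => Finset.sum_eq_zero fun e _ => by
      rw [hG.weylTensor_trace_odd hp, mul_zero]
  have t7 := hG.sum_gInv_mul_gFrame_mul hp a fun b => schoutenWeyl G b j p
  have t8 := hG.sum_gInv_mul_gFrame_mul' hp a fun c => schoutenWeyl G c j p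
  have e : ∀ b c, gInv G p b c * kTensor G j a b c p =
      gInv G p b c * (∑ d, schoutenMix G c d p * weylTensor G a b j d p)
      + gInv G p b c * (∑ d, schoutenMix G b d p * weylTensor G a c j d p)
      + gInv G p b c * (∑ d, schoutenMix G a d p * weylTensor G b d c j p)
      + gInv G p b c * (∑ d, schoutenMix G a d p * weylTensor G b j c d p)
      - gInv G p b c * gFrame G p b c * schoutenWeyl G a j p
      - 2 * gFrame G p a j * (gInv G p b c * schoutenWeyl G b c p)
      + gInv G p b c * (gFrame G p c a * schoutenWeyl G b j p)
      + gInv G p b c * (gFrame G p b a * schoutenWeyl G c j p) := fun b c => by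
    rw [kTensor_eq, hG.gFrame_apply_symm hp c a, hG.gFrame_apply_symm hp b a]; ring
  simp only [e, Finset.sum_add_distrib, Finset.sum_sub_distrib,
    ← Finset.mul_sum (a := 2 * gFrame G p a j)]
  rw [t1, t2, t3, t4, t5, t6, t7, t8]
  ring

end Contractions

/-! ### The dual of 𝒦 -/

section DualK

variable {G : E4 → Matrix (Fin 4) (Fin 4) ℝ} {D : Set E4}

variable (G) in
/-- The components `W_{xyc}{}^e`. -/
def weylMix (x y c e : Fin 4) (p : F20) : ℝ := weyl G c e p ![horiz G p x, horiz G p y]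

variable (G) in
/-- The components `W_{xy}{}^{ed}`. -/
def weylUpUp (x y e d : Fin 4) (p : F20) : ℝ := weylUp G e d p ![horiz G p x, horiz G p y]

variable (G) in
/-- The `3`-form whose Hodge dual is `Ω^{ed}_{abc} - Ω^{de}_{abc}`. -/
def omegaSkewSource (e d a b c : Fin 4) (p : F20) : Alt F20 3 :=
  ((1 / 2) * gFrame G p b c) • (wedge (weylUp G e d p) (thetaLow G a p)
      - wedge (weylUp G d e p) (thetaLow G a p))
  + kron d b • wedge (weyl G c e p) (thetaLow G a p)
  + kron d c • wedge (weyl G b e p) (thetaLow G a p)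
  - kron e b • wedge (weyl G c d p) (thetaLow G a p)
  - kron e c • wedge (weyl G b d p) (thetaLow G a p)

theorem omega_sub_omega (e d a b c : Fin 4) (p : F20) :
    omega G e d a b c p - omega G d e a b c p =
      hodgeThree (gFrame G p) (horiz G p) (fun d => theta d p) (omegaSkewSource G e d a b c p) := by
  change _ = hodgeThreeLin (gFrame G p) (horiz G p) (fun d => theta d p) _
  simp only [omegaSkewSource, map_add, map_sub, map_smul]
  have h : ∀ (μ : Form F20 2) (ν : Form F20 1), hodgeThreeLin (gFrame G p) (horiz G p)
    (fun d => theta d p) (wedge (μ p) (ν p)) = hodge G (fun q => wedge (μ q) (ν q)) p :=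
      fun _ _ => rfl
  rw [h, h, h, h, h, h, omega, omega, smul_sub]
  abel

theorem IsLorentzOn.gInv_mul_gFrame_kron (hG : IsLorentzOn G D) {p : F20} (hp : p ∈ framesOver D)
    (a b : Fin 4) : ∑ c, gInv G p a c * gFrame G p b c = kron a b := by
  rw [← hG.sum_gInv_mul_gFrame hp a b]
  exact Finset.sum_congr rfl fun c _ => by rw [hG.gFrame_apply_symm hp b c]

theorem omega_sub_omega_horiz {p : F20} (hp : p ∈ framesOver D) (e d a b c x : Fin 4) :
    (omega G e d a b c p - omega G d e a b c p) ![horiz G p x] =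
      dualCoef (gFrame G p) (fun x y z => omegaSkewSource G e d a b c p
        ![horiz G p x, horiz G p y, horiz G p z]) x := by
  rw [omega_sub_omega, hodgeThree_apply]
  simp only [theta_horiz hp, mul_ite, mul_one, mul_zero, Finset.sum_ite_eq', Finset.mem_univ,
    if_true]

theorem dualCoef_sum (g : Matrix (Fin 4) (Fin 4) ℝ) {ι : Type*} (s : Finset ι)
    (A : ι → Fin 4 → Fin 4 → Fin 4 → ℝ) (d : Fin 4) :
    dualCoef g (fun a b c => ∑ i ∈ s, A i a b c) d = ∑ i ∈ s, dualCoef g (A i) d := by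
  classical
  induction s using Finset.induction_on with
  | empty => simp [dualCoef]
  | insert i s hi ih =>
    rw [Finset.sum_insert hi, ← ih]
    simp only [dualCoef, Finset.sum_insert hi, add_mul, Finset.sum_add_distrib, mul_add]

/-- Each summand of 𝒦 is *B ∧ S_e ∧ θ_d, so the double dual inserts the raised S_e and θ_d into B.
Raising θ_d gives a Kronecker symbol, which fills the second slot with the frame vector of index d.
-/
theorem IsLorentzOn.dualCoef_kForm (hG : IsLorentzOn G D) {p : F20} (hp : p ∈ framesOver D)
    (a b c j : Fin 4) :
    dualCoef (gFrame G p) (fun x y z => kForm G a b c p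
      ![horiz G p x, horiz G p y, horiz G p z]) j =
    ∑ e, ∑ k, schoutenMix G e k p * ∑ d, omegaSkewSource G e d a b c p
      ![horiz G p k, horiz G p d, horiz G p j] := by
  set B : Fin 4 → Fin 4 → Fin 4 → Fin 4 → Fin 4 → ℝ := fun e d x y z =>
    omegaSkewSource G e d a b c p ![horiz G p x, horiz G p y, horiz G p z] with hB
  have h1 : ∀ e d x y z, (wedge (omega G e d a b c p - omega G d e a b c p)
      (wedge (schoutenForm G e p) (thetaLow G d p) : Alt F20 2) : Alt F20 3)
        ![horiz G p x, horiz G p y, horiz G p z] =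
      dualCoef (gFrame G p) (B e d) x * (schouten G y e p * gFrame G p d z
          - schouten G z e p * gFrame G p d y)
        - dualCoef (gFrame G p) (B e d) y * (schouten G x e p * gFrame G p d z
          - schouten G z e p * gFrame G p d x)
        + dualCoef (gFrame G p) (B e d) z * (schouten G x e p * gFrame G p d y
          - schouten G y e p * gFrame G p d x) := by
    intro e d x y z
    have e1 : ∀ x y, (wedge (schoutenForm G e p) (thetaLow G d p) : Alt F20 2)
        ![horiz G p x, horiz G p y] = schouten G x e p * gFrame G p d y
          - schouten G y e p * gFrame G p d x := fun x y => by
      refine (wedge_one_one _ _ _ _).trans ?_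
      rw [schoutenForm_horiz hp, schoutenForm_horiz hp, thetaLow_horiz hp, thetaLow_horiz hp]
    refine (wedge_one_two _ _ _ _ _).trans ?_
    rw [e1, e1, e1, omega_sub_omega_horiz hp, omega_sub_omega_horiz hp,
      omega_sub_omega_horiz hp]
  have h2 : (fun x y z => kForm G a b c p ![horiz G p x, horiz G p y, horiz G p z]) =
      fun x y z => ∑ e, ∑ d, (wedge (omega G e d a b c p - omega G d e a b c p)
      (wedge (schoutenForm G e p) (thetaLow G d p) : Alt F20 2) : Alt F20 3)
        ![horiz G p x, horiz G p y, horiz G p z] := by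
    funext x y z
    rw [kForm, ContinuousAlternatingMap.sum_apply]
    simp only [ContinuousAlternatingMap.sum_apply]
  rw [h2, dualCoef_sum]
  refine Finset.sum_congr rfl fun e _ => ?_
  rw [dualCoef_sum]
  simp only [Finset.mul_sum]
  rw [Finset.sum_comm]
  refine Finset.sum_congr rfl fun d _ => ?_
  simp only [h1]
  rw [dualCoef_dualCoef_wedge (A := B e d) (hG.det_gFrame_neg hp) (hG.gFrame_transpose hp)
    (fun x y z => map_swap_three_fst _ _ _ _) (fun x y z => map_swap_three_snd _ _ _ _)
    (fun y => schouten G y e p) (fun z => gFrame G p d z) j]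
  refine Finset.sum_congr rfl fun k _ => ?_
  have h3 : ∀ l, ∑ z, (gFrame G p)⁻¹ l z * gFrame G p d z = kron l d :=
    fun l => hG.gInv_mul_gFrame_kron hp l d
  have h4 : ∑ y, (gFrame G p)⁻¹ k y * schouten G y e p = schoutenMix G e k p := by
    rw [schoutenMix]
    refine Finset.sum_congr rfl fun y _ => ?_
    rw [hG.schouten_symm hp y e, hG.gInv_symm hp y k, gInv, mul_comm]
  simp only [h3, h4, ← mul_assoc, kron_comm _ d]
  rw [sum_mul_kron d fun l => B e d k l j * schoutenMix G e k p, mul_comm]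

theorem IsLorentzOn.weylMix_eq (hG : IsLorentzOn G D) {p : F20} (hp : p ∈ framesOver D)
    (x y c e : Fin 4) : weylMix G x y c e p = ∑ s, gInv G p e s * weylTensor G x y c s p := by
  have h : ∀ s, weylTensor G x y c s p = ∑ t, gFrame G p s t * weylMix G x y c t p := fun s => by
    rw [weylTensor, weylLow_apply]
    exact Finset.sum_congr rfl fun t _ => by rw [hG.gFrame_apply_symm hp s t]; rfl
  simp only [h, Finset.mul_sum]
  rw [Finset.sum_comm]
  simp only [← mul_assoc, ← Finset.sum_mul, hG.sum_gInv_mul_gFrame hp, sum_kron_mul]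

theorem weylUpUp_eq (x y e d : Fin 4) (p : F20) :
    weylUpUp G x y e d p = ∑ s, gInv G p e s * weylMix G x y s d p := weylUp_apply _ _ _ _ _

theorem IsLorentzOn.weylUpUp_skew (hG : IsLorentzOn G D) {p : F20} (hp : p ∈ framesOver D)
    (x y e d : Fin 4) : weylUpUp G x y d e p = -weylUpUp G x y e d p := by
  simp only [weylUpUp_eq, hG.weylMix_eq hp, Finset.mul_sum]
  rw [Finset.sum_comm, ← Finset.sum_neg_distrib]
  refine Finset.sum_congr rfl fun s _ => ?_
  rw [← Finset.sum_neg_distrib]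
  refine Finset.sum_congr rfl fun t _ => ?_
  rw [hG.weylTensor_swap_snd hp x y s t]
  ring

theorem IsLorentzOn.weylMix_trace (hG : IsLorentzOn G D) {p : F20} (hp : p ∈ framesOver D)
    (x c : Fin 4) : ∑ d, weylMix G x d c d p = 0 := by
  simp only [hG.weylMix_eq hp]
  exact hG.weylTensor_trace hp x c

theorem IsLorentzOn.weylUpUp_trace (hG : IsLorentzOn G D) {p : F20} (hp : p ∈ framesOver D)
    (x e : Fin 4) : ∑ d, weylUpUp G x d e d p = 0 := by
  simp only [weylUpUp_eq]
  rw [Finset.sum_comm]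
  refine Finset.sum_eq_zero fun s _ => ?_
  rw [← Finset.mul_sum, hG.weylMix_trace hp, mul_zero]

theorem IsLorentzOn.sum_gFrame_mul_weylUpUp (hG : IsLorentzOn G D) {p : F20}
    (hp : p ∈ framesOver D) (x y e a : Fin 4) :
    ∑ d, gFrame G p a d * weylUpUp G x y e d p = -weylMix G x y a e p := by
  have h := congrArg (fun α : Alt F20 2 => α ![horiz G p x, horiz G p y])
    (hG.sum_gFrame_smul_weylUp hp e a)
  simp only [ContinuousAlternatingMap.sum_apply] at h
  refine Eq.trans ?_ h
  refine Finset.sum_congr rfl fun d _ => ?_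
  rw [hG.gFrame_apply_symm hp a d]
  rfl

theorem sum_gFrame_mul_weylMix (x y c a : Fin 4) (p : F20) (hG : IsLorentzOn G D)
    (hp : p ∈ framesOver D) :
    ∑ d, gFrame G p a d * weylMix G x y c d p = weylTensor G x y c a p := by
  rw [weylTensor, weylLow_apply]
  exact Finset.sum_congr rfl fun t _ => by rw [hG.gFrame_apply_symm hp a t]; rfl

/-- The component of `2 Ω^{[ed]}` before dualization, contracted in `d`. -/
theorem IsLorentzOn.sum_omegaSkewSource (hG : IsLorentzOn G D) {p : F20} (hp : p ∈ framesOver D)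
    (e a b c k j : Fin 4) :
    ∑ d, omegaSkewSource G e d a b c p ![horiz G p k, horiz G p d, horiz G p j] =
      gFrame G p a j * (weylMix G k b c e p + weylMix G k c b e p)
      + gFrame G p b c * weylMix G k j a e p
      - gFrame G p a b * weylMix G k j c e p - gFrame G p a c * weylMix G k j b e p
      + kron e b * weylTensor G k j c a p + kron e c * weylTensor G k j b a p
      + gFrame G p a k * (weylMix G b j c e p + weylMix G c j b e p) := by
  have hw : ∀ (μ : Alt F20 2) (x y z : Fin 4), (wedge μ (thetaLow G a p) : Alt F20 3)
      ![horiz G p x, horiz G p y, horiz G p z] = μ ![horiz G p x, horiz G p y] * gFrame G p a z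
        - μ ![horiz G p x, horiz G p z] * gFrame G p a y
        + μ ![horiz G p y, horiz G p z] * gFrame G p a x := fun μ x y z => by
    refine (wedge_two_one _ _ _ _ _).trans ?_
    rw [thetaLow_horiz hp, thetaLow_horiz hp, thetaLow_horiz hp]
  have hY : ∀ d, omegaSkewSource G e d a b c p ![horiz G p k, horiz G p d, horiz G p j] =
      gFrame G p a j * (gFrame G p b c * weylUpUp G k d e d p + weylMix G k d c e p * kron b d
        + weylMix G k d b e p * kron c d - kron e b * weylMix G k d c d p
        - kron e c * weylMix G k d b d p)
      - (gFrame G p b c * (gFrame G p a d * weylUpUp G k j e d p)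
        + gFrame G p a d * weylMix G k j c e p * kron b d
        + gFrame G p a d * weylMix G k j b e p * kron c d
        - kron e b * (gFrame G p a d * weylMix G k j c d p)
        - kron e c * (gFrame G p a d * weylMix G k j b d p))
      + gFrame G p a k * (-(gFrame G p b c * weylUpUp G j d e d p) + weylMix G d j c e p * kron b d
        + weylMix G d j b e p * kron c d + kron e b * weylMix G j d c d p
        + kron e c * weylMix G j d b d p) := by
    intro d
    have u1 : ∀ x y, weylUp G d e p ![horiz G p x, horiz G p y] = -weylUpUp G x y e d p :=
      fun x y => hG.weylUpUp_skew hp x y e d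
    have u2 : ∀ x y, weylUp G e d p ![horiz G p x, horiz G p y] = weylUpUp G x y e d p :=
      fun x y => rfl
    have u3 : ∀ x y c e, weyl G c e p ![horiz G p x, horiz G p y] = weylMix G x y c e p :=
      fun x y c e => rfl
    have u4 : weylUpUp G d j e d p = -weylUpUp G j d e d p := map_swap_two _ _ _
    have u5 : ∀ c, weylMix G d j c d p = -weylMix G j d c d p := fun c => map_swap_two _ _ _
    rw [omegaSkewSource]
    simp only [ContinuousAlternatingMap.add_apply, ContinuousAlternatingMap.sub_apply,
      ContinuousAlternatingMap.smul_apply, hw, u1, u2, u3, smul_eq_mul]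
    rw [u4, u5, u5, kron_comm d b, kron_comm d c]
    ring
  -- All terms in which d is contracted within one Weyl factor vanish, because the Weyl tensor is
  -- trace-free.
  simp only [hY, Finset.sum_add_distrib, Finset.sum_sub_distrib, ← Finset.mul_sum,
    Finset.sum_neg_distrib, sum_mul_kron, hG.weylMix_trace hp, hG.weylUpUp_trace hp,
    hG.sum_gFrame_mul_weylUpUp hp, sum_gFrame_mul_weylMix _ _ _ _ _ hG hp]
  ring

theorem IsLorentzOn.sum_schoutenMix_mul_weylMix (hG : IsLorentzOn G D) {p : F20}
    (hp : p ∈ framesOver D) (y c : Fin 4) :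
    ∑ e, ∑ k, schoutenMix G e k p * weylMix G k y c e p = -schoutenWeyl G y c p := by
  have h1 : ∀ e k, schoutenMix G e k p * weylMix G k y c e p =
      ∑ s, gInv G p s e * schoutenMix G e k p * weylTensor G k y c s p := fun e k => by
    rw [hG.weylMix_eq hp, Finset.mul_sum]
    refine Finset.sum_congr rfl fun s _ => ?_
    rw [hG.gInv_symm hp s e]
    ring
  simp only [h1]
  rw [Finset.sum_comm, schoutenWeyl, ← Finset.sum_neg_distrib]
  refine Finset.sum_congr rfl fun k _ => ?_
  rw [Finset.sum_comm, ← Finset.sum_neg_distrib]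
  refine Finset.sum_congr rfl fun s _ => ?_
  rw [← Finset.sum_mul, weylTensor_swap_fst k y c s p, hG.schoutenUp_symm hp k s, schoutenUp]
  ring

theorem IsLorentzOn.sum_schoutenMix_mul_gFrame (hG : IsLorentzOn G D) {p : F20}
    (hp : p ∈ framesOver D) (e a : Fin 4) :
    ∑ k, schoutenMix G e k p * gFrame G p a k = schouten G e a p := by
  simp only [schoutenMix, Finset.sum_mul]
  rw [Finset.sum_comm]
  simp only [mul_assoc, ← Finset.mul_sum, hG.gInv_mul_gFrame_kron hp]
  have := sum_mul_kron a fun c => schouten G e c p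
  simpa only [kron_comm a] using this

theorem IsLorentzOn.sum_schouten_mul_weylMix (hG : IsLorentzOn G D) {p : F20}
    (hp : p ∈ framesOver D) (x y c a : Fin 4) :
    ∑ e, schouten G e a p * weylMix G x y c e p =
      ∑ d, schoutenMix G a d p * weylTensor G x y c d p := by
  simp only [hG.weylMix_eq hp, Finset.mul_sum, schoutenMix, Finset.sum_mul]
  rw [Finset.sum_comm]
  refine Finset.sum_congr rfl fun d _ => Finset.sum_congr rfl fun e _ => ?_
  rw [hG.schouten_symm hp e a]
  ring

/-- The sums over e and k that contract S with both free slots of one Weyl factor give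
`schoutenWeyl` up to sign. The others give the mixed terms, matched to the index order of K by pair
symmetry. -/
theorem IsLorentzOn.dualCoef_kForm_eq (hG : IsLorentzOn G D) {p : F20} (hp : p ∈ framesOver D)
    (a b c j : Fin 4) :
    dualCoef (gFrame G p) (fun x y z => kForm G a b c p
      ![horiz G p x, horiz G p y, horiz G p z]) j = kTensor G j a b c p := by
  rw [hG.dualCoef_kForm hp, kTensor_eq]
  have e1 : ∀ e k, schoutenMix G e k p * ∑ d, omegaSkewSource G e d a b c p
      ![horiz G p k, horiz G p d, horiz G p j] =
      gFrame G p a j * (schoutenMix G e k p * weylMix G k b c e p)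
      + gFrame G p a j * (schoutenMix G e k p * weylMix G k c b e p)
      + gFrame G p b c * (schoutenMix G e k p * weylMix G k j a e p)
      - gFrame G p a b * (schoutenMix G e k p * weylMix G k j c e p)
      - gFrame G p a c * (schoutenMix G e k p * weylMix G k j b e p)
      + kron b e * (schoutenMix G e k p * weylTensor G k j c a p)
      + kron c e * (schoutenMix G e k p * weylTensor G k j b a p)
      + (schoutenMix G e k p * gFrame G p a k) * (weylMix G b j c e p + weylMix G c j b e p) := by
    intro e k
    rw [hG.sum_omegaSkewSource hp, kron_comm e b, kron_comm e c]
    ring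
  simp only [e1, Finset.sum_add_distrib, Finset.sum_sub_distrib, ← Finset.mul_sum,
    ← Finset.sum_mul, hG.sum_schoutenMix_mul_weylMix hp, hG.sum_schoutenMix_mul_gFrame hp,
    sum_kron_mul, mul_add, hG.sum_schouten_mul_weylMix hp]
  have p1 : ∀ d c, weylTensor G d j c a p = weylTensor G a c j d p := fun d c => by
    rw [← hG.weylTensor_pair hp d j c a, weylTensor_swap_fst a c d j p,
      hG.weylTensor_swap_snd hp a c j d, neg_neg]
  have p2 : ∀ d, weylTensor G c j b d p = weylTensor G b d c j p := fun d =>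
    hG.weylTensor_pair hp _ _ _ _
  simp only [p1, p2]
  rw [hG.schoutenWeyl_symm hp c b, hG.schoutenWeyl_symm hp j a, hG.schoutenWeyl_symm hp j b,
    hG.schoutenWeyl_symm hp j c]
  ring

theorem IsLorentzOn.hodge_kForm (hG : IsLorentzOn G D) {p : F20} (hp : p ∈ framesOver D)
    (a b c : Fin 4) : hodge G (kForm G a b c) p = ∑ j, kTensor G j a b c p • theta j p := by
  rw [hodge, hodgeThree_eq]
  simp only [hG.dualCoef_kForm_eq hp]

end DualK

/-! ### Trace relations for 𝒦 as a form -/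

section HorizontalForms

variable {G : E4 → Matrix (Fin 4) (Fin 4) ℝ} {D : Set E4}

theorem map_three_sub_fst {V : Type*} [NormedAddCommGroup V] [NormedSpace ℝ V] (α : Alt V 3)
    (u u' v w : V) : α ![u - u', v, w] = α ![u, v, w] - α ![u', v, w] := by
  have := α.toAlternatingMap.map_update_sub ![u, v, w] 0 u u'
  have e1 : ∀ x : V, Function.update ![u, v, w] 0 x = ![x, v, w] := fun x => by
    ext i : 1; fin_cases i <;> rfl
  rw [e1, e1, e1] at this
  exact this

theorem sum_theta_smul_horiz_fst {p : F20} (hp : p ∈ framesOver D) (v : F20) :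
    (∑ x, theta x p ![v] • horiz G p x).1 = v.1 := by
  have h1 : (frameMat p).mulVec (thetaVec p v) = fun i => v.1 i := by
    have : thetaVec p v = (frameMat p)⁻¹.mulVec fun i => v.1 i :=
      funext fun a => theta_apply a p v
    rw [this, Matrix.mulVec_mulVec, frameMat_mul_inv hp, Matrix.one_mulVec]
  ext i
  have h2 := congrFun h1 i
  rw [Matrix.mulVec, dotProduct] at h2
  rw [← h2, Prod.fst_sum]
  simp only [Prod.smul_fst, WithLp.ofLp_sum, WithLp.ofLp_smul, Finset.sum_apply, Pi.smul_apply,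
    smul_eq_mul]
  exact Finset.sum_congr rfl fun x _ => mul_comm _ _

/-- A horizontal form does not change when an argument is replaced by its horizontal projection ∑
θ^x(v) H_x, the difference being vertical. -/
theorem eq_zero_of_isHorizontalAt {p : F20} (hp : p ∈ framesOver D) {α : Alt F20 3}
    (hα : IsHorizontalAt p α)
    (h : ∀ x y z, α ![horiz G p x, horiz G p y, horiz G p z] = 0) : α = 0 := by
  set H : F20 → F20 := fun v => ∑ x, theta x p ![v] • horiz G p x with hH
  have h1 : ∀ u v w, α ![u, v, w] = α ![H u, v, w] := fun u v w => by
    rw [← sub_eq_zero, ← map_three_sub_fst]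
    refine hα _ ⟨0, ?_⟩
    change IsVertical p (u - H u)
    rw [isVertical_iff hp, Prod.fst_sub, sum_theta_smul_horiz_fst hp, sub_self]
  have h2 : ∀ u v w, α ![u, v, w] = α ![u, H v, w] := fun u v w => by
    rw [map_swap_three_fst α v u w, h1, map_swap_three_fst α u (H v) w, neg_neg]
  have h3 : ∀ u v w, α ![u, v, w] = α ![u, v, H w] := fun u v w => by
    rw [map_swap_three_snd α u w v, h2, map_swap_three_snd α u v (H w), neg_neg]
  refine alt_three_ext fun u v w => ?_
  rw [h1, h2, h3]
  -- The last entry of `![u, v, w, w]` is padding: the coefficient matrix has to be 4×4, and only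
  -- its columns 0, 1, 2 are used.
  have h4 := alt_three_sum α (Matrix.of fun x i : Fin 4 =>
    theta x p ![(![u, v, w, w] : Fin 4 → F20) i])
    (horiz G p) 0 1 2
  refine h4.trans ?_
  refine Finset.sum_eq_zero fun x _ => Finset.sum_eq_zero fun y _ =>
    Finset.sum_eq_zero fun z _ => ?_
  rw [h, mul_zero]

theorem isHorizontalAt_kForm_apply (p : F20) (a b c : Fin 4) :
    IsHorizontalAt p (kForm G a b c p) := by
  have h := isHorizontalAt_kForm (G := G) p ![a, b, c]
  have h0 : (![a, b, c] : Fin 3 → Fin 4) 0 = a := rfl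
  have h1 : (![a, b, c] : Fin 3 → Fin 4) 1 = b := rfl
  have h2 : (![a, b, c] : Fin 3 → Fin 4) 2 = c := rfl
  rwa [h0, h1, h2] at h

/-- The dual is injective on horizontal 3-forms, so a linear relation among the tensors K lifts to
the forms 𝒦. -/
theorem IsLorentzOn.sum_smul_kForm_eq_zero (hG : IsLorentzOn G D) {p : F20}
    (hp : p ∈ framesOver D) {ι : Type*} [Fintype ι] (r : ι → ℝ) (a b c : ι → Fin 4)
    (h : ∀ j, ∑ i, r i * kTensor G j (a i) (b i) (c i) p = 0) :
    ∑ i, r i • kForm G (a i) (b i) (c i) p = 0 := by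
  have e : ∀ v, (∑ i, r i • kForm G (a i) (b i) (c i) p) v =
      ∑ i, r i * kForm G (a i) (b i) (c i) p v := fun v => by
    rw [ContinuousAlternatingMap.sum_apply]
    rfl
  refine eq_zero_of_isHorizontalAt (G := G) hp (fun v hv => ?_) ?_
  · rw [e]
    exact Finset.sum_eq_zero fun i _ => by rw [isHorizontalAt_kForm_apply p _ _ _ v hv, mul_zero]
  · refine eq_zero_of_dualCoef_eq_zero (hG.det_gFrame_neg hp) (hG.gFrame_transpose hp)
      (fun x y z => map_swap_three_fst _ _ _ _) (fun x y z => map_swap_three_snd _ _ _ _)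
      fun j => ?_
    simp only [e]
    rw [dualCoef_sum, ← h j]
    refine Finset.sum_congr rfl fun i _ => ?_
    rw [← hG.dualCoef_kForm_eq hp]
    simp only [dualCoef, mul_assoc, ← Finset.mul_sum]
    ring

theorem IsLorentzOn.kForm_trace_fst (hG : IsLorentzOn G D) {p : F20} (hp : p ∈ framesOver D)
    (c : Fin 4) : ∑ a, ∑ b, gInv G p a b • kForm G a b c p = 0 := by
  have h := hG.sum_smul_kForm_eq_zero hp (fun x : Fin 4 × Fin 4 => gInv G p x.1 x.2)
    (fun x => x.1) (fun x => x.2) (fun _ => c) fun j => by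
      rw [Fintype.sum_prod_type]
      exact hG.kTensor_trace_fst hp j c
  simpa only [Fintype.sum_prod_type] using h

theorem IsLorentzOn.kForm_trace_snd (hG : IsLorentzOn G D) {p : F20} (hp : p ∈ framesOver D)
    (a : Fin 4) : ∑ b, ∑ c, gInv G p b c • kForm G a b c p = 0 := by
  have h := hG.sum_smul_kForm_eq_zero hp (fun x : Fin 4 × Fin 4 => gInv G p x.1 x.2)
    (fun _ => a) (fun x => x.1) (fun x => x.2) fun j => by
      rw [Fintype.sum_prod_type]
      exact hG.kTensor_trace_snd hp j a
  simpa only [Fintype.sum_prod_type] using h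

end HorizontalForms

/-! ### Closed 3-forms and divergence-free duals -/

section Divergence

variable {G : E4 → Matrix (Fin 4) (Fin 4) ℝ} {D : Set E4}

/-- Contracting dβ with ε gives four sums that coincide up to sign after relabelling; together they
are -4 times the sum in question. -/
theorem sum_eps_mul_fderiv_eq_zero {β : Form E4 3} {y : E4} (hd : extDeriv β y = 0) :
    ∑ i, ∑ a, ∑ b, ∑ c, eps a b c i *
      fderiv ℝ β y (stdVec i) ![stdVec a, stdVec b, stdVec c] = 0 := by
  set X : Fin 4 → Fin 4 → Fin 4 → Fin 4 → ℝ := fun i a b c =>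
    fderiv ℝ β y (stdVec i) ![stdVec a, stdVec b, stdVec c] with hX
  have h0 : ∀ i a b c, X a b c i - X b a c i + X c a b i - X i a b c = 0 := fun i a b c => by
    have := extDeriv_three_apply β y (stdVec a) (stdVec b) (stdVec c) (stdVec i)
    rw [hd] at this
    exact this.symm
  have h1 : ∑ i, ∑ a, ∑ b, ∑ c, (eps a b c i * X a b c i - eps a b c i * X b a c i
      + eps a b c i * X c a b i - eps a b c i * X i a b c) = 0 :=
    Finset.sum_eq_zero fun i _ => Finset.sum_eq_zero fun a _ => Finset.sum_eq_zero fun b _ =>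
      Finset.sum_eq_zero fun c _ => by linear_combination eps a b c i * h0 i a b c
  simp only [Finset.sum_add_distrib, Finset.sum_sub_distrib] at h1
  have r1 : ∑ i, ∑ a, ∑ b, ∑ c, eps a b c i * X a b c i =
      -∑ i, ∑ a, ∑ b, ∑ c, eps a b c i * X i a b c := by
    calc _ = ∑ a, ∑ b, ∑ c, ∑ i, eps a b c i * X a b c i := by
          rw [Finset.sum_comm]
          refine Finset.sum_congr rfl fun a _ => ?_
          rw [Finset.sum_comm]
          refine Finset.sum_congr rfl fun b _ => ?_
          rw [Finset.sum_comm]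
      _ = _ := by
          simp only [← Finset.sum_neg_distrib]
          refine Finset.sum_congr rfl fun i _ => Finset.sum_congr rfl fun a _ =>
            Finset.sum_congr rfl fun b _ => Finset.sum_congr rfl fun c _ => ?_
          rw [eps_cycle a b c i]
          ring
  have r2 : ∑ i, ∑ a, ∑ b, ∑ c, eps a b c i * X b a c i =
      ∑ i, ∑ a, ∑ b, ∑ c, eps a b c i * X i a b c := by
    calc _ = ∑ b, ∑ a, ∑ c, ∑ i, eps a b c i * X b a c i := by
          rw [Finset.sum_comm]
          conv_rhs => rw [Finset.sum_comm]
          refine Finset.sum_congr rfl fun a _ => ?_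
          rw [Finset.sum_comm]
          refine Finset.sum_congr rfl fun b _ => ?_
          rw [Finset.sum_comm]
      _ = _ := by
          refine Finset.sum_congr rfl fun i _ => Finset.sum_congr rfl fun a _ =>
            Finset.sum_congr rfl fun b _ => Finset.sum_congr rfl fun c _ => ?_
          rw [eps_cycle a b c i, eps_swap_fst a i b c]
          ring
  have r3 : ∑ i, ∑ a, ∑ b, ∑ c, eps a b c i * X c a b i =
      -∑ i, ∑ a, ∑ b, ∑ c, eps a b c i * X i a b c := by
    calc _ = ∑ c, ∑ a, ∑ b, ∑ i, eps a b c i * X c a b i := by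
          rw [Finset.sum_comm]
          conv_rhs => rw [Finset.sum_comm]
          refine Finset.sum_congr rfl fun a _ => ?_
          rw [Finset.sum_comm]
          conv_rhs => rw [Finset.sum_comm]
          refine Finset.sum_congr rfl fun b _ => ?_
          rw [Finset.sum_comm]
      _ = _ := by
          simp only [← Finset.sum_neg_distrib]
          refine Finset.sum_congr rfl fun i _ => Finset.sum_congr rfl fun a _ =>
            Finset.sum_congr rfl fun b _ => Finset.sum_congr rfl fun c _ => ?_
          rw [eps_swap_trd a b c i]
          ring
  rw [r1, r2, r3] at h1
  linarith

theorem divergence_congr {J J' : Form E4 1} {y : E4} (h : J =ᶠ[nhds y] J') :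
    divergence G J y = divergence G J' y := by
  rw [divergence, divergence]
  congr 1
  refine Finset.sum_congr rfl fun i _ => ?_
  rw [pd, pd]
  congr 1
  refine Filter.EventuallyEq.fderiv_eq ?_
  filter_upwards [h] with z hz
  rw [hz]

/-- The frame of the section arises from the coordinate basis by the matrix A, so its dual is the
coordinate dual times the sign of det A. -/
theorem IsLorentzOn.starBase_apply (hG : IsLorentzOn G D) {s : E4 → F20} {z : E4}
    (hs : s z ∈ framesOver D) (hz : (s z).1 = z) (β : Form E4 3) (j : Fin 4) :
    starBase G s β z ![stdVec j] = rsign (frameMat (s z)).det *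
      dualCoef (G z) (fun a b c => β z ![stdVec a, stdVec b, stdVec c]) j := by
  have hzD : z ∈ D := hz ▸ hs.1
  rw [starBase, gFrame_eq, hz]
  have hcol : ∀ a, (WithLp.toLp 2 fun i => (s z).2 i a : E4) =
      ∑ x, frameMat (s z) x a • stdVec x := fun a => vec_eq_sum_stdVec _
  have h := hodgeThree_change (hG.det_neg z hzD) (h := frameMat (s z)) hs.2 (e := stdVec)
    (θ := fun i => oneForm (EuclideanSpace.proj i : E4 →L[ℝ] ℝ))
    (e' := fun a => (WithLp.toLp 2 fun i => (s z).2 i a : E4))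
    (θ' := fun d => oneForm (∑ i, (frameMat (s z))⁻¹ d i • (EuclideanSpace.proj i : E4 →L[ℝ] ℝ)))
    (α := β z) (α' := β z) (v := stdVec j) (v' := stdVec j)
    (fun a => by
      rw [oneForm_apply, sum_apply]
      rfl)
    (fun a b c => by rw [hcol, hcol, hcol])
  rw [h, hodgeThree_apply]
  congr 1
  have hk : ∀ d, oneForm (EuclideanSpace.proj d : E4 →L[ℝ] ℝ) ![stdVec j] = kron j d := fun d => by
    rw [oneForm_apply, stdVec]
    simp [kron, eq_comm]
  simp only [hk, sum_mul_kron]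

/-- The density and the inverse metric cancel exactly the metric factors of the dual. Since no
metric remains, differentiating produces the exterior derivative of β without Christoffel terms. -/
theorem IsLorentzOn.sqrt_mul_starBase (hG : IsLorentzOn G D) {s : E4 → F20} {z : E4}
    (hs : s z ∈ framesOver D) (hz : (s z).1 = z) (β : Form E4 3) (i : Fin 4) :
    Real.sqrt |(G z).det| * ∑ j, (G z)⁻¹ i j * starBase G s β z ![stdVec j] =
      -(1 / 6) * rsign (frameMat (s z)).det * ∑ a, ∑ b, ∑ c, eps a b c i *
        β z ![stdVec a, stdVec b, stdVec c] := by
  have hzD : z ∈ D := hz ▸ hs.1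
  have hneg := hG.det_neg z hzD
  have hinv : ∀ t, ∑ j, (G z)⁻¹ i j * G z j t = kron i t := fun t => by
    rw [← Matrix.mul_apply, Matrix.nonsing_inv_mul _ hneg.ne.isUnit, Matrix.one_apply, kron]
  set T : Fin 4 → ℝ := fun t => (1 / 6) * ∑ a, ∑ b, ∑ c,
    β z ![stdVec a, stdVec b, stdVec c] * eps a b c t with hT
  have h1 : ∑ j, (G z)⁻¹ i j * starBase G s β z ![stdVec j] =
      -(rsign (frameMat (s z)).det * (Real.sqrt (-(G z).det))⁻¹) * T i := by
    calc _ = ∑ j, ∑ t, -(rsign (frameMat (s z)).det * (Real.sqrt (-(G z).det))⁻¹) *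
          ((G z)⁻¹ i j * G z j t * T t) := by
          refine Finset.sum_congr rfl fun j _ => ?_
          rw [hG.starBase_apply hs hz, dualCoef_eq hneg, ← Finset.mul_sum]
          simp only [mul_assoc, ← Finset.mul_sum]
          ring
      _ = _ := by
          rw [Finset.sum_comm]
          simp only [← Finset.mul_sum, ← Finset.sum_mul, hinv, sum_kron_mul]
  rw [h1, abs_of_neg hneg, hT]
  have hs0 : Real.sqrt (-(G z).det) ≠ 0 := sqrt_neg_det_ne hneg
  have h2 : ∑ a, ∑ b, ∑ c, β z ![stdVec a, stdVec b, stdVec c] * eps a b c i =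
      ∑ a, ∑ b, ∑ c, eps a b c i * β z ![stdVec a, stdVec b, stdVec c] := by
    simp only [mul_comm]
  beta_reduce
  rw [h2]
  field_simp

theorem rsign_eventually_eq {f : E4 → ℝ} {y : E4} (hf : ContinuousAt f y) (h : f y ≠ 0) :
    ∀ᶠ z in nhds y, rsign (f z) = rsign (f y) := by
  rcases lt_or_gt_of_ne h with h1 | h1
  · filter_upwards [hf.eventually_lt_const h1] with z hz
    rw [rsign, rsign, sign_neg hz, sign_neg h1]
  · filter_upwards [hf.eventually_const_lt h1] with z hz
    rw [rsign, rsign, sign_pos hz, sign_pos h1]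

/-- The sign of the frame's determinant is locally constant by continuity, so it is not
differentiated. -/
theorem IsLorentzOn.divergence_starBase (hG : IsLorentzOn G D) {s : E4 → F20} {y : E4}
    (hs : ∀ᶠ z in nhds y, s z ∈ framesOver D ∧ (s z).1 = z) (hc : ContinuousAt s y)
    {β : Form E4 3} (hβ : DifferentiableAt ℝ β y) (hd : extDeriv β y = 0) :
    divergence G (starBase G s β) y = 0 := by
  have hdet : ContinuousAt (fun z => (frameMat (s z)).det) y := by
    have h1 : ContinuousAt (fun p : F20 => (frameMat p).det) (s y) :=
      (contDiffAt_det (r := 0) fun a b =>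
        (contDiff_frameMat_apply a b).contDiffAt).continuousAt
    exact h1.comp hc
  have hβc : ∀ a b c : Fin 4, DifferentiableAt ℝ
      (fun z => β z ![stdVec a, stdVec b, stdVec c]) y := fun a b c =>
    hβ.continuousAlternatingMap_apply_const _
  have key : ∀ i, pd i (fun z => Real.sqrt |(G z).det| *
      ∑ j, (G z)⁻¹ i j * starBase G s β z ![stdVec j]) y =
      -(1 / 6) * rsign (frameMat (s y)).det * ∑ a, ∑ b, ∑ c, eps a b c i *
        fderiv ℝ β y (stdVec i) ![stdVec a, stdVec b, stdVec c] := by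
    intro i
    have e : (fun z => Real.sqrt |(G z).det| *
        ∑ j, (G z)⁻¹ i j * starBase G s β z ![stdVec j]) =ᶠ[nhds y]
        fun z => -(1 / 6) * rsign (frameMat (s y)).det * ∑ a, ∑ b, ∑ c, eps a b c i *
          β z ![stdVec a, stdVec b, stdVec c] := by
      filter_upwards [hs, rsign_eventually_eq hdet hs.self_of_nhds.1.2] with z hz hz'
      rw [hG.sqrt_mul_starBase hz.1 hz.2, hz']
    have hF : HasFDerivAt (fun z => -(1 / 6) * rsign (frameMat (s y)).det *
        ∑ a, ∑ b, ∑ c, eps a b c i * β z ![stdVec a, stdVec b, stdVec c])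
        ((-(1 / 6) * rsign (frameMat (s y)).det) • ∑ a, ∑ b, ∑ c, eps a b c i •
          fderiv ℝ (fun z => β z ![stdVec a, stdVec b, stdVec c]) y) y := by
      refine HasFDerivAt.const_mul ?_ _
      refine HasFDerivAt.fun_sum fun a _ => HasFDerivAt.fun_sum fun b _ =>
        HasFDerivAt.fun_sum fun c _ => ?_
      exact (hβc a b c).hasFDerivAt.const_mul _
    rw [pd, e.fderiv_eq, hF.fderiv]
    simp only [smul_apply, sum_apply, smul_eq_mul,
      fderiv_continuousAlternatingMap_apply_const_apply hβ]
  rw [divergence]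
  simp only [key, ← Finset.mul_sum]
  rw [sum_eps_mul_fderiv_eq_zero hd, mul_zero, mul_zero]

theorem ContDiffAt.extDeriv {V : Type*} [NormedAddCommGroup V] [NormedSpace ℝ V] {k : ℕ}
    {α : Form V k} {p : V} (h : ContDiffAt ℝ ∞ α p) :
    ContDiffAt ℝ ∞ (_root_.extDeriv α) p := by
  have h1 : ContDiffAt ℝ ∞ (fderiv ℝ α) p := h.fderiv_right (m := ∞) (by simp)
  exact (ContinuousAlternatingMap.alternatizeUncurryFinCLM ℝ V ℝ (n := k)).contDiff.contDiffAt.comp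
    p h1

/-- Pull-back commutes with d, and d² = 0. -/
theorem pullback_extDeriv {s : E4 → F20} {y : E4} (hs : ContDiffAt ℝ ∞ s y) {α : Form F20 2}
    (hα : ContDiffAt ℝ ∞ α (s y)) :
    DifferentiableAt ℝ (pullback s (extDeriv α)) y ∧
      extDeriv (pullback s (extDeriv α)) y = 0 := by
  have h1 : DifferentiableAt ℝ (extDeriv α) (s y) :=
    (ContDiffAt.extDeriv hα).differentiableAt (by simp)
  refine ⟨?_, ?_⟩
  · exact (h1.comp y
      (hs.differentiableAt (by simp))).continuousAlternatingMapCompContinuousLinearMap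
      ((hs.fderiv_right (m := ∞) (by simp)).differentiableAt (by simp))
  · have := extDeriv_pullback h1 hs minSmoothness_two_le
    refine this.trans ?_
    rw [extDeriv_extDeriv_apply hα minSmoothness_two_le]
    rfl

theorem IsLorentzOn.divergence_potential (hG : IsLorentzOn G D) {s : E4 → F20} {y : E4}
    (hs : ∀ᶠ z in nhds y, s z ∈ framesOver D ∧ (s z).1 = z) (hc : ContDiffAt ℝ ∞ s y)
    (a b c : Fin 4) :
    divergence G (starBase G s (pullback s (extDeriv (potential G a b c)))) y = 0 := by
  have h := pullback_extDeriv hc (hG.contDiffAt_potential hs.self_of_nhds.1 a b c)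
  exact hG.divergence_starBase hs hc.continuousAt h.1 h.2

theorem IsLorentzOn.extDeriv_potential_eq (hG : IsLorentzOn G D) {p : F20}
    (hp : p ∈ framesOver D) (a b c : Fin 4) : extDeriv (potential G a b c) p
      = xiConn G a b c p + kForm G a b c p + belRobinson G a b c p :=
  hG.extDeriv_potential hp a b c

theorem pullback_eq_add {k : ℕ} (s : E4 → F20) (y : E4) {α β γ δ : Form F20 k}
    (h : α (s y) = β (s y) + γ (s y) + δ (s y)) :
    pullback s α y = pullback s β y + pullback s γ y + pullback s δ y := by
  rw [pullback, h]
  rfl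

theorem hodgeThree_add_add {V : Type*} [NormedAddCommGroup V] [NormedSpace ℝ V]
    (g : Matrix (Fin 4) (Fin 4) ℝ) (e : Fin 4 → V) (θ : Fin 4 → Alt V 1) (α β γ : Alt V 3) :
    hodgeThree g e θ (α + β + γ) =
      hodgeThree g e θ α + hodgeThree g e θ β + hodgeThree g e θ γ := by
  have h : ∀ α, hodgeThree g e θ α = hodgeThreeLin g e θ α := fun _ => rfl
  rw [h, h, h, h, map_add, map_add]

theorem starBase_eq_add (s : E4 → F20) (y : E4) {α β γ δ : Form E4 3}
    (h : α y = β y + γ y + δ y) :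
    starBase G s α y = (starBase G s β + starBase G s γ + starBase G s δ) y := by
  rw [Pi.add_apply, Pi.add_apply, starBase, starBase, starBase, starBase, h]
  exact hodgeThree_add_add _ _ _ _ _ _

theorem divergence_add_add {s : E4 → F20} {y : E4} {α β γ δ : Form F20 3}
    (h : ∀ᶠ z in nhds y, α (s z) = β (s z) + γ (s z) + δ (s z)) :
    divergence G (starBase G s (pullback s β) + starBase G s (pullback s γ)
      + starBase G s (pullback s δ)) y = divergence G (starBase G s (pullback s α)) y := by
  refine divergence_congr ?_
  filter_upwards [h] with z hz
  exact (starBase_eq_add s z (pullback_eq_add s z hz)).symm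

theorem IsLorentzOn.divergence_terms (hG : IsLorentzOn G D) {s : E4 → F20} {y : E4}
    (hs : ∀ᶠ z in nhds y, s z ∈ framesOver D ∧ (s z).1 = z) (hc : ContDiffAt ℝ ∞ s y)
    (a b c : Fin 4) :
    divergence G (starBase G s (pullback s (xiConn G a b c))
      + starBase G s (pullback s (kForm G a b c))
      + starBase G s (pullback s (belRobinson G a b c))) y = 0 := by
  have h : ∀ᶠ z in nhds y, extDeriv (potential G a b c) (s z) =
      xiConn G a b c (s z) + kForm G a b c (s z) + belRobinson G a b c (s z) := by
    filter_upwards [hs] with z hz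
    exact hG.extDeriv_potential_eq hz.1 a b c
  rw [divergence_add_add h]
  exact hG.divergence_potential hs hc a b c

end Divergence

/-! ### Skew connections and the exchange of the index in Ξ -/

section ConstantMetric

variable {G : E4 → Matrix (Fin 4) (Fin 4) ℝ} {D : Set E4}

/-- Skewness of gΓ₁ and gΓ₂ and cyclicity of the trace move the connection from the second index of
O to the first, at the price of exchanging Γ₁ and Γ₂. The antisymmetrization over the arguments of a
3-form absorbs the exchange and the sign. -/
theorem pairing_skew_swap {g Γ₁ Γ₂ O : Matrix (Fin 4) (Fin 4) ℝ} (hs : g.transpose = g)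
    (h1 : (g * Γ₁).transpose = -(g * Γ₁)) (h2 : (g * Γ₂).transpose = -(g * Γ₂)) :
    pairing (O * Γ₁.transpose) (g * Γ₂) = -pairing (Γ₂ * O) (g * Γ₁) := by
  have h3 : Γ₁.transpose * g = -(g * Γ₁) := by
    rw [← h1, Matrix.transpose_mul, hs]
  rw [pairing_eq_trace, pairing_eq_trace, h1, h2, Matrix.mul_neg, Matrix.mul_neg,
    Matrix.trace_neg, Matrix.trace_neg, neg_neg, Matrix.mul_assoc, ← Matrix.mul_assoc _ g, h3,
    Matrix.neg_mul, Matrix.mul_neg, Matrix.trace_neg, neg_neg, ← Matrix.mul_assoc O,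
    Matrix.trace_mul_comm, Matrix.mul_assoc]

theorem pairing_add_left (A B N : Matrix (Fin 4) (Fin 4) ℝ) :
    pairing (A + B) N = pairing A N + pairing B N := by
  simp only [pairing_eq_trace, Matrix.add_mul, Matrix.trace_add]

theorem pairing_sub_left (A B N : Matrix (Fin 4) (Fin 4) ℝ) :
    pairing (A - B) N = pairing A N - pairing B N := by
  simp only [pairing_eq_trace, Matrix.sub_mul, Matrix.trace_sub]

variable (G) in
/-- The values of `Γ_{ab}` as a matrix. -/
def connLowMat (p v : F20) : Matrix (Fin 4) (Fin 4) ℝ := Matrix.of fun a b => connLow G a b p ![v]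

theorem connLowMat_eq (p v : F20) : connLowMat G p v = gFrame G p * connMat G p v := by
  ext a b
  rw [connLowMat, Matrix.of_apply, connLow_apply]

theorem sum_wedge_connLow_apply (p : F20) (X : Fin 4 → Fin 4 → Alt F20 2) (u v w : F20) :
    (∑ d, ∑ e, wedge (X d e) (connLow G d e p) : Alt F20 3) ![u, v, w] =
      pairing (Matrix.of fun d e => X d e ![u, v]) (connLowMat G p w)
      - pairing (Matrix.of fun d e => X d e ![u, w]) (connLowMat G p v)
      + pairing (Matrix.of fun d e => X d e ![v, w]) (connLowMat G p u) := by
  have e : ∀ d e, (wedge (X d e) (connLow G d e p) : Alt F20 3) ![u, v, w] = _ :=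
    fun d e => wedge_two_one _ _ _ _ _
  rw [ContinuousAlternatingMap.sum_apply]
  simp only [ContinuousAlternatingMap.sum_apply, e, Finset.sum_add_distrib,
    Finset.sum_sub_distrib, pairing, connLowMat, Matrix.of_apply]

variable (G) in
/-- The values of `Ω^{de}_{abc}` as a matrix, with separate indices. -/
def omegaMatrix (p : F20) (a b c : Fin 4) (v : F20) : Matrix (Fin 4) (Fin 4) ℝ :=
  Matrix.of fun d e => omega G d e a b c p ![v]

theorem xi_sub_extDeriv (p : F20) (a b c : Fin 4) (v w : F20) :
    (Matrix.of fun d e => xi G d e a b c p ![v, w] : Matrix (Fin 4) (Fin 4) ℝ) =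
      (Matrix.of fun d e => extDeriv (omega G d e a b c) p ![v, w])
        + (connMat G p v * omegaMatrix G p a b c w - connMat G p w * omegaMatrix G p a b c v) := by
  ext d e
  have h : ∀ f, (wedge (conn G d f p) (omega G f e a b c p) : Alt F20 2) ![v, w] = _ :=
    fun f => wedge_one_one _ _ _ _
  rw [Matrix.of_apply, xi, ContinuousAlternatingMap.add_apply, ContinuousAlternatingMap.sum_apply,
    Matrix.add_apply, Matrix.sub_apply, Matrix.mul_apply, Matrix.mul_apply,
    ← Finset.sum_sub_distrib]
  simp only [h, omegaMatrix, connMat, Matrix.of_apply]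

theorem xiSnd_sub_extDeriv (p : F20) (a b c : Fin 4) (v w : F20) :
    (Matrix.of fun d e => xiSnd G d e a b c p ![v, w] : Matrix (Fin 4) (Fin 4) ℝ) =
      (Matrix.of fun d e => extDeriv (omega G d e a b c) p ![v, w])
        + (omegaMatrix G p a b c w * (connMat G p v).transpose
          - omegaMatrix G p a b c v * (connMat G p w).transpose) := by
  ext d e
  have h : ∀ f, (wedge (conn G e f p) (omega G d f a b c p) : Alt F20 2) ![v, w] = _ :=
    fun f => wedge_one_one _ _ _ _
  rw [Matrix.of_apply, xiSnd, ContinuousAlternatingMap.add_apply,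
    ContinuousAlternatingMap.sum_apply,
    Matrix.add_apply, Matrix.sub_apply, Matrix.mul_apply, Matrix.mul_apply,
    ← Finset.sum_sub_distrib]
  simp only [h, omegaMatrix, connMat, Matrix.of_apply, Matrix.transpose_apply, mul_comm]

theorem IsLorentzOn.xiSndConn_apply (hG : IsLorentzOn G D) {p : F20} (hp : p ∈ framesOver D)
    (a b c : Fin 4) {u v w : F20} (hu : (connLowMat G p u).transpose = -connLowMat G p u)
    (hv : (connLowMat G p v).transpose = -connLowMat G p v)
    (hw : (connLowMat G p w).transpose = -connLowMat G p w) :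
    xiSndConn G a b c p ![u, v, w] = xiConn G a b c p ![u, v, w] := by
  rw [xiSndConn, xiConn, sum_wedge_connLow_apply, sum_wedge_connLow_apply]
  simp only [xi_sub_extDeriv, xiSnd_sub_extDeriv, pairing_add_left, pairing_sub_left]
  rw [connLowMat_eq] at hu hv hw ⊢
  rw [connLowMat_eq, connLowMat_eq]
  have hs := hG.gFrame_transpose hp
  rw [pairing_skew_swap hs hu hw, pairing_skew_swap hs hv hw, pairing_skew_swap hs hu hv,
    pairing_skew_swap hs hw hv, pairing_skew_swap hs hv hu, pairing_skew_swap hs hw hu]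
  ring

theorem IsLorentzOn.pullback_xiSndConn (hG : IsLorentzOn G D) {s : E4 → F20} {y : E4}
    (hs : s y ∈ framesOver D) (hd : DifferentiableAt ℝ s y) {C : Fin 4 → Fin 4 → ℝ}
    (hC : ∀ᶠ z in nhds y, ∀ a b, gFrame G (s z) a b = C a b) (a b c : Fin 4) :
    pullback s (xiSndConn G a b c) y = pullback s (xiConn G a b c) y := by
  -- Constancy of g_{ab} along the section kills dg_{ab} = Γ_{ab} + Γ_{ba} on all vectors tangent to
  -- it.
  have hskew : ∀ v, (connLowMat G (s y) (fderiv ℝ s y v)).transpose =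
      -connLowMat G (s y) (fderiv ℝ s y v) := by
    intro v
    ext a b
    have h1 : fderiv ℝ (fun z => gFrame G (s z) b a) y = 0 := by
      have : (fun z => gFrame G (s z) b a) =ᶠ[nhds y] fun _ => C b a := by
        filter_upwards [hC] with z hz
        exact hz b a
      rw [this.fderiv_eq, fderiv_const_apply]
    have h2 : HasFDerivAt (fun z => gFrame G (s z) b a)
        ((fderiv ℝ (fun q => gFrame G q b a) (s y)).comp (fderiv ℝ s y)) y :=
      HasFDerivAt.comp y (((hG.contDiffAt_gFrame hs b a).differentiableAt (by simp)).hasFDerivAt)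
        hd.hasFDerivAt
    rw [h2.fderiv] at h1
    have h3 : fderiv ℝ (fun q => gFrame G q b a) (s y) (fderiv ℝ s y v) = 0 :=
      congrArg (fun L => L v) h1
    rw [hG.fderiv_gFrame hs] at h3
    rw [Matrix.transpose_apply, Matrix.neg_apply, connLowMat, Matrix.of_apply, Matrix.of_apply]
    exact eq_neg_of_add_eq_zero_left h3
  refine alt_three_ext fun u v w => ?_
  have e : ∀ α : Form F20 3, pullback s α y ![u, v, w] =
      α (s y) ![fderiv ℝ s y u, fderiv ℝ s y v, fderiv ℝ s y w] := by
    intro α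
    have : (fun i => fderiv ℝ s y ((![u, v, w] : Fin 3 → E4) i)) =
        ![fderiv ℝ s y u, fderiv ℝ s y v, fderiv ℝ s y w] := by
      ext i : 1; fin_cases i <;> rfl
    rw [← this]
    rfl
  rw [e, e]
  exact hG.xiSndConn_apply hs a b c (hskew u) (hskew v) (hskew w)

end ConstantMetric

/-! ### Derivatives of charts -/

section Charts

variable {M : Type*} [TopologicalSpace M] [ChartedSpace E4 M]

/-- Tangent spaces are copies of `E4`. Naming the two derivatives as maps of this fixed space
removes the dependence of their types on the point. -/
theorem mfderiv_chart_symm {φ : OpenPartialHomeomorph M E4}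
    (hφ : φ ∈ IsManifold.maximalAtlas (𝓡 4) ∞ M) {y : E4} (hy : y ∈ φ.target) :
    ∃ L K : E4 →L[ℝ] E4, (∀ v : E4, mfderiv (𝓡 4) (𝓡 4) φ.symm y v = L v) ∧
      (∀ w : E4, mfderiv (𝓡 4) (𝓡 4) φ (φ.symm y) w = K w) ∧
      (∀ v, K (L v) = v) ∧ ∀ w, L (K w) = w := by
  have hd : φ.MDifferentiable (𝓡 4) (𝓡 4) :=
    ⟨(contMDiffOn_of_mem_maximalAtlas hφ).mdifferentiableOn (by simp),
      (contMDiffOn_symm_of_mem_maximalAtlas hφ).mdifferentiableOn (by simp)⟩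
  let L : E4 →L[ℝ] E4 := mfderiv (𝓡 4) (𝓡 4) φ.symm y
  let K : E4 →L[ℝ] E4 := mfderiv (𝓡 4) (𝓡 4) φ (φ.symm y)
  have h1 : K.comp L = ContinuousLinearMap.id ℝ E4 := hd.comp_symm_deriv hy
  have h2 : ∀ v, K (L v) = v := fun v => congrArg (fun T : E4 →L[ℝ] E4 => T v) h1
  -- In finite dimension a one-sided inverse is two-sided.
  have h3 : (L : E4 →ₗ[ℝ] E4) * (K : E4 →ₗ[ℝ] E4) = 1 := by
    rw [mul_eq_one_comm]
    ext1 v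
    exact h2 v
  exact ⟨L, K, fun _ => rfl, fun _ => rfl, h2, fun w => congrArg (fun T : E4 →ₗ[ℝ] E4 => T w) h3⟩

end Charts

/-! ### The variant of the identity along a frame with constant metric components -/

section ConstantMetric

variable {G : E4 → Matrix (Fin 4) (Fin 4) ℝ} {D : Set E4}

theorem IsLorentzOn.pullback_extDeriv_potential (hG : IsLorentzOn G D) {s : E4 → F20} {y : E4}
    (hs : s y ∈ framesOver D) (hd : DifferentiableAt ℝ s y) {C : Fin 4 → Fin 4 → ℝ}
    (hC : ∀ᶠ z in nhds y, ∀ a b, gFrame G (s z) a b = C a b) (a b c : Fin 4) :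
    pullback s (extDeriv (potential G a b c)) y = pullback s (xiSndConn G a b c) y
      + pullback s (kForm G a b c) y + pullback s (belRobinson G a b c) y := by
  rw [hG.pullback_xiSndConn hs hd hC]
  have h := hG.extDeriv_potential_eq hs a b c
  generalize extDeriv (potential G a b c) = α at h ⊢
  generalize xiConn G a b c = β at h ⊢
  generalize kForm G a b c = γ at h ⊢
  generalize belRobinson G a b c = δ at h ⊢
  exact pullback_eq_add (k := 3) s y h

end ConstantMetric

/-! ### From the manifold to a chart -/

section Coordinates

variable {M : Type*} [TopologicalSpace M] [ChartedSpace E4 M]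

theorem det_ne_zero_of_mulVec {n : ℕ} {P : Matrix (Fin n) (Fin n) ℝ}
    (h : ∀ x, P.mulVec x = 0 → x = 0) : P.det ≠ 0 := by
  intro h0
  obtain ⟨x, hx, hx0⟩ := Matrix.exists_mulVec_eq_zero_iff.2 h0
  exact hx (h x hx0)

/-- The Gram matrix of linearly independent vectors for a scalar product of Lorentz signature. -/
theorem gram_det_neg {E : Type*} [AddCommGroup E] [Module ℝ E] (B : E →ₗ[ℝ] E →ₗ[ℝ] ℝ)
    (b : Module.Basis (Fin 4) ℝ E)
    (hb : ∀ i j, B (b i) (b j) = if i = j then (if i = 0 then -1 else 1) else 0)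
    {e : Fin 4 → E} (he : LinearIndependent ℝ e) :
    (Matrix.of fun i j => B (e i) (e j) : Matrix (Fin 4) (Fin 4) ℝ).det < 0 := by
  set P : Matrix (Fin 4) (Fin 4) ℝ := Matrix.of fun k i => b.repr (e i) k with hP
  set N : Matrix (Fin 4) (Fin 4) ℝ := Matrix.diagonal fun i => if i = 0 then -1 else 1 with hN
  have hexp : ∀ i, e i = ∑ k, P k i • b k := fun i => (b.sum_repr (e i)).symm
  have hG : (Matrix.of fun i j => B (e i) (e j) : Matrix (Fin 4) (Fin 4) ℝ) =
      P.transpose * N * P := by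
    ext i j
    rw [Matrix.of_apply, hexp i, hexp j]
    simp only [map_sum, LinearMap.sum_apply, map_smul, LinearMap.smul_apply, hb, smul_eq_mul]
    rw [Matrix.mul_assoc, Matrix.mul_apply]
    refine Finset.sum_congr rfl fun k _ => ?_
    rw [hN, Matrix.diagonal_mul, Matrix.transpose_apply]
    simp [mul_comm (P k j)]
  -- A vector in the kernel of P is a linear relation among the vectors `e i`.
  have hPd : P.det ≠ 0 := det_ne_zero_of_mulVec fun x hx => by
    have h1 : ∑ i, x i • e i = 0 := by
      have h2 : ∀ i, x i • e i = ∑ k, (P k i * x i) • b k := fun i => by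
        conv_lhs => rw [hexp i, Finset.smul_sum]
        exact Finset.sum_congr rfl fun k _ => by rw [smul_smul, mul_comm]
      simp only [h2]
      rw [Finset.sum_comm]
      refine Finset.sum_eq_zero fun k _ => ?_
      rw [← Finset.sum_smul]
      have h3 : ∑ i, P k i * x i = 0 := congrFun hx k
      rw [h3, zero_smul]
    exact funext (Fintype.linearIndependent_iff.1 he x h1)
  have hNd : N.det = -1 := by
    rw [hN, Matrix.det_diagonal, Fin.prod_univ_four]
    simp
  rw [hG, Matrix.det_mul, Matrix.det_mul, Matrix.det_transpose, hNd]
  have : 0 < P.det * P.det := mul_self_pos.2 hPd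
  linarith

theorem linearIndependent_stdVec : LinearIndependent ℝ stdVec := by
  rw [Fintype.linearIndependent_iff]
  intro x hx i
  have h := congrArg (fun v : E4 => v i) hx
  simpa [stdVec, Finset.sum_apply, Pi.single_apply] using h

/-- The scalar product at a point of a chart domain, on the coordinate space. -/
def LorentzMetric.coordForm (g : LorentzMetric M) (x : M) : E4 →ₗ[ℝ] E4 →ₗ[ℝ] ℝ := g.val x

theorem LorentzMetric.coord_apply (g : LorentzMetric M) {φ : OpenPartialHomeomorph M E4} {y : E4}
    {L : E4 →L[ℝ] E4} (hL : ∀ v : E4, mfderiv (𝓡 4) (𝓡 4) φ.symm y v = L v) (i j : Fin 4) :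
    g.coord φ y i j = g.coordForm (φ.symm y) (L (stdVec i)) (L (stdVec j)) :=
  congrArg₂ (fun v w : E4 => g.coordForm (φ.symm y) v w) (hL (stdVec i)) (hL (stdVec j))

/-- The derivative of the inverse chart is injective, so the coordinate vectors are independent and
their Gram matrix is congruent to diag(-1, 1, 1, 1). Of the signature only the sign of the
determinant is kept. -/
theorem LorentzMetric.isLorentzOn_coord (g : LorentzMetric M) {φ : OpenPartialHomeomorph M E4}
    (hφ : φ ∈ IsManifold.maximalAtlas (𝓡 4) ∞ M) : IsLorentzOn (g.coord φ) φ.target where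
  isOpen := φ.open_target
  smooth y hy i j := (g.smooth φ hφ i j).contDiffAt (φ.open_target.mem_nhds hy)
  symm y hy := by
    ext i j
    exact g.symm _ _ _
  det_neg y hy := by
    obtain ⟨b, hb⟩ := g.signature (φ.symm y)
    obtain ⟨L, K, hL, -, hKL, -⟩ := mfderiv_chart_symm hφ hy
    have h1 : LinearIndependent ℝ fun i => L (stdVec i) :=
      linearIndependent_stdVec.map' (L : E4 →ₗ[ℝ] E4)
        (LinearMap.ker_eq_bot.2 (Function.LeftInverse.injective hKL))
    have h2 : g.coord φ y = Matrix.of fun i j =>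
        g.coordForm (φ.symm y) (L (stdVec i)) (L (stdVec j)) := by
      ext i j
      exact g.coord_apply hL i j
    rw [h2]
    exact gram_det_neg (g.coordForm (φ.symm y)) b hb h1

theorem FrameBundle.coord_mem {φ : OpenPartialHomeomorph M E4}
    (hφ : φ ∈ IsManifold.maximalAtlas (𝓡 4) ∞ M) {u : FrameBundle M} (hu : u.base ∈ φ.source) :
    u.coord φ ∈ framesOver φ.target := by
  obtain ⟨x, b⟩ := u
  obtain ⟨y, hy, rfl⟩ : ∃ y ∈ φ.target, φ.symm y = x := ⟨φ x, φ.map_source hu, φ.left_inv hu⟩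
  obtain ⟨L, K, -, hK, -, hLK⟩ := mfderiv_chart_symm hφ hy
  refine ⟨φ.map_source hu, det_ne_zero_of_mulVec fun x hx => ?_⟩
  let b' : Module.Basis (Fin 4) ℝ E4 := b
  have hA : ∀ i a, frameMat (FrameBundle.coord φ ⟨φ.symm y, b⟩) i a = K (b' a) i := fun i a =>
    congrArg (fun v : E4 => v i) (hK (b' a))
  have h1 : K (∑ a, x a • b' a) = 0 := by
    rw [map_sum]
    ext i
    have h2 := congrFun hx i
    rw [Matrix.mulVec, dotProduct] at h2
    simp only [hA] at h2
    simp only [map_smul, WithLp.ofLp_sum, WithLp.ofLp_smul, Finset.sum_apply, Pi.smul_apply,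
      smul_eq_mul]
    refine Eq.trans (Finset.sum_congr rfl fun a _ => mul_comm _ _) h2
  have h2 : ∑ a, x a • b' a = 0 := by
    rw [← hLK (∑ a, x a • b' a), h1, map_zero]
  exact funext (Fintype.linearIndependent_iff.1 b'.linearIndependent x h2)

/-- The frame is expanded in the coordinate vectors, its coefficients being the chart coordinates A.
This translates the hypothesis of constant g_{ab} into the chart. -/
theorem LorentzMetric.gFrame_coord (g : LorentzMetric M) {φ : OpenPartialHomeomorph M E4}
    (hφ : φ ∈ IsManifold.maximalAtlas (𝓡 4) ∞ M) {u : FrameBundle M} (hu : u.base ∈ φ.source)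
    (a b : Fin 4) :
    gFrame (g.coord φ) (u.coord φ) a b = g.val u.base (u.frame a) (u.frame b) := by
  obtain ⟨x, u⟩ := u
  obtain ⟨y, hy, rfl⟩ : ∃ y ∈ φ.target, φ.symm y = x := ⟨φ x, φ.map_source hu, φ.left_inv hu⟩
  obtain ⟨L, K, hL, hK, -, hLK⟩ := mfderiv_chart_symm hφ hy
  let f : Module.Basis (Fin 4) ℝ E4 := u
  let A : Fin 4 → Fin 4 → ℝ := (FrameBundle.coord φ ⟨φ.symm y, u⟩).2
  have h1 : (FrameBundle.coord φ ⟨φ.symm y, u⟩).1 = y := φ.right_inv hy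
  have hA : ∀ i a, A i a = K (f a) i := fun i a => congrArg (fun v : E4 => v i) (hK (f a))
  have hf : ∀ a, f a = ∑ i, A i a • L (stdVec i) := fun a => by
    have h2 : K (f a) = ∑ i, A i a • stdVec i := by
      rw [vec_eq_sum_stdVec (K (f a))]
      simp only [hA]
    have h3 := hLK (f a)
    rw [h2, map_sum] at h3
    simp only [map_smul] at h3
    exact h3.symm
  set B := g.coordForm (φ.symm y) with hBdef
  have hB : B (f a) (f b) = ∑ i, ∑ j, B (L (stdVec i)) (L (stdVec j)) * A i a * A j b := by
    rw [hf a, hf b]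
    simp only [map_sum, LinearMap.sum_apply, map_smul, LinearMap.smul_apply, smul_eq_mul,
      Finset.mul_sum]
    rw [Finset.sum_comm]
    refine Finset.sum_congr rfl fun i _ => Finset.sum_congr rfl fun j _ => ?_
    ring
  refine Eq.trans ?_ hB.symm
  rw [gFrame, Matrix.of_apply, h1]
  refine Finset.sum_congr rfl fun i _ => Finset.sum_congr rfl fun j _ => ?_
  rw [g.coord_apply hL]

variable {U : Set M} {σ : M → FrameBundle M} {φ : OpenPartialHomeomorph M E4}

theorem IsLocalSection.eventually_mem (hσ : IsLocalSection U σ) {x : M} (hx : x ∈ U ∩ φ.source) :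
    ∀ᶠ z in nhds (φ x), z ∈ φ.target ∧ φ.symm z ∈ U := by
  have h1 : IsOpen (φ.target ∩ φ.symm ⁻¹' U) := φ.symm.isOpen_inter_preimage hσ.1
  refine h1.mem_nhds ⟨φ.map_source hx.2, ?_⟩
  rw [Set.mem_preimage, φ.left_inv hx.2]
  exact hx.1

theorem IsLocalSection.sectionCoord_mem (hσ : IsLocalSection U σ)
    (hφ : φ ∈ IsManifold.maximalAtlas (𝓡 4) ∞ M) {z : E4} (hz : z ∈ φ.target)
    (hzU : φ.symm z ∈ U) :
    sectionCoord φ σ z ∈ framesOver φ.target ∧ (sectionCoord φ σ z).1 = z := by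
  have h1 := hσ.2.1 _ hzU
  refine ⟨FrameBundle.coord_mem hφ (by rw [h1]; exact φ.map_target hz), ?_⟩
  change φ (σ (φ.symm z)).base = z
  rw [h1, φ.right_inv hz]

theorem IsLocalSection.contDiffAt_sectionCoord (hσ : IsLocalSection U σ)
    (hφ : φ ∈ IsManifold.maximalAtlas (𝓡 4) ∞ M) {x : M} (hx : x ∈ U ∩ φ.source) :
    ContDiffAt ℝ ∞ (sectionCoord φ σ) (φ x) :=
  (hσ.2.2 φ hφ).contDiffAt (hσ.eventually_mem hx)

end Coordinates

end Superenergy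

end

/-! ### Assembly of the theorem -/

theorem mainTheorem2 {M : Type*} [TopologicalSpace M] [ChartedSpace E4 M] [IsManifold (𝓡 4) ∞ M]
    (g : LorentzMetric M) :
    -- the forms on the frame bundle, in the natural chart induced by any chart of `M`
    (∀ φ ∈ IsManifold.maximalAtlas (𝓡 4) ∞ M,
      -- the identity
      (∀ p ∈ frameDomain φ, ∀ a b c : Fin 4,
        extDeriv (potential (g.coord φ) a b c) p
          = (∑ d, ∑ e, wedge (xi (g.coord φ) d e a b c p) (connLow (g.coord φ) d e p))
            + kForm (g.coord φ) a b c p + belRobinson (g.coord φ) a b c p) ∧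
      -- the character of the three terms
      IsTensorial (frameDomain φ) (twistedRep 0 3)
        (fun I => belRobinson (g.coord φ) (I.2 0) (I.2 1) (I.2 2)) ∧
      IsTensorial (frameDomain φ) (twistedRep 0 3)
        (fun I => kForm (g.coord φ) (I.2 0) (I.2 1) (I.2 2)) ∧
      IsPseudoTensorial (frameDomain φ) (twistedRep 2 3)
        (fun I => xi (g.coord φ) (I.1 0) (I.1 1) (I.2 0) (I.2 1) (I.2 2)) ∧
      (∀ p ∈ frameDomain φ,
        (∀ d e a b c, IsHorizontalAt p (xi (g.coord φ) d e a b c p)) →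
          ∀ a b c d, weylTensor (g.coord φ) a b c d p = 0) ∧
      -- the dual of `𝒦` and its algebraic properties
      (∀ p ∈ frameDomain φ,
        (∀ a b c, hodge (g.coord φ) (kForm (g.coord φ) a b c) p
          = ∑ j, kTensor (g.coord φ) j a b c p • theta j p) ∧
        (∀ j a b c, kTensor (g.coord φ) j a b c p = kTensor (g.coord φ) j a c b p) ∧
        (∀ j c, ∑ a, ∑ b, gInv (g.coord φ) p a b * kTensor (g.coord φ) j a b c p = 0) ∧
        (∀ j a, ∑ b, ∑ c, gInv (g.coord φ) p b c * kTensor (g.coord φ) j a b c p = 0) ∧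
        (∀ c, ∑ a, ∑ b, gInv (g.coord φ) p a b • kForm (g.coord φ) a b c p = 0) ∧
        (∀ a, ∑ b, ∑ c, gInv (g.coord φ) p b c • kForm (g.coord φ) a b c p = 0))) ∧
    -- the conservation law on `M`, for any smooth local section
    (∀ (U : Set M) (σ : M → FrameBundle M), IsLocalSection U σ →
      ∀ φ ∈ IsManifold.maximalAtlas (𝓡 4) ∞ M, ∀ x ∈ U ∩ φ.source, ∀ a b c : Fin 4,
        divergence (g.coord φ)
          (starBase (g.coord φ) (sectionCoord φ σ)
            (pullback (sectionCoord φ σ) (extDeriv (potential (g.coord φ) a b c)))) (φ x) = 0 ∧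
        divergence (g.coord φ)
          (starBase (g.coord φ) (sectionCoord φ σ)
              (pullback (sectionCoord φ σ) (xiConn (g.coord φ) a b c))
            + starBase (g.coord φ) (sectionCoord φ σ)
              (pullback (sectionCoord φ σ) (kForm (g.coord φ) a b c))
            + starBase (g.coord φ) (sectionCoord φ σ)
              (pullback (sectionCoord φ σ) (belRobinson (g.coord φ) a b c))) (φ x) = 0) ∧
    -- along frame fields with constant `g_{ab}`, the connection in `Ξ` may act on the second index
    (∀ (U : Set M) (σ : M → FrameBundle M), IsLocalSection U σ →
      (∃ C : Fin 4 → Fin 4 → ℝ, ∀ x ∈ U, ∀ a b,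
        g.val (σ x).base ((σ x).frame a) ((σ x).frame b) = C a b) →
      ∀ φ ∈ IsManifold.maximalAtlas (𝓡 4) ∞ M, ∀ x ∈ U ∩ φ.source, ∀ a b c : Fin 4,
        pullback (sectionCoord φ σ) (extDeriv (potential (g.coord φ) a b c)) (φ x)
          = pullback (sectionCoord φ σ) (xiSndConn (g.coord φ) a b c) (φ x)
            + pullback (sectionCoord φ σ) (kForm (g.coord φ) a b c) (φ x)
            + pullback (sectionCoord φ σ) (belRobinson (g.coord φ) a b c) (φ x)) := by
  refine ⟨fun φ hφ => ?_, fun U σ hσ φ hφ x hx a b c => ?_, fun U σ hσ hC φ hφ x hx a b c => ?_⟩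
  · have hG := g.isLorentzOn_coord hφ
    -- `frameDomain φ` and `framesOver φ.target` agree by definition.
    exact ⟨fun p hp a b c => hG.extDeriv_potential hp a b c, hG.isTensorial_belRobinson,
      hG.isTensorial_kForm, hG.isPseudoTensorial_xi,
      fun p hp h a b c d => hG.weylTensor_eq_zero_of_isHorizontalAt_xi hp h a b c d,
      fun p hp => ⟨fun a b c => hG.hodge_kForm hp a b c, fun j a b c => hG.kTensor_symm hp j a b c,
        fun j c => hG.kTensor_trace_fst hp j c, fun j a => hG.kTensor_trace_snd hp j a,
        fun c => hG.kForm_trace_fst hp c, fun a => hG.kForm_trace_snd hp a⟩⟩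
  · have hG := g.isLorentzOn_coord hφ
    have hs : ∀ᶠ z in nhds (φ x), sectionCoord φ σ z ∈ framesOver φ.target ∧
        (sectionCoord φ σ z).1 = z :=
      (hσ.eventually_mem hx).mono fun z hz => hσ.sectionCoord_mem hφ hz.1 hz.2
    have hc := hσ.contDiffAt_sectionCoord hφ hx
    exact ⟨hG.divergence_potential hs hc a b c, hG.divergence_terms hs hc a b c⟩
  · have hG := g.isLorentzOn_coord hφ
    obtain ⟨C, hC⟩ := hC
    have hx' := (hσ.eventually_mem hx).self_of_nhds
    have hs := (hσ.sectionCoord_mem hφ hx'.1 hx'.2).1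
    have hd := (hσ.contDiffAt_sectionCoord hφ hx).differentiableAt (by simp)
    have hg : ∀ᶠ z in nhds (φ x), ∀ a b, gFrame (g.coord φ) (sectionCoord φ σ z) a b = C a b := by
      filter_upwards [hσ.eventually_mem hx] with z hz a b
      have hb : (σ (φ.symm z)).base ∈ φ.source := by
        rw [hσ.2.1 _ hz.2]
        exact φ.map_target hz.1
      exact (g.gFrame_coord hφ hb a b).trans (hC _ hz.2 a b)
    have h : ∀ y : E4, y = φ x →
        pullback (sectionCoord φ σ) (extDeriv (potential (g.coord φ) a b c)) y
          = pullback (sectionCoord φ σ) (xiSndConn (g.coord φ) a b c) y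
            + pullback (sectionCoord φ σ) (kForm (g.coord φ) a b c) y
            + pullback (sectionCoord φ σ) (belRobinson (g.coord φ) a b c) y := by
      intro y hy
      exact hG.pullback_extDeriv_potential (by rw [hy]; exact hs) (by rw [hy]; exact hd)
        (by rw [hy]; exact hg) a b c
    exact h _ rfl
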